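/- Let $\pi=\mathbb{C}[b_{-1},b_{-2},\dots]|0\rangle$ be the Heisenberg vertex algebra of rank one: $b_n$ acts by multiplication for $n<0$, by $0$ for $n=0$ and by $n\,\partial/\partial b_{-n}$ for $n>0$; $b_{-n}$ has weight $n$; $T$ is the derivation with $Tb_{-n}=n\,b_{-n-1}$; and $Y(b_{-k_1-1}\cdots b_{-k_r-1}|0\rangle,z)={:}\tfrac{1}{k_1!}\partial^{k_1}b(z)\cdots\tfrac{1}{k_r!}\partial^{k_r}b(z){:}$ with $b(z)=\sum_n b_nz^{-n-1}$. Write $Y(a,z)=\sum_n a_{(n)}z^{-n-1}$. Let $\mathfrak{L}=(\pi\otimes\mathbb{C}[t,t^{-1}])/\mathrm{Im}(T\otimes 1+1\otimes\tfrac{d}{dt})$, let $a_{[n]}$ be the class of $a\otimes t^n$, of degree $\deg a-n-1$ for homogeneous $a$, with Lie bracket $[a_{[m]},b_{[n]}]=\sum_{k\ge0}\binom{m}{k}(a_{(k)}b)_{[m+n-k]}$. Let $U=\bigoplus_d U_d$ be the universal enveloping algebra of $\mathfrak{L}$, with the topology in which the left ideals $N^nU=U\cdot U_{\le -n}$ form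 a basis of neighbourhoods of $0$, and let $\widehat U=\bigoplus_d\widehat U_d$ with $\widehat U_d=\varprojlim_n U_d/(N^nU\cap U_d)$ be its graded completion, where $N^n\widehat U$ is the closure of $N^nU$ in $\widehat U$. Let $\bar J$ be the closure of the two-sided ideal of $\widehat U$ generated by $|0\rangle_{[-1]}-1$ and by the Jacobi relations $$\sum_{i\ge 0}(-1)^i\binom{\ell}{i}\left(a_{[m+\ell-i]}b_{[n+i]}-(-1)^{\ell}b_{[n+\ell-i]}a_{[m+i]}\right)-\sum_{i\ge 0}\binom{m}{i}(a_{(\ell+i)}b)_{[m+n-i]}\qquad(a,b\in\pi,\ \ell,m,n\in\mathbb{Z}),$$ and put $\mathscr{U}=\widehat U/\bar J$, graded by the images $\mathscr{U}_d$ of $\widehat U_d$, with $N^n\mathscr{U}_0$ the intersection of $\mathscr{U}_0$ with the image of $N^n\widehat U$. For $d\in\mathbb{Z}$ the $d$-th higher level Zhu algebra is $\mathsf{A}_d(\pi)=\mathscr{U}_0/N^{d+1}\mathscr{U}_0$; it is zero for $d<0$. Then for every integer $d\ge0$ there are isomorphisms of $\mathbb{C}$-algebras $$\mathsf{A}_d(\pi)\cong\mathrm{Mat}_{p(d)}(\mathbb{C}[x])\oplus\mathsf{A}_{d-1}(\pi)\qquad\text{and}\qquad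 \mathsf{A}_d(\pi)\cong\prod_{j=0}^d\mathrm{Mat}_{p(j)}(\mathbb{C}[x]),$$ where $p(j)$ is the number of partitions of $j$ into positive integers, $p(0)=1$, and $\oplus$ denotes the direct product of algebras. -/

import Mathlib

open scoped Polynomial

noncomputable section

namespace Heisenberg

/-! ### The Heisenberg vertex algebra -/

/-- The Fock space `π = ℂ[b₋₁, b₋₂, …]|0⟩`. The variable `X k` stands for the creation operator
`b₋₍ₖ₊₁₎`, so that the monomial `X k₁ ⋯ X kᵣ` is the state `b₋ₖ₁₋₁ ⋯ b₋ₖᵣ₋₁|0⟩`. -/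
abbrev Fock : Type := MvPolynomial ℕ ℂ

/-- The vacuum vector `|0⟩`. -/
def vacuum : Fock := 1

/-- The oscillators `bₙ` acting on `π`: multiplication by the variable `b₋ₙ` for `n < 0`, zero for
`n = 0`, and `n ∂/∂b₋ₙ` for `n > 0`, so that `[bₘ, bₙ] = m δ_{m+n,0}`. -/
def oscillator : ℤ → Module.End ℂ Fock
  | Int.ofNat 0 => 0
  | Int.ofNat (k + 1) => ((k : ℂ) + 1) • (MvPolynomial.pderiv k).toLinearMap
  | Int.negSucc k => LinearMap.mulLeft ℂ (MvPolynomial.X k)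

/-- The piece `π_n` of conformal weight `n`, where `b₋₍ₖ₊₁₎` has weight `k + 1`. -/
def weightSpace (n : ℕ) : Submodule ℂ Fock :=
  MvPolynomial.weightedHomogeneousSubmodule ℂ (fun k : ℕ => k + 1) n

/-- The translation operator `T = L₋₁` of `π`: the derivation with `T|0⟩ = 0` and
`T b₋ₙ = n b₋ₙ₋₁`. -/
def translation : Module.End ℂ Fock :=
  (MvPolynomial.mkDerivation ℂ fun k : ℕ =>
    ((k : ℂ) + 1) • (MvPolynomial.X (k + 1) : Fock)).toLinearMap

/-- A family of modes `(Aₙ)` with `Aₙ v = 0` for `n ≫ 0` gives the field `∑ₙ Aₙ z⁻ⁿ⁻¹`. -/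
def ofModes (A : ℤ → Module.End ℂ Fock) (hA : ∀ v, ∃ N : ℤ, ∀ n, N ≤ n → A n v = 0) :
    VertexOperator ℂ Fock :=
  VertexOperator.of_coeff (fun k => A (-k - 1)) fun v => by
    obtain ⟨N, hN⟩ := hA v
    refine ⟨-N, fun k hk => ?_⟩
    by_contra h
    exact hk (hN _ (by omega))

/-- Fields are truncated: `Aₙ v = 0` for `n ≫ 0`. -/
theorem exists_ncoeff_eq_zero (A : VertexOperator ℂ Fock) (v : Fock) :
    ∃ N : ℤ, ∀ n, N ≤ n → VertexOperator.ncoeff A n v = 0 :=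
  ⟨-((HahnModule.of ℂ).symm (A v)).order, fun n hn =>
    VertexOperator.ncoeff_eq_zero_of_lt_order A n v (by omega)⟩

theorem exists_oscillator_eq_zero (v : Fock) :
    ∃ N : ℤ, ∀ n, N ≤ n → oscillator n v = 0 := by
  refine ⟨(v.vars.sup id : ℕ) + 2, fun n hn => ?_⟩
  match n, hn with
  | Int.ofNat 0, _ => simp [oscillator]
  | Int.ofNat (k + 1), hn =>
    have hk : k ∉ v.vars := fun h => by
      have h1 : k ≤ v.vars.sup id := Finset.le_sup (f := id) h
      simp only [Int.ofNat_eq_natCast] at hn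
      push_cast at hn
      omega
    simp [oscillator, MvPolynomial.pderiv_eq_zero_of_notMem_vars hk]
  | Int.negSucc k, hn => omega

/-- The field `Y(b₋₍ₖ₊₁₎|0⟩, z) = (1/k!) ∂ᵏ b(z)`, where `b(z) = ∑ₙ bₙ z⁻ⁿ⁻¹`. Its coefficient at
`z⁻ⁿ⁻¹` is `(-1)ᵏ (n choose k) bₙ₋ₖ`. -/
def oscillatorField (k : ℕ) : VertexOperator ℂ Fock :=
  ofModes (fun n => ((-1 : ℤ) ^ k * Ring.choose n k) • oscillator (n - k)) fun v => by
    obtain ⟨N, hN⟩ := exists_oscillator_eq_zero v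
    exact ⟨N + k, fun n hn => by simp [hN (n - k) (by omega)]⟩

theorem finite_support_nat {v : ℤ → Fock} (h : ∃ N : ℤ, ∀ n, N ≤ n → v n = 0) (c : ℤ)
    {F : ℤ → Module.End ℂ Fock} :
    (Function.support fun i : ℕ => F i (v (c + i))).Finite := by
  obtain ⟨N, hN⟩ := h
  refine (Set.finite_lt_nat (N - c).toNat).subset fun i hi => ?_
  by_contra h'
  simp only [Set.mem_ofPred_eq, not_lt] at h'
  exact hi (by simp [hN (c + i) (by omega)])

/-- The `n`-th mode of the normally ordered product `:A(z)B(z): = A(z)₊B(z) + B(z)A(z)₋`, where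
`A(z)₊ = ∑_{j < 0} Aⱼ z⁻ʲ⁻¹` and `A(z)₋ = ∑_{j ≥ 0} Aⱼ z⁻ʲ⁻¹`. Both sums are finite on each vector. -/
def normalOrderMode (A B : VertexOperator ℂ Fock) (n : ℤ) : Module.End ℂ Fock where
  toFun v :=
    (∑ᶠ i : ℕ, VertexOperator.ncoeff A (-1 - i) (VertexOperator.ncoeff B (n + i) v)) +
      ∑ᶠ i : ℕ, VertexOperator.ncoeff B (n - 1 - i) (VertexOperator.ncoeff A (0 + i) v)
  map_add' v w := by
    have hB := fun u => finite_support_nat (exists_ncoeff_eq_zero B u) n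
      (F := fun i => VertexOperator.ncoeff A (-1 - i))
    have hA := fun u => finite_support_nat (exists_ncoeff_eq_zero A u) 0
      (F := fun i => VertexOperator.ncoeff B (n - 1 - i))
    simp only [map_add]
    rw [finsum_add_distrib (hB v) (hB w), finsum_add_distrib (hA v) (hA w)]
    abel
  map_smul' c v := by
    have hB := finite_support_nat (exists_ncoeff_eq_zero B v) n
      (F := fun i => VertexOperator.ncoeff A (-1 - i))
    have hA := finite_support_nat (exists_ncoeff_eq_zero A v) 0
      (F := fun i => VertexOperator.ncoeff B (n - 1 - i))
    simp only [map_smul, RingHom.id_apply, smul_add]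
    rw [smul_finsum' c hB, smul_finsum' c hA]

/-- The normally ordered product `:A(z)B(z):` of two fields. -/
def normalOrder (A B : VertexOperator ℂ Fock) : VertexOperator ℂ Fock :=
  ofModes (normalOrderMode A B) fun v => by
    obtain ⟨NA, hNA⟩ := exists_ncoeff_eq_zero A v
    obtain ⟨NB, hNB⟩ := exists_ncoeff_eq_zero B v
    choose M hM using fun i : ℕ =>
      exists_ncoeff_eq_zero B (VertexOperator.ncoeff A (0 + (i : ℤ)) v)
    obtain ⟨K, hK⟩ : ∃ K : ℤ, ∀ i ∈ Finset.range NA.toNat, M i + i + 1 ≤ K := by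
      refine ⟨∑ i ∈ Finset.range NA.toNat, |M i + i + 1|, fun i hi => ?_⟩
      exact (le_abs_self _).trans
        (Finset.single_le_sum (f := fun i : ℕ => |M i + (i : ℤ) + 1|)
          (fun j _ => abs_nonneg _) hi)
    refine ⟨max NB K, fun n hn => ?_⟩
    have h1 : ∀ i : ℕ, VertexOperator.ncoeff A (-1 - (i : ℤ))
        (VertexOperator.ncoeff B (n + i) v) = 0 := fun i => by
      rw [hNB (n + i) (by have := le_max_left NB K; omega), map_zero]
    have h2 : ∀ i : ℕ, VertexOperator.ncoeff B (n - 1 - (i : ℤ))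
        (VertexOperator.ncoeff A (0 + (i : ℤ)) v) = 0 := fun i => by
      by_cases hi : i < NA.toNat
      · have := hK i (Finset.mem_range.2 hi)
        have := le_max_right NB K
        exact hM i _ (by omega)
      · rw [hNA (0 + i) (by omega), map_zero]
    simp only [normalOrderMode, LinearMap.coe_mk, AddHom.coe_mk, h1, h2, finsum_zero, add_zero]

/-- The identity field `Y(|0⟩, z) = id`. -/
def identityField : VertexOperator ℂ Fock :=
  ofModes (fun n => if n = -1 then LinearMap.id else 0) fun _ =>
    ⟨0, fun n hn => by rw [if_neg (by omega)]; rfl⟩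

/-- The state-field correspondence of `π`, with
`Y(b₋ₖ₁₋₁ ⋯ b₋ₖᵣ₋₁|0⟩, z) = :(1/k₁!)∂ᵏ¹b(z) ⋯ (1/kᵣ!)∂ᵏʳb(z):`
(normally ordered products nested to the right). -/
def Y : Fock →ₗ[ℂ] VertexOperator ℂ Fock :=
  (MvPolynomial.basisMonomials ℕ ℂ).constr ℂ fun s : ℕ →₀ ℕ =>
    ((Finsupp.toMultiset s).sort).foldr (fun k A => normalOrder (oscillatorField k) A)
      identityField

/-- The `n`-th product `a₍ₙ₎b`, where `Y(a, z) = ∑ₙ a₍ₙ₎ z⁻ⁿ⁻¹`. -/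
def nthProduct (n : ℤ) (a b : Fock) : Fock := VertexOperator.ncoeff (Y a) n b

/-! ### The finite ancillary Lie algebra and its enveloping algebra -/

/-- The operator `∇ = L₋₁ ⊗ id + id ⊗ d/dt` on `π ⊗ ℂ[t, t⁻¹]`. The element `∑ₙ aₙ ⊗ tⁿ` of this
tensor product is the finitely supported function `n ↦ aₙ`. -/
def nabla : (ℤ →₀ Fock) →ₗ[ℂ] (ℤ →₀ Fock) :=
  Finsupp.lsum ℂ fun n : ℤ =>
    Finsupp.lsingle n ∘ₗ translation + (n : ℂ) • Finsupp.lsingle (n - 1)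

/-- The vector space `𝔏(π)ᶠ = (π ⊗ ℂ[t, t⁻¹]) / Im ∇`. -/
abbrev Ancillary : Type := (ℤ →₀ Fock) ⧸ LinearMap.range nabla

/-- The class `a_[n]` of `a ⊗ tⁿ` in `𝔏(π)ᶠ`. -/
def bracketMode (a : Fock) (n : ℤ) : Ancillary :=
  (LinearMap.range nabla).mkQ (Finsupp.single n a)

/-- The Lie bracket `[a_[m], b_[n]] = ∑_{k ≥ 0} (m choose k) (a₍ₖ₎b)_[m+n-k]` of `𝔏(π)ᶠ`, on
generators. -/
def lieBracket (a b : Fock) (m n : ℤ) : Ancillary :=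
  ∑ᶠ k : ℕ, Ring.choose m k • bracketMode (nthProduct k a b) (m + n - k)

/-- The relations `xy = yx + [x, y]` that define the universal enveloping algebra of `𝔏(π)ᶠ` as a
quotient of its tensor algebra. -/
inductive EnvelopingRel : TensorAlgebra ℂ Ancillary → TensorAlgebra ℂ Ancillary → Prop
  | lie (a b : Fock) (m n : ℤ) : EnvelopingRel
      (TensorAlgebra.ι ℂ (bracketMode a m) * TensorAlgebra.ι ℂ (bracketMode b n))
      (TensorAlgebra.ι ℂ (bracketMode b n) * TensorAlgebra.ι ℂ (bracketMode a m) +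
        TensorAlgebra.ι ℂ (lieBracket a b m n))

/-- The universal enveloping algebra `U` of the Lie algebra `𝔏(π)ᶠ`. -/
def Enveloping : Type := RingQuot EnvelopingRel

instance : Ring Enveloping := inferInstanceAs (Ring (RingQuot EnvelopingRel))

instance : Algebra ℂ Enveloping := inferInstanceAs (Algebra ℂ (RingQuot EnvelopingRel))

/-- The projection of the tensor algebra onto `U`. -/
def envProj : TensorAlgebra ℂ Ancillary →ₐ[ℂ] Enveloping := RingQuot.mkAlgHom ℂ EnvelopingRel

/-- The canonical map `𝔏(π)ᶠ → U`. -/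
def envι : Ancillary →ₗ[ℂ] Enveloping := envProj.toLinearMap ∘ₗ TensorAlgebra.ι ℂ

/-- Products of homogeneous generators: `a_[n]` has degree `wt a - n - 1`. -/
inductive IsMonomial : ℤ → Enveloping → Prop
  | one : IsMonomial 0 1
  | mul {w : ℕ} {a : Fock} (ha : a ∈ weightSpace w) (n : ℤ) {d : ℤ} {u : Enveloping}
      (hu : IsMonomial d u) : IsMonomial (w - n - 1 + d) (envι (bracketMode a n) * u)

/-- The graded piece `U_d` of the enveloping algebra. -/
def gradedPiece (d : ℤ) : Submodule ℂ Enveloping := Submodule.span ℂ {u | IsMonomial d u}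

/-- The left ideal `N_L^n U = U · U_{≤ -n}`. -/
def leftNhd (n : ℤ) : Ideal Enveloping := Ideal.span {u | ∃ j : ℤ, j ≤ -n ∧ u ∈ gradedPiece j}

theorem leftNhd_anti {m n : ℤ} (h : m ≤ n) : leftNhd n ≤ leftNhd m :=
  Ideal.span_mono fun _ ⟨j, hj, hu⟩ => ⟨j, by omega, hu⟩

theorem IsMonomial.mul_mul {d e : ℤ} {u v : Enveloping} (hu : IsMonomial d u)
    (hv : IsMonomial e v) : IsMonomial (d + e) (u * v) := by
  induction hu with
  | one => simpa using hv
  | mul ha n _ ih =>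
    rw [mul_assoc, add_assoc]
    exact IsMonomial.mul ha n ih

theorem mul_mem_gradedPiece {d e : ℤ} {u v : Enveloping} (hu : u ∈ gradedPiece d)
    (hv : v ∈ gradedPiece e) : u * v ∈ gradedPiece (d + e) := by
  have h := Submodule.mul_mem_mul hu hv
  rw [gradedPiece, gradedPiece, Submodule.span_mul_span] at h
  refine Submodule.span_mono ?_ h
  rintro _ ⟨x, hx, y, hy, rfl⟩
  exact IsMonomial.mul_mul hx hy

theorem mul_mem_leftNhd {n e : ℤ} {u v : Enveloping} (hu : u ∈ leftNhd n)
    (hv : v ∈ gradedPiece e) : u * v ∈ leftNhd (n - e) := by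
  induction hu using Submodule.span_induction with
  | mem x hx =>
    obtain ⟨j, hj, hx⟩ := hx
    exact Ideal.subset_span ⟨j + e, by omega, mul_mem_gradedPiece hx hv⟩
  | zero => simp
  | add x y _ _ hx hy => rw [add_mul]; exact add_mem hx hy
  | smul c x _ hx => rw [smul_eq_mul, mul_assoc]; exact Ideal.mul_mem_left _ _ hx

/-- The degree zero subalgebra `U₀`. -/
def degreeZero : Subalgebra ℂ Enveloping :=
  (gradedPiece 0).toSubalgebra (Submodule.subset_span IsMonomial.one) fun _ _ hu hv => by
    simpa using mul_mem_gradedPiece hu hv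

/-- Right multiplication by a fixed element is continuous for the left ideals `N_L^n U`. -/
theorem exists_mul_mem_leftNhd (x : Enveloping) (i : ℤ) :
    ∃ j : ℤ, ∀ u ∈ leftNhd j, u * x ∈ leftNhd i := by
  obtain ⟨y, rfl⟩ : ∃ y, envProj y = x := RingQuot.mkAlgHom_surjective ℂ EnvelopingRel x
  revert i
  have hadd : ∀ x y : Enveloping, (∀ i, ∃ j : ℤ, ∀ u ∈ leftNhd j, u * x ∈ leftNhd i) →
      (∀ i, ∃ j : ℤ, ∀ u ∈ leftNhd j, u * y ∈ leftNhd i) →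
      ∀ i, ∃ j : ℤ, ∀ u ∈ leftNhd j, u * (x + y) ∈ leftNhd i := by
    intro x y hx hy i
    obtain ⟨j, hj⟩ := hx i
    obtain ⟨k, hk⟩ := hy i
    refine ⟨max j k, fun u hu => ?_⟩
    rw [mul_add]
    exact add_mem (hj _ (leftNhd_anti (le_max_left _ _) hu))
      (hk _ (leftNhd_anti (le_max_right _ _) hu))
  induction y using TensorAlgebra.induction with
  | algebraMap r =>
    intro i
    refine ⟨i, fun u hu => ?_⟩
    rw [AlgHom.commutes]
    exact (Algebra.commutes r u) ▸ Ideal.mul_mem_left _ _ hu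
  | ι z =>
    obtain ⟨f, rfl⟩ := Submodule.mkQ_surjective _ z
    induction f using Finsupp.induction_linear with
    | zero => intro i; exact ⟨i, fun u hu => by simp⟩
    | add f g hf hg => simpa only [map_add] using hadd _ _ hf hg
    | single n a =>
      induction a using MvPolynomial.induction_on' with
      | add p q hp hq =>
        simpa only [Finsupp.single_add, map_add] using hadd _ _ hp hq
      | monomial s c =>
        intro i
        have hs : MvPolynomial.monomial s c ∈
            weightSpace (Finsupp.weight (fun k : ℕ => k + 1) s) :=
          MvPolynomial.isWeightedHomogeneous_monomial _ _ _ rfl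
        have hm : envι (bracketMode (MvPolynomial.monomial s c) n) ∈ gradedPiece _ :=
          Submodule.subset_span (by simpa using IsMonomial.mul hs n IsMonomial.one)
        exact ⟨i + (_ : ℤ), fun u hu => by
          have := mul_mem_leftNhd hu hm
          rwa [add_sub_cancel_right] at this⟩
  | mul p q hp hq =>
    intro i
    obtain ⟨j, hj⟩ := hq i
    obtain ⟨k, hk⟩ := hp j
    refine ⟨k, fun u hu => ?_⟩
    rw [map_mul]
    exact (mul_assoc u _ _) ▸ hj _ (hk u hu)
  | add p q hp hq => simpa only [map_add] using hadd _ _ hp hq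

theorem leftNhd_basis :
    RingSubgroupsBasis fun n : ℤ => Submodule.toAddSubgroup (leftNhd n) where
  inter i j := ⟨max i j, fun _ hu =>
    ⟨leftNhd_anti (le_max_left _ _) hu, leftNhd_anti (le_max_right _ _) hu⟩⟩
  mul i := ⟨i, by
    rintro _ ⟨x, _, y, hy, rfl⟩
    exact Ideal.mul_mem_left _ _ hy⟩
  leftMul _ i := ⟨i, fun _ hu => Ideal.mul_mem_left _ _ hu⟩
  rightMul x i := exists_mul_mem_leftNhd x i

/-! ### Completion -/

/-- The topology of `U` for which the left ideals `N_L^n U` are a basis of neighbourhoods of `0`. -/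
instance : TopologicalSpace Enveloping := leftNhd_basis.topology

instance : IsTopologicalRing Enveloping :=
  leftNhd_basis.toRingFilterBasis.isTopologicalRing

instance : UniformSpace Enveloping := IsTopologicalAddGroup.rightUniformSpace Enveloping

instance : IsUniformAddGroup Enveloping := isUniformAddGroup_of_addCommGroup

instance : UniformContinuousConstSMul ℂ Enveloping where
  uniformContinuous_const_smul c := by
    simp only [Algebra.smul_def]
    exact uniformContinuous_addMonoidHom_of_continuous
      (f := AddMonoidHom.mulLeft (algebraMap ℂ Enveloping c)) (continuous_const_mul _)

/-- The separated completion of `U`. It contains the graded completion of `U`. -/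
abbrev Completed : Type := UniformSpace.Completion Enveloping

/-- The canonical map `U → lim U / N_L^n U`. -/
def toCompleted : Enveloping →ₐ[ℂ] Completed :=
  { UniformSpace.Completion.coeRingHom with commutes' := fun _ => rfl }

/-- The piece `Û_d = lim U_d / N_L^n U_d`, as the closure of `U_d` in the completion. -/
def completedPiece (d : ℤ) : Set Completed := closure (toCompleted '' gradedPiece d)

/-- The graded completion `Û = ⨁_d Û_d`, as the subalgebra generated by the pieces `Û_d`. -/
abbrev GradedCompletion : Type :=
  Algebra.adjoin ℂ (⋃ d : ℤ, completedPiece d)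

instance : IsTopologicalRing GradedCompletion :=
  (Algebra.adjoin ℂ (⋃ d : ℤ, completedPiece d)).toSubring.instIsTopologicalRing

/-! ### The universal enveloping algebra of the vertex algebra -/

/-- The generator `a_[n]`, in `U`. -/
def mode (a : Fock) (n : ℤ) : Enveloping := envι (bracketMode a n)

/-- The `i`-th term of the left-hand side of the Jacobi identity,
`(-1)^i (ℓ choose i) (a_[m+ℓ-i] b_[n+i] - (-1)^ℓ b_[n+ℓ-i] a_[m+i])`. -/
def jacobiTerm (a b : Fock) (l m n : ℤ) (i : ℕ) : Enveloping :=
  ((-1 : ℤ) ^ i * Ring.choose l i) •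
    (mode a (m + l - i) * mode b (n + i) -
      (l.negOnePow : ℤ) • (mode b (n + l - i) * mode a (m + i)))

/-- The right-hand side of the Jacobi identity, `∑_{i ≥ 0} (m choose i) (a₍ₗ₊ᵢ₎b)_[m+n-i]`. -/
def jacobiRight (a b : Fock) (l m n : ℤ) : Enveloping :=
  envι (∑ᶠ i : ℕ, Ring.choose m i • bracketMode (nthProduct (l + i) a b) (m + n - i))

/-- The relations imposed on `Û`: the differences of the two sides of the Jacobi identities (the
left-hand side being a convergent series), and the vacuum relation `|0⟩_[-1] = 1`. -/
def relations : Set GradedCompletion :=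
  {x | (∃ (a b : Fock) (l m n : ℤ) (s : Completed),
      HasSum (fun i : ℕ => toCompleted (jacobiTerm a b l m n i)) s ∧
        (x : Completed) = s - toCompleted (jacobiRight a b l m n)) ∨
    (x : Completed) = toCompleted (mode vacuum (-1)) - 1}

/-- The closure in `Û` of the two-sided ideal generated by the relations. -/
def closedIdeal : Ideal GradedCompletion :=
  Ideal.closure (TwoSidedIdeal.asIdeal (TwoSidedIdeal.span relations))

instance : closedIdeal.IsTwoSided where
  mul_mem_of_left y hx :=
    map_mem_closure (f := fun z => z * y) (continuous_mul_const y) hx fun _ hz =>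
      TwoSidedIdeal.mul_mem_right _ _ _ hz

/-- The (finite) universal enveloping algebra `𝒰 = Û / J̄` of the vertex algebra `π`. -/
abbrev UEA : Type := GradedCompletion ⧸ closedIdeal

/-- The degree zero subalgebra `Û₀`, the closure of `U₀`. -/
def completedZero : Subalgebra ℂ GradedCompletion :=
  ((degreeZero.map toCompleted).topologicalClosure).comap (Subalgebra.val _)

/-- The degree zero subalgebra `𝒰₀`, the image of `Û₀`. -/
def UEAZero : Subalgebra ℂ UEA := completedZero.map (Ideal.Quotient.mkₐ ℂ closedIdeal)

/-- The neighbourhood `N^n Û`, the closure of `N_L^n U`. -/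
def completedNhd (n : ℤ) : Set Completed := closure (toCompleted '' leftNhd n)

theorem add_mem_completedNhd {n : ℤ} {x y : Completed} (hx : x ∈ completedNhd n)
    (hy : y ∈ completedNhd n) : x + y ∈ completedNhd n :=
  map_mem_closure₂ continuous_add hx hy (by
    rintro _ ⟨u, hu, rfl⟩ _ ⟨v, hv, rfl⟩
    exact ⟨u + v, add_mem hu hv, map_add _ _ _⟩)

theorem mul_mem_completedNhd {n : ℤ} (x : Completed) {y : Completed} (hy : y ∈ completedNhd n) :
    x * y ∈ completedNhd n := by
  refine map_mem_closure₂ (s := Set.range toCompleted) continuous_mul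
    (UniformSpace.Completion.denseRange_coe x) hy ?_
  rintro _ ⟨u, rfl⟩ _ ⟨v, hv, rfl⟩
  exact ⟨u * v, Ideal.mul_mem_left _ _ hv, map_mul _ _ _⟩

theorem completedNhd_mul_mem {n : ℤ} {x y : Completed} (hx : x ∈ completedNhd n)
    (hy : y ∈ (degreeZero.map toCompleted).topologicalClosure) : x * y ∈ completedNhd n := by
  refine map_mem_closure₂ continuous_mul hx hy ?_
  rintro _ ⟨u, hu, rfl⟩ _ ⟨v, hv, rfl⟩
  exact ⟨u * v, by simpa using mul_mem_leftNhd hu hv, map_mul _ _ _⟩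

/-- The neighbourhood `N^n 𝒰₀ = N^n 𝒰 ∩ 𝒰₀`, where `N^n 𝒰` is the image of `N^n Û`. It is a
two-sided ideal of `𝒰₀`. -/
def nhdZero (n : ℤ) : Ideal UEAZero where
  carrier := {x | ∃ y : GradedCompletion, (y : Completed) ∈ completedNhd n ∧
    Ideal.Quotient.mk closedIdeal y = x}
  zero_mem' := ⟨0, subset_closure ⟨0, zero_mem _, map_zero _⟩, map_zero _⟩
  add_mem' := by
    rintro a b ⟨y, hy, hya⟩ ⟨z, hz, hzb⟩
    exact ⟨y + z, add_mem_completedNhd hy hz, by simp [hya, hzb]⟩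
  smul_mem' := by
    rintro a b ⟨y, hy, hyb⟩
    obtain ⟨z, hz⟩ := Ideal.Quotient.mk_surjective (a : UEA)
    exact ⟨z * y, mul_mem_completedNhd _ hy, by simp [hyb, hz]⟩

instance (n : ℤ) : (nhdZero n).IsTwoSided where
  mul_mem_of_left {a} b := by
    rintro ⟨y, hy, hya⟩
    obtain ⟨z, hz, hzb⟩ := b.2
    exact ⟨y * z, completedNhd_mul_mem hy hz, by rw [map_mul, hya]; exact congrArg _ hzb⟩

/-- The `d`-th higher level Zhu algebra `A_d(π) = 𝒰₀ / N^{d+1} 𝒰₀`. For `d < 0` it is zero. -/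
abbrev HigherZhu (d : ℤ) : Type := UEAZero ⧸ nhdZero (d + 1)

end Heisenberg

end

noncomputable section

namespace Heisenberg

open MvPolynomial

/-! ### Modes attached to a family of oscillators -/

/-! The algebra `𝒰` acts on the universal Fock module `ℂ[x][b₋₁, b₋₂, …]`, on which `b₀` is
multiplication by `x`. This module is graded in degrees `≥ 0`, and its piece of degree `j` is free
over `ℂ[x]` of rank `p(j)`. Elements of `𝒰₀` preserve the degree and commute with `x`, so each of
them gives a `p(j) × p(j)` matrix over `ℂ[x]` for every `j`, and `N^m 𝒰₀` kills all degrees below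
`m`. The induced map from `𝒰₀ / N^m 𝒰₀` to the product of the matrix algebras with `j < m` is an
isomorphism. The case `m = d + 1` is the second claim; splitting off the last factor and using the
case `m = d` gives the first.

Bijectivity rests on normal ordering. The Jacobi relations express every mode through oscillators,
so modulo `N^m` an element of `𝒰₀` is a sum of products of a creation polynomial and an annihilation
polynomial of equal degree (`exists_ordered`). The annihilation monomials of degree `j` pair
diagonally with the basis of the piece of degree `j` (`exists_annihilation_basisVec`). Hence
products with annihilation part of degree exactly `j` kill the lower degrees, realize every matrix
in degree `j`, and have coefficients that can be read off from that matrix. This triangular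
structure gives `totalAct_surjective` and `totalAct_eq_zero_iff`.

Most of the work is the existence of the action, that is, the Jacobi identity `jac_eq_zero` for the
fields on the universal Fock module. If an operator commutes with the oscillators up to scalars, its
commutator with a mode of `a` is a combination of modes of the derivatives of `a` (`Rep.Cov.act`).
Applied to multiplications by variables and to partial derivatives, this shows that the commutator
of such an operator with the defect of the Jacobi identity is a combination of defects of smaller
conformal weight. By induction the defect commutes with all of them, so it is a scalar
(`exists_scalar`). The scalar can be computed at `b₀ = 0` as a vacuum expectation value on `π`,
where the claim becomes a binomial identity (`constantCoeff_jac`). The same scheme gives the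
compatibility with `T` (`act_translation`). Each vector is killed by `N^n U` for large `n`, so the
action extends to the completion and vanishes on the closed ideal (`gradedAct_closedIdeal`). -/

/-- A truncated family of oscillators on the space of polynomials. -/
structure Rep where
  /-- The oscillators. -/
  osc : ℤ → Module.End ℂ Fock
  trunc : ∀ v, ∃ N : ℤ, ∀ n, N ≤ n → osc n v = 0

/-- The field `(1/k!) ∂ᵏ b(z)` of a family of oscillators. -/
def Rep.field (ρ : Rep) (k : ℕ) : VertexOperator ℂ Fock :=
  ofModes (fun n => ((-1 : ℤ) ^ k * Ring.choose n k) • ρ.osc (n - k)) fun v => by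
    obtain ⟨N, hN⟩ := ρ.trunc v
    exact ⟨N + k, fun n hn => by simp [hN (n - k) (by omega)]⟩

/-- The nested normally ordered product of the fields indexed by a list. -/
def Rep.wick (ρ : Rep) (L : List ℕ) : VertexOperator ℂ Fock :=
  L.foldr (fun k A => normalOrder (ρ.field k) A) identityField

/-- The state-field correspondence of a family of oscillators. -/
def Rep.Y (ρ : Rep) : Fock →ₗ[ℂ] VertexOperator ℂ Fock :=
  (MvPolynomial.basisMonomials ℕ ℂ).constr ℂ fun s : ℕ →₀ ℕ =>
    ρ.wick (Finsupp.toMultiset s).sort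

/-- The modes of the state-field correspondence of a family of oscillators. -/
def Rep.act (ρ : Rep) (n : ℤ) : Fock →ₗ[ℂ] Module.End ℂ Fock :=
  LinearMap.proj n ∘ₗ VertexOperator.ncoeff ∘ₗ ρ.Y

/-- The oscillators of the vertex algebra itself. -/
def fockRep : Rep := ⟨oscillator, exists_oscillator_eq_zero⟩

theorem nthProduct_eq (n : ℤ) (a b : Fock) : nthProduct n a b = fockRep.act n a b := rfl

theorem ncoeff_ofModes (A : ℤ → Module.End ℂ Fock) (hA) (n : ℤ) :
    VertexOperator.ncoeff (ofModes A hA) n = A n := by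
  rw [ofModes, VertexOperator.ncoeff_of_coeff]
  congr 1
  ring

theorem ncoeff_field (ρ : Rep) (k : ℕ) (n : ℤ) :
    VertexOperator.ncoeff (ρ.field k) n = ((-1 : ℤ) ^ k * Ring.choose n k) • ρ.osc (n - k) :=
  ncoeff_ofModes _ _ _

theorem ncoeff_identityField (n : ℤ) :
    VertexOperator.ncoeff identityField n = if n = -1 then LinearMap.id else 0 :=
  ncoeff_ofModes _ _ _

theorem ncoeff_normalOrder (A B : VertexOperator ℂ Fock) (n : ℤ) (v : Fock) :
    VertexOperator.ncoeff (normalOrder A B) n v =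
      (∑ᶠ i : ℕ, VertexOperator.ncoeff A (-1 - i) (VertexOperator.ncoeff B (n + i) v)) +
      ∑ᶠ i : ℕ, VertexOperator.ncoeff B (n - 1 - i) (VertexOperator.ncoeff A i v) := by
  rw [normalOrder, ncoeff_ofModes]
  simp [normalOrderMode]

theorem Rep.act_monomial (ρ : Rep) (s : ℕ →₀ ℕ) (n : ℤ) :
    ρ.act n (monomial s 1) = VertexOperator.ncoeff (ρ.wick (Finsupp.toMultiset s).sort) n := by
  have := (MvPolynomial.basisMonomials ℕ ℂ).constr_basis ℂ
    (fun s : ℕ →₀ ℕ => ρ.wick (Finsupp.toMultiset s).sort) s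
  rw [coe_basisMonomials] at this
  simp only [Rep.act, LinearMap.comp_apply, LinearMap.proj_apply]
  rw [Rep.Y, this]

theorem Rep.wick_cons (ρ : Rep) (k : ℕ) (L : List ℕ) :
    ρ.wick (k :: L) = normalOrder (ρ.field k) (ρ.wick L) := rfl

theorem Rep.act_trunc (ρ : Rep) (a v : Fock) :
    ∃ N : ℤ, ∀ n, N ≤ n → ρ.act n a v = 0 :=
  exists_ncoeff_eq_zero (ρ.Y a) v

theorem Rep.act_one (ρ : Rep) (n : ℤ) : ρ.act n 1 = if n = -1 then LinearMap.id else 0 := by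
  have := ρ.act_monomial 0 n
  rw [monomial_zero', C_1] at this
  rw [this]
  simp [Rep.wick, ncoeff_identityField]

/-! ### Operators acting on the oscillators by shifts -/

/-- `[O, βₙ] = g δ_{n,-1-r}`. -/
def Rep.Cov (ρ : Rep) (O : Module.End ℂ Fock) (g : ℂ) (r : ℤ) : Prop :=
  ∀ n v, O (ρ.osc n v) = ρ.osc n (O v) + if n = -1 - r then g • v else 0

/-- Upper negation. The left side is the coefficient of the oscillator of index `-1 - r` in the mode
of index `k - 1 - r` of `(1/k!) ∂ᵏ b(z)`; the right side is what differentiating `zʳ` produces. -/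
theorem choose_reflect (r : ℤ) (k : ℕ) :
    (-1 : ℤ) ^ k * Ring.choose ((k : ℤ) - 1 - r) k = Ring.choose r k := by
  have h := Ring.choose_neg (-r) k
  rw [neg_neg] at h
  rw [h]
  have : Int.negOnePow k • Ring.choose (-r + k - 1) k =
      (-1 : ℤ) ^ k * Ring.choose (-r + k - 1) k := by
    simp [Units.smul_def, Int.negOnePow]
  rw [this]
  congr 2
  ring

/-- In generating series, `[O, b(z)] = g zʳ`; applying `∂ᵏ/k!` gives `g (r choose k) zʳ⁻ᵏ`. -/
theorem Rep.Cov.field {ρ : Rep} {O : Module.End ℂ Fock} {g : ℂ} {r : ℤ} (h : ρ.Cov O g r)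
    (k : ℕ) (n : ℤ) (v : Fock) :
    O (VertexOperator.ncoeff (ρ.field k) n v) = VertexOperator.ncoeff (ρ.field k) n (O v) +
      if n = k - 1 - r then (g * (Ring.choose r k : ℤ)) • v else 0 := by
  simp only [ncoeff_field, LinearMap.smul_apply, map_zsmul, h (n - k) v, smul_add]
  congr 1
  by_cases hn : n = k - 1 - r
  · subst hn
    rw [choose_reflect, if_pos (by ring), if_pos rfl, ← Int.cast_smul_eq_zsmul ℂ, smul_smul,
      mul_comm]
  · rw [if_neg (by omega), if_neg hn, smul_zero]

theorem finite_support_left (A B : VertexOperator ℂ Fock) (n : ℤ) (v : Fock) :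
    (Function.support fun i : ℕ =>
      VertexOperator.ncoeff A (-1 - i) (VertexOperator.ncoeff B (n + i) v)).Finite :=
  finite_support_nat (exists_ncoeff_eq_zero B v) n (F := fun i => VertexOperator.ncoeff A (-1 - i))

theorem finite_support_right (A B : VertexOperator ℂ Fock) (n : ℤ) (v : Fock) :
    (Function.support fun i : ℕ =>
      VertexOperator.ncoeff B (n - 1 - i) (VertexOperator.ncoeff A i v)).Finite := by
  simpa using finite_support_nat (exists_ncoeff_eq_zero A v) 0
    (F := fun i => VertexOperator.ncoeff B (n - 1 - i))

theorem finite_support_smul (c : ℂ) {f : ℕ → Fock} (h : (Function.support f).Finite) :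
    (Function.support fun i => c • f i).Finite :=
  h.subset fun i => mt fun (h : f i = 0) => show c • f i = 0 by rw [h, smul_zero]

/-- Commutation with `O` is a derivation of normally ordered products, because its commutator with
each single field is a scalar series: one factor at a time is deleted and replaced by `g (r choose
k) zʳ⁻ᵏ`. -/
theorem Rep.Cov.wick {ρ : Rep} {O : Module.End ℂ Fock} {g : ℂ} {r : ℤ} (h : ρ.Cov O g r)
    (L : List ℕ) (n : ℤ) (v : Fock) :
    O (VertexOperator.ncoeff (ρ.wick L) n v) = VertexOperator.ncoeff (ρ.wick L) n (O v) +
      ∑ j : Fin L.length, (g * (Ring.choose r (L.get j) : ℤ)) •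
        VertexOperator.ncoeff (ρ.wick (L.eraseIdx j)) (n + r - L.get j) v := by
  induction L generalizing n v with
  | nil =>
    simp only [Rep.wick, List.foldr_nil, ncoeff_identityField]
    split_ifs <;> simp
  | cons k L ih =>
    set A := ρ.field k with hA
    set B := ρ.wick L with hB
    have e1 : ∀ i : ℕ, O (VertexOperator.ncoeff A (-1 - i) (VertexOperator.ncoeff B (n + i) v)) =
        VertexOperator.ncoeff A (-1 - i) (VertexOperator.ncoeff B (n + i) (O v)) +
        ((if (-1 - i : ℤ) = k - 1 - r then (g * (Ring.choose r k : ℤ)) •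
          VertexOperator.ncoeff B (n + i) v else 0) +
        ∑ j : Fin L.length, (g * (Ring.choose r (L.get j) : ℤ)) •
          VertexOperator.ncoeff A (-1 - i)
            (VertexOperator.ncoeff (ρ.wick (L.eraseIdx j)) (n + r - L.get j + i) v)) := by
      intro i
      rw [h.field, ih, map_add, map_sum, add_assoc, add_comm (∑ _, _)]
      congr 3
      funext j
      rw [map_smul, show n + i + r - L.get j = n + r - L.get j + i by ring]
    have e2 : ∀ i : ℕ, O (VertexOperator.ncoeff B (n - 1 - i) (VertexOperator.ncoeff A i v)) =
        VertexOperator.ncoeff B (n - 1 - i) (VertexOperator.ncoeff A i (O v)) +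
        ((if (i : ℤ) = k - 1 - r then (g * (Ring.choose r k : ℤ)) •
          VertexOperator.ncoeff B (n - 1 - i) v else 0) +
        ∑ j : Fin L.length, (g * (Ring.choose r (L.get j) : ℤ)) •
            (VertexOperator.ncoeff (ρ.wick (L.eraseIdx j)) (n + r - L.get j - 1 - i)
              (VertexOperator.ncoeff A i v))) := by
      intro i
      rw [ih, h.field, map_add, apply_ite (VertexOperator.ncoeff B (n - 1 - i)), map_smul, map_zero,
        add_assoc]
      congr 3
      funext j
      rw [show n - 1 - i + r - L.get j = n + r - L.get j - 1 - i by ring]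
    have s1 : (Function.support fun i : ℕ =>
        if (-1 - i : ℤ) = k - 1 - r then (g * (Ring.choose r k : ℤ)) •
          VertexOperator.ncoeff B (n + i) v else 0).Finite := by
      refine (Set.finite_singleton (-1 - (k - 1 - r)).toNat).subset fun i hi => ?_
      by_contra h'
      exact hi (if_neg fun h2 => h' (by simp only [Set.mem_singleton_iff]; omega))
    have s2 : (Function.support fun i : ℕ =>
        if (i : ℤ) = k - 1 - r then (g * (Ring.choose r k : ℤ)) •
          VertexOperator.ncoeff B (n - 1 - i) v else 0).Finite := by
      refine (Set.finite_singleton (k - 1 - r).toNat).subset fun i hi => ?_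
      by_contra h'
      exact hi (if_neg fun h2 => h' (by simp only [Set.mem_singleton_iff]; omega))
    have s3 : ∀ j : Fin L.length, (Function.support fun i : ℕ =>
        (g * (Ring.choose r (L.get j) : ℤ)) • VertexOperator.ncoeff A (-1 - i)
            (VertexOperator.ncoeff (ρ.wick (L.eraseIdx j)) (n + r - L.get j + i) v)).Finite :=
      fun j => finite_support_smul _ (finite_support_left A _ _ v)
    have s4 : ∀ j : Fin L.length, (Function.support fun i : ℕ =>
        (g * (Ring.choose r (L.get j) : ℤ)) •
          VertexOperator.ncoeff (ρ.wick (L.eraseIdx j)) (n + r - L.get j - 1 - i)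
            (VertexOperator.ncoeff A i v)).Finite :=
      fun j => finite_support_smul _ (finite_support_right A _ _ v)
    have fin_sum : ∀ F : Fin L.length → ℕ → Fock, (∀ j, (Function.support (F j)).Finite) →
        (Function.support fun i => ∑ j, F j i).Finite := fun F hF => by
      refine (Set.finite_iUnion hF).subset fun i hi => ?_
      obtain ⟨j, -, hj⟩ := Finset.exists_ne_zero_of_sum_ne_zero hi
      exact Set.mem_iUnion.2 ⟨j, hj⟩
    -- The contraction with the leading field sits at the single mode index `k - 1 - r`. This index
    -- is negative or not, so exactly one of the two halves of the normally ordered product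
    -- contributes.
    have key : (∑ᶠ i : ℕ, if (-1 - i : ℤ) = k - 1 - r then (g * (Ring.choose r k : ℤ)) •
          VertexOperator.ncoeff B (n + i) v else 0) +
        (∑ᶠ i : ℕ, if (i : ℤ) = k - 1 - r then (g * (Ring.choose r k : ℤ)) •
          VertexOperator.ncoeff B (n - 1 - i) v else 0) =
        (g * (Ring.choose r k : ℤ)) • VertexOperator.ncoeff B (n + r - k) v := by
      rcases lt_or_ge (k - 1 - r : ℤ) 0 with hp | hp
      · rw [finsum_eq_single _ (-1 - (k - 1 - r)).toNat fun i hi => if_neg (by omega),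
          if_pos (by omega), finsum_eq_zero_of_forall_eq_zero fun i => if_neg (by omega), add_zero,
          show n + ((-1 - (k - 1 - r)).toNat : ℤ) = n + r - k by omega]
      · rw [finsum_eq_zero_of_forall_eq_zero fun i => if_neg (by omega),
          finsum_eq_single _ (k - 1 - r).toNat fun i hi => if_neg (by omega),
          if_pos (by omega), zero_add,
          show n - 1 - ((k - 1 - r).toNat : ℤ) = n + r - k by omega]
    rw [ρ.wick_cons, ← hA, ← hB, ncoeff_normalOrder, map_add,
      map_finsum O (finite_support_left A B n v),
      map_finsum O (finite_support_right A B n v), finsum_congr e1, finsum_congr e2,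
      finsum_add_distrib (finite_support_left A B n _)
        ((s1.union (fin_sum _ s3)).subset (Function.support_add _ _)),
      finsum_add_distrib s1 (fin_sum _ s3),
      finsum_add_distrib (finite_support_right A B n _)
        ((s2.union (fin_sum _ s4)).subset (Function.support_add _ _)),
      finsum_add_distrib s2 (fin_sum _ s4), finsum_sum_comm _ _ fun j _ => s3 j,
      finsum_sum_comm _ _ fun j _ => s4 j, ncoeff_normalOrder A B n (O v)]
    have split : ∀ j : Fin L.length, (g * (Ring.choose r (L.get j) : ℤ)) •
        VertexOperator.ncoeff (normalOrder A (ρ.wick (L.eraseIdx j))) (n + r - L.get j) v =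
        (∑ᶠ i : ℕ, (g * (Ring.choose r (L.get j) : ℤ)) • VertexOperator.ncoeff A (-1 - i)
            (VertexOperator.ncoeff (ρ.wick (L.eraseIdx j)) (n + r - L.get j + i) v)) +
        ∑ᶠ i : ℕ, (g * (Ring.choose r (L.get j) : ℤ)) •
          VertexOperator.ncoeff (ρ.wick (L.eraseIdx j)) (n + r - L.get j - 1 - i)
            (VertexOperator.ncoeff A i v) := fun j => by
      rw [ncoeff_normalOrder, smul_add, smul_finsum' _ (finite_support_left A _ _ v),
        smul_finsum' _ (finite_support_right A _ _ v)]
    have hR : ∑ j : Fin (k :: L).length, (g * (Ring.choose r ((k :: L).get j) : ℤ)) •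
        VertexOperator.ncoeff (ρ.wick ((k :: L).eraseIdx j)) (n + r - (k :: L).get j) v =
        (g * (Ring.choose r k : ℤ)) • VertexOperator.ncoeff B (n + r - k) v +
        ∑ j : Fin L.length, (g * (Ring.choose r (L.get j) : ℤ)) •
          VertexOperator.ncoeff (normalOrder A (ρ.wick (L.eraseIdx j))) (n + r - L.get j) v :=
      Fin.sum_univ_succ _
    rw [hR, Finset.sum_congr rfl fun j _ => split j, Finset.sum_add_distrib, ← key]
    abel

/-! ### Reduction to monomials -/

/-- The state-field map is defined through sorted lists; this turns the deletion of a factor back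
into a monomial. -/
theorem sort_eraseIdx (s : ℕ →₀ ℕ) (j : Fin (Finsupp.toMultiset s).sort.length) :
    (Finsupp.toMultiset (s - Finsupp.single ((Finsupp.toMultiset s).sort.get j) 1)).sort =
      (Finsupp.toMultiset s).sort.eraseIdx j := by
  have h2 : ((Finsupp.toMultiset s).sort : Multiset ℕ) = Finsupp.toMultiset s :=
    Multiset.sort_eq _ _
  have hsort : (Finsupp.toMultiset s).sort.Pairwise (· ≤ ·) := Multiset.pairwise_sort _ _
  generalize (Finsupp.toMultiset s).sort = L at j h2 hsort ⊢
  have hmem : L.get j ∈ Finsupp.toMultiset s := by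
    rw [← h2]
    exact List.get_mem _ _
  have hle : Finsupp.single (L.get j) 1 ≤ s := by
    rw [Finsupp.single_le_iff]
    have := (Finsupp.mem_toMultiset _ _).1 hmem
    exact Nat.one_le_iff_ne_zero.2 (Finsupp.mem_support_iff.1 this)
  refine List.Perm.eq_of_pairwise' (r := (· ≤ ·)) (Multiset.pairwise_sort _ _)
    (hsort.sublist (List.eraseIdx_sublist _ _)) ?_
  rw [← Multiset.coe_eq_coe, Multiset.sort_eq]
  have h1 : ((L.get j :: L.eraseIdx j : List ℕ) : Multiset ℕ) = (L : Multiset ℕ) :=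
    Multiset.coe_eq_coe.2 (List.getElem_cons_eraseIdx_perm j.2)
  have h3 : Finsupp.toMultiset (Finsupp.single (L.get j) 1 + (s - Finsupp.single (L.get j) 1)) =
      Finsupp.toMultiset s := by rw [add_tsub_cancel_of_le hle]
  rw [Finsupp.toMultiset_add, Finsupp.toMultiset_single, one_smul, Multiset.singleton_add,
    ← h2, ← h1, ← Multiset.cons_coe] at h3
  exact (Multiset.cons_inj_right _).1 h3

/-- Equal factors are collected: the multiplicity `s k` is the factor that `pderiv k` produces on a
monomial. -/
theorem sum_get_sort (s : ℕ →₀ ℕ) (F : ℕ → Fock) (K : ℕ) (hK : ∀ k, K ≤ k → s k = 0) :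
    ∑ j : Fin (Finsupp.toMultiset s).sort.length, F ((Finsupp.toMultiset s).sort.get j) =
      ∑ k ∈ Finset.range K, s k • F k := by
  have h1 : ∑ j : Fin (Finsupp.toMultiset s).sort.length, F ((Finsupp.toMultiset s).sort.get j) =
      ((Finsupp.toMultiset s).map F).sum := by
    conv_rhs => rw [← Multiset.sort_eq (Finsupp.toMultiset s) (· ≤ ·)]
    rw [Multiset.map_coe, Multiset.sum_coe, ← List.sum_ofFn]
    congr 1
    rw [List.ofFn_comp' , List.ofFn_get]
  rw [h1, Finset.sum_multiset_map_count, Finsupp.toFinset_toMultiset]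
  simp only [Finsupp.count_toMultiset]
  refine Finset.sum_subset (fun k hk => ?_) fun k _ hk => ?_
  · rw [Finset.mem_range]
    by_contra h
    exact Finsupp.mem_support_iff.1 hk (hK k (not_lt.1 h))
  · rw [Finsupp.notMem_support_iff.1 hk, zero_smul]

theorem monomial_eq_smul (s : ℕ →₀ ℕ) (c : ℂ) :
    (monomial s c : Fock) = c • monomial s 1 := by
  rw [smul_monomial, smul_eq_mul, mul_one]

theorem exists_pderiv_eq_zero (a : Fock) : ∃ K : ℕ, ∀ k, K ≤ k → pderiv k a = 0 := by
  refine ⟨a.vars.sup id + 1, fun k hk => pderiv_eq_zero_of_notMem_vars fun h => ?_⟩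
  have h1 : k ≤ a.vars.sup id := Finset.le_sup (f := id) h
  omega

/-- The contractions with equal factors of a monomial add up to its partial derivative. All large
`K` are allowed so that two summands can share one truncation. -/
theorem Rep.Cov.act_of_large {ρ : Rep} {O : Module.End ℂ Fock} {g : ℂ} {r : ℤ} (h : ρ.Cov O g r)
    (a : Fock) : ∃ K₀ : ℕ, ∀ K, K₀ ≤ K → ∀ (n : ℤ) (v : Fock),
      O (ρ.act n a v) = ρ.act n a (O v) + g • ∑ k ∈ Finset.range K,
        Ring.choose r k • ρ.act (n + r - k) (pderiv k a) v := by
  induction a using MvPolynomial.induction_on' with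
  | add p q hp hq =>
    obtain ⟨K₁, h₁⟩ := hp
    obtain ⟨K₂, h₂⟩ := hq
    refine ⟨max K₁ K₂, fun K hK n v => ?_⟩
    simp only [map_add, LinearMap.add_apply, h₁ K (le_trans (le_max_left _ _) hK),
      h₂ K (le_trans (le_max_right _ _) hK), smul_add, Finset.sum_add_distrib]
    abel
  | monomial s c =>
    refine ⟨s.support.sup id + 1, fun K hK n v => ?_⟩
    have hs : ∀ k, K ≤ k → s k = 0 := fun k hk => by
      by_contra h'
      have h1 : k ≤ s.support.sup id :=
        Finset.le_sup (f := id) (Finsupp.mem_support_iff.2 h')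
      omega
    have h1 : O (ρ.act n (monomial s 1) v) = ρ.act n (monomial s 1) (O v) +
        g • ∑ k ∈ Finset.range K,
          Ring.choose r k • ρ.act (n + r - k) (pderiv k (monomial s 1)) v := by
      rw [ρ.act_monomial, h.wick, add_right_inj]
      have := sum_get_sort s (fun k => (g * (Ring.choose r k : ℤ)) •
        ρ.act (n + r - k) (monomial (s - Finsupp.single k 1) 1) v) K hs
      rw [Finset.smul_sum]
      convert this using 1
      · refine Finset.sum_congr rfl fun j _ => ?_
        rw [ρ.act_monomial, sort_eraseIdx]
      · refine Finset.sum_congr rfl fun k _ => ?_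
        rw [pderiv_monomial, one_mul, monomial_eq_smul, map_smul, LinearMap.smul_apply,
          ← Int.cast_smul_eq_zsmul ℂ, ← Nat.cast_smul_eq_nsmul ℂ]
        simp only [smul_smul]
        congr 1
        ring
    rw [monomial_eq_smul]
    have h2 : ∀ k, pderiv k (c • monomial s 1 : Fock) = c • pderiv k (monomial s 1) :=
      fun k => (pderiv k).map_smul c _
    simp only [map_smul, LinearMap.smul_apply, h1, smul_add, h2]
    rw [smul_comm c g, Finset.smul_sum]
    simp only [smul_comm c]

/-- The commutation rule of modes with an operator that acts on oscillators by a shift. -/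
theorem Rep.Cov.act {ρ : Rep} {O : Module.End ℂ Fock} {g : ℂ} {r : ℤ} (h : ρ.Cov O g r)
    {a : Fock} {K : ℕ} (hK : ∀ k, K ≤ k → pderiv k a = 0) (n : ℤ) (v : Fock) :
    O (ρ.act n a v) = ρ.act n a (O v) + g • ∑ k ∈ Finset.range K,
      Ring.choose r k • ρ.act (n + r - k) (pderiv k a) v := by
  obtain ⟨K₀, h₀⟩ := h.act_of_large a
  rw [h₀ (max K₀ K) (le_max_left _ _)]
  congr 2
  refine (Finset.sum_subset (Finset.range_mono (le_max_right _ _)) fun k _ hk => ?_).symm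
  rw [hK k (by simpa using hk), map_zero, LinearMap.zero_apply, smul_zero]

/-- Prepending a smallest index keeps the list sorted, so the recursion for nested products applies
without knowing that their order is irrelevant. -/
theorem Rep.Y_X_mul (ρ : Rep) {k : ℕ} {s : ℕ →₀ ℕ} (h : ∀ j ∈ s.support, k ≤ j) :
    ρ.Y (monomial (Finsupp.single k 1 + s) 1) =
      normalOrder (ρ.field k) (ρ.Y (monomial s 1)) := by
  have key : ∀ s : ℕ →₀ ℕ, ρ.Y (monomial s 1) = ρ.wick (Finsupp.toMultiset s).sort := fun s => by
    have := (MvPolynomial.basisMonomials ℕ ℂ).constr_basis ℂ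
      (fun s : ℕ →₀ ℕ => ρ.wick (Finsupp.toMultiset s).sort) s
    rwa [coe_basisMonomials] at this
  rw [key, key, Finsupp.toMultiset_add, Finsupp.toMultiset_single, one_smul,
    Multiset.singleton_add, Multiset.sort_cons, Rep.wick_cons]
  intro j hj
  exact h j ((Finsupp.mem_toMultiset _ _).1 hj)

theorem Rep.act_X_mul (ρ : Rep) {k : ℕ} {s : ℕ →₀ ℕ} (h : ∀ j ∈ s.support, k ≤ j) (n : ℤ)
    (v : Fock) : ρ.act n (monomial (Finsupp.single k 1 + s) 1) v =
      (∑ᶠ i : ℕ, VertexOperator.ncoeff (ρ.field k) (-1 - i) (ρ.act (n + i) (monomial s 1) v)) +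
      ∑ᶠ i : ℕ, ρ.act (n - 1 - i) (monomial s 1) (VertexOperator.ncoeff (ρ.field k) i v) := by
  simp only [Rep.act, LinearMap.comp_apply, LinearMap.proj_apply]
  rw [ρ.Y_X_mul h, ncoeff_normalOrder]

/-- Induction on exponents, adding a smallest variable at each step. -/
theorem exponent_induction {P : (ℕ →₀ ℕ) → Prop} (zero : P 0)
    (cons : ∀ k s, (∀ j ∈ s.support, k ≤ j) → P s → P (Finsupp.single k 1 + s)) (s : ℕ →₀ ℕ) :
    P s := by
  induction hd : s.degree generalizing s with
  | zero =>
    rw [Finsupp.degree_eq_zero_iff] at hd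
    rwa [hd]
  | succ d ih =>
    have hs : s.support.Nonempty := by
      rw [Finsupp.support_nonempty_iff]
      rintro rfl
      simp at hd
    set k := s.support.min' hs with hk
    have hle : Finsupp.single k 1 ≤ s := by
      rw [Finsupp.single_le_iff]
      exact Nat.one_le_iff_ne_zero.2 (Finsupp.mem_support_iff.1 (Finset.min'_mem _ hs))
    rw [← add_tsub_cancel_of_le hle] at hd ⊢
    refine cons k _ (fun j hj => Finset.min'_le _ _ ?_) (ih _ ?_)
    · exact Finsupp.support_tsub hj
    · rw [map_add, Finsupp.degree_single] at hd
      omega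

/-! ### Gradings -/

/-- Weighted homogeneous polynomials, for integer weights. -/
def grade (w : ℕ → ℤ) (z : ℤ) : Submodule ℂ Fock := weightedHomogeneousSubmodule ℂ w z

/-- The conformal weights of the variables of the Fock space. -/
def wt (k : ℕ) : ℤ := k + 1

theorem monomial_mem_grade {w : ℕ → ℤ} {z : ℤ} {s : ℕ →₀ ℕ} {c : ℂ}
    (h : Finsupp.weight w s = z) : monomial s c ∈ grade w z :=
  isWeightedHomogeneous_monomial w s c h

theorem X_mul_mem_grade {w : ℕ → ℤ} {z : ℤ} {a : Fock} (k : ℕ) (h : a ∈ grade w z) :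
    X k * a ∈ grade w (z + w k) := by
  rw [add_comm]
  exact (isWeightedHomogeneous_X ℂ w k).mul h

theorem pderiv_mem_grade {w : ℕ → ℤ} {z : ℤ} {a : Fock} (k : ℕ) (h : a ∈ grade w z) :
    pderiv k a ∈ grade w (z - w k) :=
  IsWeightedHomogeneous.pderiv (w := w) h (sub_add_cancel _ _)

theorem grade_induction {w : ℕ → ℤ} {z : ℤ} {P : Fock → Prop}
    (monomial : ∀ s c, Finsupp.weight w s = z → P (monomial s c))
    (zero : P 0) (add : ∀ p q, P p → P q → P (p + q)) {a : Fock} (ha : a ∈ grade w z) : P a := by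
  refine IsWeightedHomogeneous.induction_on (w := w) (m := z) (motive := fun p _ => P p)
    zero (fun p q _ _ => add p q) monomial ha

theorem mem_grade_cast {w : ℕ → ℕ} {n : ℕ} {a : Fock} :
    a ∈ weightedHomogeneousSubmodule ℂ w n ↔ a ∈ grade (fun k => (w k : ℤ)) n := by
  have : ∀ s : ℕ →₀ ℕ, Finsupp.weight (fun k => (w k : ℤ)) s =
      (Finsupp.weight w s : ℤ) := fun s => by
    simp [Finsupp.weight_apply, Finsupp.sum]
  rw [grade, mem_weightedHomogeneousSubmodule, mem_weightedHomogeneousSubmodule,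
    IsWeightedHomogeneous, IsWeightedHomogeneous]
  simp [this]

theorem mem_weightSpace {n : ℕ} {a : Fock} : a ∈ weightSpace n ↔ a ∈ grade wt n := by
  rw [weightSpace, mem_grade_cast]
  simp only [Nat.cast_add, Nat.cast_one]
  rfl

theorem weight_nonneg {w : ℕ → ℤ} (hw : ∀ k, 0 ≤ w k) (s : ℕ →₀ ℕ) :
    0 ≤ Finsupp.weight w s := by
  rw [Finsupp.weight_apply]
  exact Finset.sum_nonneg fun k _ => nsmul_nonneg (hw k) _

theorem eq_zero_of_mem_grade {w : ℕ → ℤ} (hw : ∀ k, 0 ≤ w k) {z : ℤ} (hz : z < 0) {a : Fock}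
    (ha : a ∈ grade w z) : a = 0 := by
  refine grade_induction (P := fun a => a = 0) (fun s c hs => ?_) rfl
    (fun p q hp hq => by rw [hp, hq, add_zero]) ha
  have := weight_nonneg hw s
  omega

theorem wt_nonneg (k : ℕ) : 0 ≤ wt k := by unfold wt; omega

/-- The oscillator of index `n` lowers the grading by `n`. -/
def Rep.Graded (ρ : Rep) (w : ℕ → ℤ) : Prop :=
  ∀ n z v, v ∈ grade w z → ρ.osc n v ∈ grade w (z - n)

theorem Rep.Graded.field {ρ : Rep} {w : ℕ → ℤ} (h : ρ.Graded w) (k : ℕ) {n z : ℤ} {v : Fock}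
    (hv : v ∈ grade w z) : VertexOperator.ncoeff (ρ.field k) n v ∈ grade w (z + k - n) := by
  rw [ncoeff_field, LinearMap.smul_apply, ← Int.cast_smul_eq_zsmul ℂ]
  have := h (n - k) z v hv
  rw [show z - (n - k) = z + k - n by ring] at this
  exact Submodule.smul_mem _ _ this

theorem finsum_mem_submodule {ι : Type*} (p : Submodule ℂ Fock) {f : ι → Fock}
    (h : ∀ i, f i ∈ p) : ∑ᶠ i, f i ∈ p :=
  finsum_induction (· ∈ p) p.zero_mem (fun _ _ => p.add_mem) h

/-- The weights `w` of the module are separate from the conformal weights `wt` of the states, since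
the same lemma serves `π` and the universal Fock module, where `b₀` has degree zero. -/
theorem Rep.Graded.act {ρ : Rep} {w : ℕ → ℤ} (h : ρ.Graded w) {i n z : ℤ} {a v : Fock}
    (ha : a ∈ grade wt i) (hv : v ∈ grade w z) : ρ.act n a v ∈ grade w (z + i - n - 1) := by
  refine grade_induction (P := fun a => ρ.act n a v ∈ grade w (z + i - n - 1)) (fun s c hs => ?_)
    (by simp) (fun p q hp hq => by simpa using add_mem hp hq) ha
  rw [monomial_eq_smul, map_smul, LinearMap.smul_apply]
  refine Submodule.smul_mem _ _ ?_
  clear ha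
  induction s using exponent_induction generalizing i n z v with
  | zero =>
    rw [map_zero] at hs
    subst hs
    rw [monomial_zero', C_1, ρ.act_one]
    split_ifs with hn
    · subst hn
      simpa using hv
    · simp
  | cons k s hks ih =>
    rw [ρ.act_X_mul hks]
    rw [map_add, Finsupp.weight_single, one_smul] at hs
    have e : Finsupp.weight wt s = i - (k + 1) := by rw [← hs, wt]; ring
    refine add_mem (finsum_mem_submodule _ fun j => ?_) (finsum_mem_submodule _ fun j => ?_)
    · have := h.field k (n := -1 - j) (ih (n := n + j) hv e)
      rwa [show z + (i - (k + 1)) - (n + j) - 1 + k - (-1 - j) = z + i - n - 1 by ring] at this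
    · have := ih (n := n - 1 - j) (h.field k (n := j) hv) e
      rwa [show z + k - j + (i - (k + 1)) - (n - 1 - j) - 1 = z + i - n - 1 by ring] at this

/-! ### Binomial identities -/

theorem succ_mul_choose (r : ℤ) (k : ℕ) :
    ((k : ℤ) + 1) * Ring.choose r (k + 1) = (r - k) * Ring.choose r k := by
  have h := Ring.choose_smul_choose r (Nat.le_succ k)
  simp only [Nat.succ_eq_add_one, Nat.choose_succ_self_right, add_tsub_cancel_left,
    Ring.choose_one_right, nsmul_eq_mul] at h
  push_cast at h
  rw [h, mul_comm]

theorem succ_mul_choose' (r : ℤ) (k : ℕ) :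
    ((k : ℤ) + 1) * Ring.choose r (k + 1) = r * Ring.choose (r - 1) k := by
  have h := Ring.choose_smul_choose r (Nat.succ_le_succ (Nat.zero_le k))
  simp only [Nat.succ_eq_add_one, zero_add, Nat.choose_one_right, add_tsub_cancel_right,
    Ring.choose_one_right, nsmul_eq_mul] at h
  push_cast at h
  rw [h]

theorem sub_mul_choose (r : ℤ) (k : ℕ) :
    (r - k) * Ring.choose r k = r * Ring.choose (r - 1) k := by
  rw [← succ_mul_choose, succ_mul_choose']

theorem choose_eq_zero_of_lt {n : ℤ} {k : ℕ} (h0 : 0 ≤ n) (h : n < k) : Ring.choose n k = 0 := by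
  lift n to ℕ using h0
  have h1 : (n : ℤ) < (k : ℤ) := h
  rw [Ring.choose_natCast, Nat.choose_eq_zero_of_lt (by omega)]
  rfl

/-! ### The vacuum and the translation operator -/

theorem oscillator_one {n : ℤ} (hn : 0 ≤ n) : oscillator n 1 = 0 := by
  match n, hn with
  | Int.ofNat 0, _ => simp [oscillator]
  | Int.ofNat (k + 1), _ => simp [oscillator]

theorem field_one (k : ℕ) {n : ℤ} (hn : 0 ≤ n) :
    VertexOperator.ncoeff (fockRep.field k) n 1 = 0 := by
  rw [ncoeff_field, LinearMap.smul_apply]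
  rcases lt_or_ge n k with h | h
  · rw [choose_eq_zero_of_lt hn h, mul_zero, zero_smul]
  · rw [fockRep, oscillator_one (by omega), smul_zero]

theorem field_neg (k : ℕ) (i : ℕ) (v : Fock) :
    ∃ c : ℤ, VertexOperator.ncoeff (fockRep.field k) (-1 - i) v = c • (X (k + i) * v) := by
  refine ⟨(-1) ^ k * Ring.choose (-1 - i : ℤ) k, ?_⟩
  rw [ncoeff_field, LinearMap.smul_apply]
  congr 1
  rw [show (-1 - i - k : ℤ) = Int.negSucc (k + i) by rw [Int.negSucc_eq]; push_cast; ring]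
  rfl

theorem field_neg_one (k : ℕ) (v : Fock) :
    VertexOperator.ncoeff (fockRep.field k) (-1) v = X k * v := by
  rw [ncoeff_field, LinearMap.smul_apply, show (-1 - k : ℤ) = Int.negSucc k by
    rw [Int.negSucc_eq]; ring]
  have h := choose_reflect k k
  rw [show (k - 1 - k : ℤ) = -1 by ring, Ring.choose_natCast, Nat.choose_self] at h
  rw [h]
  simp [fockRep, oscillator]

theorem act_one_vec (a : Fock) {n : ℤ} (hn : 0 ≤ n) : fockRep.act n a 1 = 0 := by
  induction a using MvPolynomial.induction_on' with
  | add p q hp hq => rw [map_add, LinearMap.add_apply, hp, hq, add_zero]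
  | monomial s c =>
    rw [monomial_eq_smul, map_smul, LinearMap.smul_apply]
    suffices h : fockRep.act n (monomial s 1) 1 = 0 by rw [h, smul_zero]
    induction s using exponent_induction generalizing n with
    | zero => rw [monomial_zero', C_1, Rep.act_one, if_neg (by omega)]; rfl
    | cons k s hks ih =>
      rw [fockRep.act_X_mul hks, finsum_eq_zero_of_forall_eq_zero fun i => ?_,
        finsum_eq_zero_of_forall_eq_zero fun i => ?_, add_zero]
      · rw [field_one k (by omega), map_zero]
      · rw [ih (by omega), map_zero]

/-- On the vacuum only the product of the two modes of index `-1` survives; every other term applies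
a mode of nonnegative index to `1`. -/
theorem act_neg_one_one_vec (a : Fock) : fockRep.act (-1) a 1 = a := by
  induction a using MvPolynomial.induction_on' with
  | add p q hp hq => rw [map_add, LinearMap.add_apply, hp, hq]
  | monomial s c =>
    rw [monomial_eq_smul, map_smul, LinearMap.smul_apply]
    congr 1
    induction s using exponent_induction with
    | zero => rw [monomial_zero', C_1, Rep.act_one, if_pos rfl]; rfl
    | cons k s hks ih =>
      rw [fockRep.act_X_mul hks, finsum_eq_single _ 0 fun i hi => ?_,
        finsum_eq_zero_of_forall_eq_zero fun i => ?_, add_zero]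
      · simp only [Nat.cast_zero, sub_zero, add_zero]
        rw [ih, field_neg_one, X, monomial_mul, mul_one]
      · rw [field_one k (by omega), map_zero]
      · rw [act_one_vec _ (by omega), map_zero]

theorem translation_X (k : ℕ) : translation (X k) = ((k : ℂ) + 1) • X (k + 1) := by
  simp [translation]

theorem translation_mul (f g : Fock) :
    translation (f * g) = f * translation g + g * translation f := by
  simp [translation, Derivation.leibniz]

theorem translation_one : translation 1 = 0 := by simp [translation]

theorem constantCoeff_translation (f : Fock) : constantCoeff (translation f) = 0 := by
  induction f using MvPolynomial.induction_on with
  | C a => simp [translation]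
  | add p q hp hq => rw [map_add, map_add, hp, hq, add_zero]
  | mul_X p k hp => simp [translation_mul, translation_X, hp]

/-- For `k = 0` the truncated index `k - 1` is harmless, as its coefficient is zero. -/
theorem pderiv_translation (k : ℕ) (f : Fock) :
    pderiv k (translation f) = translation (pderiv k f) + (k : ℂ) • pderiv (k - 1) f := by
  induction f using MvPolynomial.induction_on with
  | C a => simp [translation]
  | add p q hp hq => simp only [map_add, hp, hq, smul_add]; abel
  | mul_X p j hp =>
    have hX : pderiv k (translation (X j)) = (k : ℂ) • pderiv (k - 1) (X j : Fock) := by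
      rw [translation_X, Derivation.map_smul]
      by_cases h : j + 1 = k
      · subst h
        rw [pderiv_X_self, Nat.add_sub_cancel, pderiv_X_self]
        push_cast
        rfl
      · rw [pderiv_X_of_ne h, smul_zero]
        rcases Nat.eq_zero_or_pos k with rfl | hk
        · simp
        · rw [pderiv_X_of_ne (by omega), smul_zero]
    have hc : translation (pderiv k (X j : Fock)) = 0 := by
      by_cases h : j = k
      · rw [h, pderiv_X_self, translation_one]
      · rw [pderiv_X_of_ne h, map_zero]
    simp only [translation_mul, Derivation.leibniz, map_add, hp, hX, smul_eq_mul, hc, mul_zero,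
      smul_add, Algebra.mul_smul_comm, mul_add]
    ring

theorem translation_oscillator (n : ℤ) (v : Fock) :
    translation (oscillator n v) = oscillator n (translation v) - n • oscillator (n - 1) v := by
  match n with
  | Int.ofNat 0 => simp [oscillator]
  | Int.ofNat (k + 1) =>
    have h : (Int.ofNat (k + 1) - 1 : ℤ) = Int.ofNat k := by simp
    rw [h]
    have hk : oscillator (Int.ofNat k) v = (k : ℂ) • pderiv (k - 1) v := by
      match k with
      | 0 => simp [oscillator]
      | k + 1 => simp [oscillator]
    rw [hk]
    simp only [oscillator, LinearMap.smul_apply]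
    change _ = ((k : ℂ) + 1) • pderiv k (translation v) - _
    rw [pderiv_translation, smul_add, map_smul]
    change ((k : ℂ) + 1) • translation (pderiv k v) = _
    rw [← Int.cast_smul_eq_zsmul ℂ]
    simp
  | Int.negSucc k =>
    rw [show (Int.negSucc k - 1 : ℤ) = Int.negSucc (k + 1) by
      rw [Int.negSucc_eq, Int.negSucc_eq]; push_cast; ring]
    simp only [oscillator, LinearMap.mulLeft_apply, translation_mul, translation_X]
    rw [← Int.cast_smul_eq_zsmul ℂ, Int.negSucc_eq]
    push_cast
    rw [neg_smul, sub_neg_eq_add, mul_smul_comm, mul_comm v]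

theorem finsum_eq_range {f : ℕ → Fock} {N : ℕ} (h : ∀ i, N ≤ i → f i = 0) :
    ∑ᶠ i, f i = ∑ i ∈ Finset.range N, f i :=
  finsum_eq_sum_of_support_subset _ fun i hi => by
    by_contra h'
    exact hi (h i (by simpa using h'))

theorem exists_bound_of_finite {f : ℕ → Fock} (h : (Function.support f).Finite) :
    ∃ N, ∀ i, N ≤ i → f i = 0 := by
  obtain ⟨N, hN⟩ := h.bddAbove
  refine ⟨N + 1, fun i hi => ?_⟩
  by_contra h'
  have := hN h'
  omega

theorem finsum_succ {f : ℕ → Fock} (h : (Function.support f).Finite) :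
    ∑ᶠ i, f i = f 0 + ∑ᶠ i, f (i + 1) := by
  obtain ⟨N, hN⟩ := exists_bound_of_finite h
  rw [finsum_eq_range (N := N + 1) fun i hi => hN i (by omega),
    finsum_eq_range (N := N) fun i hi => hN (i + 1) (by omega), Finset.sum_range_succ', add_comm]

/-- Translation covariance of a field. -/
def TransCov (A : VertexOperator ℂ Fock) : Prop :=
  ∀ (n : ℤ) (v : Fock), translation (VertexOperator.ncoeff A n v) =
    VertexOperator.ncoeff A n (translation v) - n • VertexOperator.ncoeff A (n - 1) v

theorem transCov_field (k : ℕ) : TransCov (fockRep.field k) := by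
  intro n v
  simp only [ncoeff_field, LinearMap.smul_apply, map_zsmul]
  rw [fockRep, translation_oscillator, smul_sub, smul_smul, smul_smul]
  congr 2
  · rw [mul_assoc, mul_comm (Ring.choose n k), sub_mul_choose]
    ring
  · rw [sub_right_comm]

theorem finite_support_zsmul (c : ℕ → ℤ) {f : ℕ → Fock} (h : (Function.support f).Finite) :
    (Function.support fun i => c i • f i).Finite :=
  h.subset fun i => mt fun (h : f i = 0) => show c i • f i = 0 by rw [h, smul_zero]

/-- Summation by parts: the sum of `(i + 1) F (i + 1)` equals the sum of `i F i`, and the weights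
`i` cancel. -/
theorem finsum_shift_sub {F : ℕ → Fock} (h : (Function.support F).Finite) (n : ℤ) :
    ∑ᶠ i : ℕ, (((i : ℤ) + 1) • F (i + 1) - (n + i) • F i) = -(n • ∑ᶠ i, F i) := by
  have h1 := finsum_succ (finite_support_zsmul (fun i => (i : ℤ)) h)
  simp only [Nat.cast_zero, zero_smul, zero_add, Nat.cast_add, Nat.cast_one] at h1
  have h2 : (Function.support fun i : ℕ => ((i : ℤ) + 1) • F (i + 1)).Finite := by
    have := finite_support_zsmul (fun i => (i : ℤ)) h
    obtain ⟨N, hN⟩ := exists_bound_of_finite h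
    refine (Set.finite_lt_nat N).subset fun i hi => ?_
    by_contra h'
    exact hi (by simp only [hN (i + 1) (by simp at h'; omega), smul_zero])
  rw [finsum_sub_distrib h2 (finite_support_zsmul _ h), ← h1,
    ← finsum_sub_distrib (finite_support_zsmul _ h) (finite_support_zsmul _ h),
    smul_finsum' _ h, ← finsum_neg_distrib]
  refine finsum_congr fun i => ?_
  rw [← sub_smul, ← neg_smul]
  congr 1
  ring

/-- In each half of the normally ordered product, commuting `T` past the two modes lowers one of the
two indices by one. After a shift of summation the two coefficients combine to the constant `-n`. -/
theorem TransCov.normalOrder {A B : VertexOperator ℂ Fock} (hA : TransCov A) (hB : TransCov B) :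
    TransCov (normalOrder A B) := by
  intro n v
  set F : ℕ → Fock := fun i =>
    VertexOperator.ncoeff A (-1 - i) (VertexOperator.ncoeff B (n - 1 + i) v) with hF
  set G : ℕ → Fock := fun i =>
    VertexOperator.ncoeff B (n - 1 - 1 - i) (VertexOperator.ncoeff A i v) with hG
  have sF : (Function.support F).Finite := finite_support_left A B (n - 1) v
  have sG : (Function.support G).Finite := finite_support_right A B (n - 1) v
  have e1 : ∀ i : ℕ, translation (VertexOperator.ncoeff A (-1 - i)
      (VertexOperator.ncoeff B (n + i) v)) = VertexOperator.ncoeff A (-1 - i)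
      (VertexOperator.ncoeff B (n + i) (translation v)) +
      (((i : ℤ) + 1) • F (i + 1) - (n + i) • F i) := fun i => by
    rw [hA, hB, map_sub, map_zsmul, hF]
    simp only [Nat.cast_add, Nat.cast_one]
    rw [show (-1 - (i : ℤ) - 1) = -1 - (i + 1) by ring,
      show n - 1 + ((i : ℤ) + 1) = n + i by ring, show n + (i : ℤ) - 1 = n - 1 + i by ring]
    module
  have e2 : ∀ i : ℕ, translation (VertexOperator.ncoeff B (n - 1 - i)
      (VertexOperator.ncoeff A i v)) = VertexOperator.ncoeff B (n - 1 - i)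
      (VertexOperator.ncoeff A i (translation v)) -
      ((n - 1 - i) • G i + (i : ℤ) • VertexOperator.ncoeff B (n - 1 - i)
        (VertexOperator.ncoeff A (i - 1) v)) := fun i => by
    rw [hB, hA, map_sub, map_zsmul, hG]
    simp only
    rw [show (n - 1 - (i : ℤ) - 1) = n - 1 - 1 - i by ring]
    abel
  have s3 : (Function.support fun i : ℕ => (i : ℤ) • VertexOperator.ncoeff B (n - 1 - i)
        (VertexOperator.ncoeff A (i - 1) v)).Finite := by
    refine finite_support_zsmul _ ?_
    simpa only [neg_add_eq_sub] using finite_support_nat (exists_ncoeff_eq_zero A v) (-1)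
      (F := fun i => VertexOperator.ncoeff B (n - 1 - i))
  have e3 : ∑ᶠ i : ℕ, ((n - 1 - i) • G i + (i : ℤ) • VertexOperator.ncoeff B (n - 1 - i)
        (VertexOperator.ncoeff A (i - 1) v)) = n • ∑ᶠ i, G i := by
    have h3 := finsum_succ s3
    simp only [Nat.cast_zero, zero_smul, zero_add, Nat.cast_add, Nat.cast_one,
      add_sub_cancel_right] at h3
    have h4 : ∀ i : ℕ, ((i : ℤ) + 1) • VertexOperator.ncoeff B (n - 1 - (i + 1))
        (VertexOperator.ncoeff A i v) = ((i : ℤ) + 1) • G i := fun i => by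
      rw [hG]
      simp only
      rw [show n - 1 - ((i : ℤ) + 1) = n - 1 - 1 - i by ring]
    rw [finsum_add_distrib (finite_support_zsmul _ sG) s3, h3, finsum_congr h4,
      ← finsum_add_distrib (finite_support_zsmul _ sG) (finite_support_zsmul _ sG),
      smul_finsum' _ sG]
    refine finsum_congr fun i => ?_
    rw [← add_smul]
    congr 1
    ring
  have hs1 : (Function.support fun i : ℕ => (((i : ℤ) + 1) • F (i + 1) - (n + i) • F i)).Finite := by
    obtain ⟨N, hN⟩ := exists_bound_of_finite sF
    refine (Set.finite_lt_nat N).subset fun i hi => ?_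
    by_contra h'
    simp only [Set.mem_ofPred_eq, not_lt] at h'
    exact hi (by simp only [hN (i + 1) (by omega), hN i h', smul_zero, sub_zero])
  rw [ncoeff_normalOrder, map_add, map_finsum translation (finite_support_left A B n v),
    map_finsum translation (finite_support_right A B n v), finsum_congr e1, finsum_congr e2,
    finsum_add_distrib (finite_support_left A B n _) hs1, finsum_shift_sub sF,
    finsum_sub_distrib (finite_support_right A B n _)
      (((finite_support_zsmul _ sG).union s3).subset (Function.support_add _ _)), e3,
    ncoeff_normalOrder, ncoeff_normalOrder, smul_add]
  abel

theorem translation_act (a : Fock) (n : ℤ) (v : Fock) :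
    translation (fockRep.act n a v) =
      fockRep.act n a (translation v) - n • fockRep.act (n - 1) a v := by
  induction a using MvPolynomial.induction_on' with
  | add p q hp hq => simp only [map_add, LinearMap.add_apply, hp, hq, smul_add]; abel
  | monomial s c =>
    have h : ∀ s : ℕ →₀ ℕ, TransCov (fockRep.Y (monomial s 1)) := fun s => by
      induction s using exponent_induction with
      | zero =>
        intro n v
        have h := fun n => fockRep.act_one n
        simp only [Rep.act, LinearMap.comp_apply, LinearMap.proj_apply] at h
        rw [monomial_zero', C_1, h, h]
        split_ifs with h1 h2
        · omega
        · simp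
        · have : n = 0 := by omega
          simp [this]
        · simp
      | cons k s hks ih =>
        rw [fockRep.Y_X_mul hks]
        exact (transCov_field k).normalOrder ih
    rw [monomial_eq_smul]
    simp only [map_smul, LinearMap.smul_apply]
    rw [show fockRep.act n (monomial s 1) =
      VertexOperator.ncoeff (fockRep.Y (monomial s 1)) n from rfl, h s n v, smul_sub, smul_comm c]
    rfl

/-- Vacuum expectation values of products of two modes. -/
theorem constantCoeff_act_act (a v : Fock) (p : ℤ) (t : ℕ) :
    constantCoeff (fockRep.act p a (fockRep.act (-1 - t) v 1)) =
      (Ring.choose p t : ℤ) * constantCoeff (fockRep.act (p - t) a v) := by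
  induction t generalizing p with
  | zero => simp [act_neg_one_one_vec]
  | succ t ih =>
    -- `T` sends the mode `-1 - t` of `v` on the vacuum to `t + 1` times the mode `-2 - t`. Since
    -- the image of `T` has no constant term, moving `T` to the left past `a₍ₚ₎` leaves only the
    -- commutator.
    have h1 := translation_act v (-1 - t) 1
    rw [translation_one, map_zero, zero_sub, ← neg_smul] at h1
    have h2 := congrArg constantCoeff (translation_act a p (fockRep.act (-1 - t) v 1))
    rw [constantCoeff_translation, map_sub, h1, map_zsmul, map_zsmul, map_zsmul, ih] at h2
    have h3 := congrArg (Int.cast (R := ℂ)) (succ_mul_choose' p t)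
    push_cast at h3
    rw [show (-1 - (t : ℤ) - 1) = -1 - ((t + 1 : ℕ) : ℤ) by push_cast; ring,
      show (p - 1 - t : ℤ) = p - ((t + 1 : ℕ) : ℤ) by push_cast; ring] at h2
    have ht : ((t : ℂ) + 1) ≠ 0 := Nat.cast_add_one_ne_zero t
    refine mul_left_cancel₀ ht ?_
    rw [← mul_assoc, h3]
    simp only [zsmul_eq_mul] at h2
    push_cast at h2 ⊢
    linear_combination -h2

/-! ### Creation and annihilation operators as covariant operators -/

theorem pderiv_comm (j k : ℕ) (f : Fock) : pderiv j (pderiv k f) = pderiv k (pderiv j f) := by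
  have h : ⁅(pderiv j : Derivation ℂ Fock Fock), (pderiv k : Derivation ℂ Fock Fock)⁆ = 0 := by
    ext i
    rw [Derivation.commutator_apply, pderiv_X, pderiv_X]
    simp only [Pi.single_apply]
    split_ifs <;> simp
  have := congrArg (fun D : Derivation ℂ Fock Fock => D f) h
  simpa [Derivation.commutator_apply, sub_eq_zero] using this

theorem pderiv_X_mul (j k : ℕ) (f : Fock) :
    pderiv k (X j * f) = X j * pderiv k f + if j = k then f else 0 := by
  rw [Derivation.leibniz, smul_eq_mul, smul_eq_mul]
  congr 1
  split_ifs with h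
  · rw [h, pderiv_X_self, mul_one]
  · rw [pderiv_X_of_ne h, mul_zero]

theorem cov_pderiv (k : ℕ) : fockRep.Cov (pderiv k).toLinearMap 1 k := by
  intro n v
  match n with
  | Int.ofNat 0 =>
    rw [if_neg (by simp; omega)]
    simp [fockRep, oscillator]
  | Int.ofNat (j + 1) =>
    rw [if_neg (by simp; omega)]
    simp only [fockRep, oscillator, LinearMap.smul_apply, map_smul, Derivation.coeFn_coe,
      pderiv_comm k j, add_zero]
  | Int.negSucc j =>
    have := pderiv_X_mul j k v
    simp only [fockRep, oscillator, LinearMap.mulLeft_apply, Derivation.coeFn_coe, this, one_smul]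
    congr 1
    refine if_congr ?_ rfl rfl
    rw [Int.negSucc_eq]
    omega

/-- `X k` is `b₋ₖ₋₁`, which fails to commute only with `bₖ₊₁`; the index `k + 1` is `-1 - r` for `r
= -2 - k`. -/
theorem cov_X (k : ℕ) : fockRep.Cov (LinearMap.mulLeft ℂ (X k)) (-((k : ℂ) + 1)) (-2 - k) := by
  intro n v
  match n with
  | Int.ofNat 0 =>
    rw [if_neg (by simp; omega)]
    simp [fockRep, oscillator]
  | Int.ofNat (j + 1) =>
    have := pderiv_X_mul k j v
    simp only [fockRep, oscillator, LinearMap.mulLeft_apply, LinearMap.smul_apply,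
      Derivation.coeFn_coe, this, mul_smul_comm, smul_add, Int.ofNat_eq_natCast]
    by_cases h : k = j
    · subst h
      rw [if_pos rfl, if_pos (by push_cast; ring)]
      module
    · rw [if_neg h, if_neg (by push_cast; omega)]
      simp
  | Int.negSucc j =>
    rw [if_neg (by rw [Int.negSucc_eq]; omega)]
    simp only [fockRep, oscillator, LinearMap.mulLeft_apply]
    ring

theorem negOnePow_natCast (n : ℕ) : ((n : ℤ).negOnePow : ℤ) = (-1) ^ n := by
  simp [Int.negOnePow]

theorem constantCoeff_X_mul (k : ℕ) (f : Fock) : constantCoeff (X k * f) = 0 := by simp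

/-- Skew-symmetry of the top pairing. -/
theorem skew {i j : ℤ} {a v : Fock} (ha : a ∈ grade wt i) (hv : v ∈ grade wt j) :
    constantCoeff (fockRep.act (i + j - 1) v a) =
      ((i + j).negOnePow : ℤ) * constantCoeff (fockRep.act (i + j - 1) a v) := by
  refine grade_induction (P := fun a => constantCoeff (fockRep.act (i + j - 1) v a) =
      ((i + j).negOnePow : ℤ) * constantCoeff (fockRep.act (i + j - 1) a v)) (fun s c hs => ?_)
    (by simp) (fun p q hp hq => by simp only [map_add, LinearMap.add_apply, hp, hq]; ring) ha
  clear ha a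
  rw [monomial_eq_smul]
  simp only [map_smul, LinearMap.smul_apply, constantCoeff_smul]
  rw [smul_eq_mul, smul_eq_mul, mul_left_comm]
  congr 1
  induction s using exponent_induction generalizing i j v with
  | zero =>
    rw [map_zero] at hs
    subst hs
    rw [monomial_zero', C_1, Rep.act_one, zero_add]
    rcases lt_trichotomy j 0 with h | h | h
    · rw [eq_zero_of_mem_grade wt_nonneg h hv]
      simp
    · subst h
      simp [act_neg_one_one_vec]
    · rw [act_one_vec _ (by omega), if_neg (by omega)]
      simp
  | cons k s hks ih =>
    rw [map_add, Finsupp.weight_single, one_smul, wt] at hs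
    obtain ⟨K, hK⟩ := exists_pderiv_eq_zero v
    have hX : (monomial (Finsupp.single k 1 + s) 1 : Fock) = X k * monomial s 1 := by
      rw [X, monomial_mul, mul_one]
    -- The leading variable is commuted out through the mode of `v`; once outside it kills the
    -- constant term, so only the terms with derivatives of `v` remain.
    have h1 := congrArg constantCoeff ((cov_X k).act hK (i + j - 1) (monomial s 1))
    rw [LinearMap.mulLeft_apply, LinearMap.mulLeft_apply, constantCoeff_X_mul, ← hX, map_add,
      constantCoeff_smul, map_sum] at h1
    have hfs : (Function.support fun t : ℕ => VertexOperator.ncoeff (fockRep.field k) (-1 - t)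
        (fockRep.act (i + j - 1 + t) (monomial s 1) v)).Finite :=
      finite_support_left (fockRep.field k) (fockRep.Y (monomial s 1)) (i + j - 1) v
    have hz : ∀ t : ℕ, t < k + 1 → VertexOperator.ncoeff (fockRep.field k) t v = 0 := fun t ht => by
      rw [ncoeff_field]
      rcases lt_or_ge t k with h | h
      · rw [choose_eq_zero_of_lt (by omega) (by omega), mul_zero, zero_smul, LinearMap.zero_apply]
      · have : (t : ℤ) - k = Int.ofNat 0 := by simp; omega
        rw [this]
        simp [fockRep, oscillator]
    have hp : ∀ t : ℕ, VertexOperator.ncoeff (fockRep.field k) ((k + 1 + t : ℕ) : ℤ) v =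
        ((-1) ^ k * Ring.choose ((k + 1 + t : ℕ) : ℤ) k) • ((t : ℂ) + 1) • pderiv t v := fun t => by
      rw [ncoeff_field, LinearMap.smul_apply]
      have : ((k + 1 + t : ℕ) : ℤ) - k = Int.ofNat (t + 1) := by simp; omega
      rw [this]
      rfl
    -- The creation half lies in the ideal generated by the variables. In the other half the modes
    -- of the leading field of index at most `k` kill `v`, and the mode of index `k + 1 + t` is a
    -- multiple of `∂/∂X t`.
    have h2 : constantCoeff (fockRep.act (i + j - 1) (monomial (Finsupp.single k 1 + s) 1) v) =
        ∑ t ∈ Finset.range K, ((-1) ^ k * (Ring.choose ((k + 1 + t : ℕ) : ℤ) k : ℤ) *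
          ((t : ℂ) + 1)) * constantCoeff (fockRep.act (i + j - 3 - k - t) (monomial s 1)
            (pderiv t v)) := by
      rw [fockRep.act_X_mul hks, map_add, map_finsum constantCoeff hfs,
        finsum_eq_zero_of_forall_eq_zero fun t => ?_, zero_add,
        finsum_eq_range (N := k + 1 + K) fun t ht => ?_, Finset.sum_range_add,
        Finset.sum_eq_zero fun t ht => ?_, zero_add, map_sum]
      · refine Finset.sum_congr rfl fun t _ => ?_
        rw [hp, map_zsmul, map_zsmul, map_smul, constantCoeff_smul, zsmul_eq_mul, smul_eq_mul,
          show i + j - 1 - 1 - ((k + 1 + t : ℕ) : ℤ) = i + j - 3 - k - t by push_cast; ring]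
        push_cast
        ring
      · rw [hz t (Finset.mem_range.1 ht), map_zero]
      · obtain ⟨u, rfl⟩ : ∃ u, t = k + 1 + u := ⟨t - (k + 1), by omega⟩
        rw [hp, hK u (by omega), smul_zero, smul_zero, map_zero]
      · obtain ⟨c, hc⟩ := field_neg k t (fockRep.act (i + j - 1 + t) (monomial s 1) v)
        exact (congrArg constantCoeff hc).trans (by simp)
    rw [h2, Finset.mul_sum]
    have h3 : constantCoeff (fockRep.act (i + j - 1) v (monomial (Finsupp.single k 1 + s) 1)) =
        ((k : ℂ) + 1) * ∑ t ∈ Finset.range K, constantCoeff (Ring.choose (-2 - k : ℤ) t •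
          fockRep.act (i + j - 1 + (-2 - k) - t) (pderiv t v) (monomial s 1)) := by
      rw [smul_eq_mul] at h1
      linear_combination -h1
    rw [h3, Finset.mul_sum]
    refine Finset.sum_congr rfl fun t _ => ?_
    have e1 := ih (i := i - k - 1) (j := j - t - 1) (v := pderiv t v)
      (by have := pderiv_mem_grade t hv; rwa [wt, ← sub_sub] at this) (by omega)
    rw [show i - k - 1 + (j - t - 1) - 1 = i + j - 3 - k - t by ring] at e1
    rw [map_zsmul, show i + j - 1 + (-2 - k) - t = i + j - 3 - k - t by ring, e1, zsmul_eq_mul]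
    have hs1 : ((i - k - 1 + (j - t - 1)).negOnePow : ℤ) =
        ((i + j).negOnePow : ℤ) * (-1) ^ k * (-1) ^ t := by
      rw [show i - k - 1 + (j - t - 1) = (i + j) - k - t - 2 by ring, Int.negOnePow_sub,
        Int.negOnePow_sub, Int.negOnePow_sub]
      push_cast
      rw [negOnePow_natCast, negOnePow_natCast, show Int.negOnePow 2 = 1 from rfl]
      simp
    -- Up to the sign `(-1)ᵗ` both sides are `(k + 1 + t)! / (k! t!)`; this matches the coefficients
    -- produced by the two expansions.
    have hc : ((k : ℤ) + 1) * Ring.choose (-2 - k : ℤ) t =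
        (-1) ^ t * Ring.choose ((k + 1 + t : ℕ) : ℤ) k * (t + 1) := by
      have r1 := choose_reflect (-2 - k) t
      have r2 := succ_mul_choose ((k + 1 + t : ℕ) : ℤ) k
      rw [show (t : ℤ) - 1 - (-2 - k) = ((k + 1 + t : ℕ) : ℤ) by push_cast; ring,
        Ring.choose_natCast, ← Nat.choose_symm_add] at r1
      rw [Ring.choose_natCast, Ring.choose_natCast] at r2
      rw [← r1, Ring.choose_natCast]
      push_cast at r2 ⊢
      linear_combination ((-1) ^ t) * r2
    have hs2 := congrArg (Int.cast (R := ℂ)) hs1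
    have hc2 := congrArg (Int.cast (R := ℂ)) hc
    have ht : ((-1 : ℂ) ^ t) * (-1) ^ t = 1 := by rw [← mul_pow]; simp
    push_cast at hs2 hc2
    rw [hs2]
    push_cast
    linear_combination (((i + j).negOnePow : ℤ) * (-1 : ℂ) ^ k * (-1) ^ t *
      constantCoeff (fockRep.act (i + j - 3 - k - t) (monomial s 1) (pderiv t v))) * hc2 +
      ((Ring.choose ((k : ℤ) + 1 + t) k : ℤ) * ((t : ℂ) + 1) * ((i + j).negOnePow : ℤ) * (-1 : ℂ) ^ k *
      constantCoeff (fockRep.act (i + j - 3 - k - t) (monomial s 1) (pderiv t v))) * ht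

/-! ### The polynomial module -/

/-- The oscillators on the universal Fock module: the variable `X 0` is the central parameter `b₀`
and `X k` is the creation operator `b₋ₖ`. -/
def polyOscillator : ℤ → Module.End ℂ Fock
  | Int.ofNat 0 => LinearMap.mulLeft ℂ (X 0)
  | Int.ofNat (k + 1) => ((k : ℂ) + 1) • (pderiv (k + 1)).toLinearMap
  | Int.negSucc k => LinearMap.mulLeft ℂ (X (k + 1))

/-- The universal Fock module. -/
def polyRep : Rep where
  osc := polyOscillator
  trunc v := by
    obtain ⟨K, hK⟩ := exists_pderiv_eq_zero v
    refine ⟨K + 1, fun n hn => ?_⟩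
    match n, hn with
    | Int.ofNat 0, hn => simp at hn; omega
    | Int.ofNat (k + 1), hn =>
      have := hK (k + 1) (by simp at hn; omega)
      simp [polyOscillator, this]
    | Int.negSucc k, hn => omega

theorem polyCov_pderiv (k : ℕ) : polyRep.Cov (pderiv k).toLinearMap 1 (k - 1) := by
  intro n v
  match n with
  | Int.ofNat 0 =>
    have := pderiv_X_mul 0 k v
    simp only [polyRep, polyOscillator, LinearMap.mulLeft_apply, Derivation.coeFn_coe, this,
      one_smul]
    congr 1
    refine if_congr ?_ rfl rfl
    simp
    omega
  | Int.ofNat (j + 1) =>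
    rw [if_neg (by simp; omega)]
    simp only [polyRep, polyOscillator, LinearMap.smul_apply, map_smul, Derivation.coeFn_coe,
      pderiv_comm k (j + 1), add_zero]
  | Int.negSucc j =>
    have := pderiv_X_mul (j + 1) k v
    simp only [polyRep, polyOscillator, LinearMap.mulLeft_apply, Derivation.coeFn_coe, this,
      one_smul]
    congr 1
    refine if_congr ?_ rfl rfl
    rw [Int.negSucc_eq]
    omega

/-- Here `X k` is `b₋ₖ`; for `k = 0` the coefficient vanishes, in accordance with `b₀` being
central. -/
theorem polyCov_X (k : ℕ) : polyRep.Cov (LinearMap.mulLeft ℂ (X k)) (-(k : ℂ)) (-1 - k) := by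
  intro n v
  match n with
  | Int.ofNat 0 =>
    have : X k * (X 0 * v) = X 0 * (X k * v) := by ring
    simp only [polyRep, polyOscillator, LinearMap.mulLeft_apply, this]
    split_ifs with h
    · have : k = 0 := by simp at h; omega
      subst this
      simp
    · simp
  | Int.ofNat (j + 1) =>
    have := pderiv_X_mul k (j + 1) v
    simp only [polyRep, polyOscillator, LinearMap.mulLeft_apply, LinearMap.smul_apply,
      Derivation.coeFn_coe, this, mul_smul_comm, smul_add, Int.ofNat_eq_natCast]
    by_cases h : k = j + 1
    · subst h
      rw [if_pos rfl, if_pos (by push_cast; ring)]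
      push_cast
      module
    · rw [if_neg h, if_neg (by push_cast; omega)]
      simp
  | Int.negSucc j =>
    rw [if_neg (by rw [Int.negSucc_eq]; omega)]
    simp only [polyRep, polyOscillator, LinearMap.mulLeft_apply]
    ring

/-- Specialization of the central parameter of the universal Fock module to zero. -/
def specialize : Fock →ₐ[ℂ] Fock := aeval fun k => match k with
  | 0 => 0
  | k + 1 => X k

theorem specialize_X_zero : specialize (X 0) = 0 := by simp [specialize]

theorem specialize_X_succ (k : ℕ) : specialize (X (k + 1)) = X k := by simp [specialize]

theorem specialize_pderiv (k : ℕ) (f : Fock) :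
    specialize (pderiv (k + 1) f) = pderiv k (specialize f) := by
  induction f using MvPolynomial.induction_on with
  | C a => simp [specialize]
  | add p q hp hq => simp only [map_add, hp, hq]
  | mul_X p j hp =>
    rw [mul_comm, pderiv_X_mul, map_add, map_mul specialize, map_mul specialize, hp]
    match j with
    | 0 => simp [specialize_X_zero]
    | j + 1 =>
      rw [specialize_X_succ, pderiv_X_mul, apply_ite specialize, map_zero]
      simp only [add_left_inj]

theorem specialize_oscillator (n : ℤ) (v : Fock) :
    specialize (polyOscillator n v) = oscillator n (specialize v) := by
  match n with
  | Int.ofNat 0 => simp [polyOscillator, oscillator, specialize_X_zero]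
  | Int.ofNat (k + 1) => simp [polyOscillator, oscillator, specialize_pderiv]
  | Int.negSucc k => simp [polyOscillator, oscillator, specialize_X_succ]

theorem specialize_field (k : ℕ) (n : ℤ) (v : Fock) :
    specialize (VertexOperator.ncoeff (polyRep.field k) n v) =
      VertexOperator.ncoeff (fockRep.field k) n (specialize v) := by
  simp only [ncoeff_field, LinearMap.smul_apply, map_zsmul]
  rw [polyRep, specialize_oscillator]
  rfl

/-- Specialization intertwines the oscillators and hence everything built from them. Vacuum
expectation values on the universal Fock module can therefore be computed on `π`. -/
theorem specialize_act (n : ℤ) (a v : Fock) :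
    specialize (polyRep.act n a v) = fockRep.act n a (specialize v) := by
  induction a using MvPolynomial.induction_on' with
  | add p q hp hq => simp only [map_add, LinearMap.add_apply, hp, hq]
  | monomial s c =>
    rw [monomial_eq_smul]
    simp only [map_smul, LinearMap.smul_apply]
    congr 1
    induction s using exponent_induction generalizing n v with
    | zero =>
      rw [monomial_zero', C_1, Rep.act_one, Rep.act_one]
      split_ifs <;> simp
    | cons k s hks ih =>
      have h1 := finite_support_left (polyRep.field k) (polyRep.Y (monomial s 1)) n v
      have h2 := finite_support_right (polyRep.field k) (polyRep.Y (monomial s 1)) n v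
      rw [polyRep.act_X_mul hks, fockRep.act_X_mul hks, map_add]
      congr 1
      · refine (map_finsum specialize h1).trans (finsum_congr fun i => ?_)
        exact (specialize_field _ _ _).trans (congrArg _ (ih _ _))
      · refine (map_finsum specialize h2).trans (finsum_congr fun i => ?_)
        exact (ih _ _).trans (congrArg _ (specialize_field _ _ _))

/-- An operator that commutes with all multiplications and all derivatives is a scalar. -/
theorem exists_scalar (O : Module.End ℂ Fock) (hX : ∀ k w, X k * O w = O (X k * w))
    (hd : ∀ k w, pderiv k (O w) = O (pderiv k w)) : ∃ c : ℂ, ∀ w, O w = c • w := by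
  -- `O 1` is killed by all partial derivatives, so in characteristic zero it is constant.
  have h1 : O 1 = C (coeff 0 (O 1)) := by
    ext s
    rw [coeff_C]
    split_ifs with h
    · rw [h]
    · obtain ⟨k, hk⟩ := Finsupp.ne_iff.1 (Ne.symm h)
      have h2 := congrArg (coeff (s - Finsupp.single k 1)) (hd k 1)
      have h3 : s - Finsupp.single k 1 + Finsupp.single k 1 = s :=
        tsub_add_cancel_of_le (Finsupp.single_le_iff.2 (Nat.one_le_iff_ne_zero.2 hk))
      rw [pderiv_one, map_zero, coeff_pderiv, h3, coeff_zero] at h2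
      exact (mul_eq_zero.1 h2).resolve_right (Nat.cast_add_one_ne_zero _)
  refine ⟨coeff 0 (O 1), fun w => ?_⟩
  induction w using MvPolynomial.induction_on with
  | C a =>
    rw [show (C a : Fock) = a • 1 by rw [smul_eq_C_mul, mul_one], map_smul, smul_comm]
    congr 1
    rw [smul_eq_C_mul, mul_one, ← h1]
  | add p q hp hq => rw [map_add, hp, hq, smul_add]
  | mul_X p k hp => rw [mul_comm, ← hX, hp, mul_smul_comm]

/-! ### The Jacobi identity -/

/-- The `i`-th term of the left-hand side of the Jacobi identity for modes. -/
def Rep.jacTerm (ρ : Rep) (a v : Fock) (l m n : ℤ) (w : Fock) (i : ℕ) : Fock :=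
  ((-1 : ℤ) ^ i * Ring.choose l i) •
    (ρ.act (m + l - i) a (ρ.act (n + i) v w) -
      (l.negOnePow : ℤ) • ρ.act (n + l - i) v (ρ.act (m + i) a w))

/-- The `i`-th term of the right-hand side of the Jacobi identity for modes. -/
def Rep.jacTerm' (ρ : Rep) (a v : Fock) (l m n : ℤ) (w : Fock) (i : ℕ) : Fock :=
  Ring.choose m i • ρ.act (m + n - i) (fockRep.act (l + i) a v) w

theorem Rep.exists_act_bound (ρ : Rep) (a w : Fock) (n : ℤ) :
    ∃ N : ℕ, ∀ i : ℕ, N ≤ i → ρ.act (n + i) a w = 0 := by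
  obtain ⟨N, hN⟩ := ρ.act_trunc a w
  exact ⟨(N - n).toNat, fun i hi => hN _ (by omega)⟩

theorem Rep.exists_jacTerm_bound (ρ : Rep) (a v : Fock) (l m n : ℤ) (w : Fock) :
    ∃ N : ℕ, ∀ i, N ≤ i → ρ.jacTerm a v l m n w i = 0 := by
  obtain ⟨N, hN⟩ := ρ.exists_act_bound v w n
  obtain ⟨M, hM⟩ := ρ.exists_act_bound a w m
  refine ⟨max N M, fun i hi => ?_⟩
  rw [jacTerm, hN i (le_trans (le_max_left _ _) hi), hM i (le_trans (le_max_right _ _) hi)]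
  simp

theorem exists_jacTerm'_bound (ρ : Rep) (a v : Fock) (l m n : ℤ) (w : Fock) :
    ∃ N : ℕ, ∀ i, N ≤ i → ρ.jacTerm' a v l m n w i = 0 := by
  obtain ⟨N, hN⟩ := fockRep.exists_act_bound a v l
  exact ⟨N, fun i hi => by simp [Rep.jacTerm', hN i hi]⟩

theorem finite_of_bound {f : ℕ → Fock} (h : ∃ N, ∀ i, N ≤ i → f i = 0) :
    (Function.support f).Finite := by
  obtain ⟨N, hN⟩ := h
  refine (Set.finite_lt_nat N).subset fun i hi => ?_
  by_contra h'
  simp only [Set.mem_ofPred_eq, not_lt] at h'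
  exact hi (hN i h')

theorem Rep.finite_jacTerm (ρ : Rep) (a v : Fock) (l m n : ℤ) (w : Fock) :
    (Function.support (ρ.jacTerm a v l m n w)).Finite :=
  finite_of_bound (ρ.exists_jacTerm_bound a v l m n w)

theorem Rep.finite_jacTerm' (ρ : Rep) (a v : Fock) (l m n : ℤ) (w : Fock) :
    (Function.support (ρ.jacTerm' a v l m n w)).Finite :=
  finite_of_bound (exists_jacTerm'_bound ρ a v l m n w)

/-- The left-hand side of the Jacobi identity. -/
def Rep.jacL (ρ : Rep) (a v : Fock) (l m n : ℤ) (w : Fock) : Fock := ∑ᶠ i, ρ.jacTerm a v l m n w i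

/-- The right-hand side of the Jacobi identity. -/
def Rep.jacR (ρ : Rep) (a v : Fock) (l m n : ℤ) (w : Fock) : Fock := ∑ᶠ i, ρ.jacTerm' a v l m n w i

/-- The defect of the Jacobi identity. -/
def Rep.jac (ρ : Rep) (a v : Fock) (l m n : ℤ) (w : Fock) : Fock :=
  ρ.jacL a v l m n w - ρ.jacR a v l m n w

theorem Rep.jac_add_left (ρ : Rep) (a a' v : Fock) (l m n : ℤ) (w : Fock) :
    ρ.jac (a + a') v l m n w = ρ.jac a v l m n w + ρ.jac a' v l m n w := by
  have h1 : ∀ i, ρ.jacTerm (a + a') v l m n w i = ρ.jacTerm a v l m n w i +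
      ρ.jacTerm a' v l m n w i := fun i => by
    simp only [jacTerm, map_add, LinearMap.add_apply]
    module
  have h2 : ∀ i, ρ.jacTerm' (a + a') v l m n w i = ρ.jacTerm' a v l m n w i +
      ρ.jacTerm' a' v l m n w i := fun i => by
    simp only [jacTerm', map_add, LinearMap.add_apply, smul_add]
  rw [jac, jacL, jacR, finsum_congr h1, finsum_congr h2,
    finsum_add_distrib (ρ.finite_jacTerm ..) (ρ.finite_jacTerm ..),
    finsum_add_distrib (ρ.finite_jacTerm' ..) (ρ.finite_jacTerm' ..), jac, jac, jacL, jacR, jacL,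
    jacR]
  abel

theorem Rep.jac_add_mid (ρ : Rep) (a v v' : Fock) (l m n : ℤ) (w : Fock) :
    ρ.jac a (v + v') l m n w = ρ.jac a v l m n w + ρ.jac a v' l m n w := by
  have h1 : ∀ i, ρ.jacTerm a (v + v') l m n w i = ρ.jacTerm a v l m n w i +
      ρ.jacTerm a v' l m n w i := fun i => by
    simp only [jacTerm, map_add, LinearMap.add_apply]
    module
  have h2 : ∀ i, ρ.jacTerm' a (v + v') l m n w i = ρ.jacTerm' a v l m n w i +
      ρ.jacTerm' a v' l m n w i := fun i => by
    simp only [jacTerm', map_add, LinearMap.add_apply, smul_add]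
  rw [jac, jacL, jacR, finsum_congr h1, finsum_congr h2,
    finsum_add_distrib (ρ.finite_jacTerm ..) (ρ.finite_jacTerm ..),
    finsum_add_distrib (ρ.finite_jacTerm' ..) (ρ.finite_jacTerm' ..), jac, jac, jacL, jacR, jacL,
    jacR]
  abel

theorem Rep.jac_add_right (ρ : Rep) (a v : Fock) (l m n : ℤ) (w w' : Fock) :
    ρ.jac a v l m n (w + w') = ρ.jac a v l m n w + ρ.jac a v l m n w' := by
  have h1 : ∀ i, ρ.jacTerm a v l m n (w + w') i = ρ.jacTerm a v l m n w i +
      ρ.jacTerm a v l m n w' i := fun i => by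
    simp only [jacTerm, map_add]
    module
  have h2 : ∀ i, ρ.jacTerm' a v l m n (w + w') i = ρ.jacTerm' a v l m n w i +
      ρ.jacTerm' a v l m n w' i := fun i => by
    simp only [jacTerm', map_add, smul_add]
  rw [jac, jacL, jacR, finsum_congr h1, finsum_congr h2,
    finsum_add_distrib (ρ.finite_jacTerm ..) (ρ.finite_jacTerm ..),
    finsum_add_distrib (ρ.finite_jacTerm' ..) (ρ.finite_jacTerm' ..), jac, jac, jacL, jacR, jacL,
    jacR]
  abel

theorem Rep.jac_smul_right (ρ : Rep) (a v : Fock) (l m n : ℤ) (c : ℂ) (w : Fock) :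
    ρ.jac a v l m n (c • w) = c • ρ.jac a v l m n w := by
  have h1 : ∀ i, ρ.jacTerm a v l m n (c • w) i = c • ρ.jacTerm a v l m n w i := fun i => by
    simp only [jacTerm, map_smul, smul_comm c, smul_sub]
  have h2 : ∀ i, ρ.jacTerm' a v l m n (c • w) i = c • ρ.jacTerm' a v l m n w i := fun i => by
    simp only [jacTerm', map_smul, smul_comm c]
  rw [jac, jacL, jacR, finsum_congr h1, finsum_congr h2, ← smul_finsum' c (ρ.finite_jacTerm ..),
    ← smul_finsum' c (ρ.finite_jacTerm' ..), ← smul_sub]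
  rfl

theorem Rep.jac_zero_left (ρ : Rep) (v : Fock) (l m n : ℤ) (w : Fock) :
    ρ.jac 0 v l m n w = 0 := by
  simpa using ρ.jac_add_left 0 0 v l m n w

theorem Rep.jac_zero_mid (ρ : Rep) (a : Fock) (l m n : ℤ) (w : Fock) :
    ρ.jac a 0 l m n w = 0 := by
  simpa using ρ.jac_add_mid a 0 0 l m n w

/-! ### Covariance of the two sides of the Jacobi identity -/

theorem smul_smul_finsum_add (g : ℂ) (z : ℤ) {f f' : ℕ → Fock}
    (h : (Function.support f).Finite) (h' : (Function.support f').Finite) :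
    g • z • (∑ᶠ i, f i + ∑ᶠ i, f' i) = ∑ᶠ i, g • z • (f i + f' i) := by
  have h2 : (Function.support fun i => f i + f' i).Finite :=
    (h.union h').subset (Function.support_add _ _)
  rw [← finsum_add_distrib h h', smul_finsum' z h2,
    smul_finsum' g (finite_support_zsmul (fun _ => z) h2)]

/-- Commuting `O` past a mode of `a` replaces `a` by `∂ₖ a` and shifts `m` by `r - k`; likewise for
`v` and `n`. The shift does not depend on the summation index, so the terms regroup into left-hand
sides with the same `ℓ`. -/
theorem Rep.Cov.jacL {ρ : Rep} {O : Module.End ℂ Fock} {g : ℂ} {r : ℤ} (h : ρ.Cov O g r)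
    {a v : Fock} {K : ℕ} (ha : ∀ k, K ≤ k → pderiv k a = 0) (hv : ∀ k, K ≤ k → pderiv k v = 0)
    (l m n : ℤ) (w : Fock) : O (ρ.jacL a v l m n w) = ρ.jacL a v l m n (O w) +
      g • ∑ k ∈ Finset.range K, Ring.choose r k •
        (ρ.jacL (pderiv k a) v l (m + r - k) n w + ρ.jacL a (pderiv k v) l m (n + r - k) w) := by
  have e : ∀ i, O (ρ.jacTerm a v l m n w i) = ρ.jacTerm a v l m n (O w) i +
      ∑ k ∈ Finset.range K, g • Ring.choose r k • (ρ.jacTerm (pderiv k a) v l (m + r - k) n w i +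
        ρ.jacTerm a (pderiv k v) l m (n + r - k) w i) := fun i => by
    simp only [jacTerm, map_zsmul, map_sub, h.act ha, h.act hv, map_add, map_smul, map_sum]
    rw [← Finset.smul_sum]
    have h1 : ∀ k : ℕ, m + r - k + l - i = m + l - i + r - k := fun k => by ring
    have h2 : ∀ k : ℕ, n + r - k + l - i = n + l - i + r - k := fun k => by ring
    have h3 : ∀ k : ℕ, n + r - k + i = n + i + r - k := fun k => by ring
    have h4 : ∀ k : ℕ, m + r - k + i = m + i + r - k := fun k => by ring
    simp only [h1, h2, h3, h4, smul_add, smul_sub, Finset.sum_add_distrib,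
      Finset.sum_sub_distrib, Finset.smul_sum, smul_comm (Ring.choose r _) (_ : ℤ),
      smul_comm g (_ : ℤ)]
    abel
  have s : ∀ k ∈ Finset.range K, (Function.support fun i =>
      g • Ring.choose r k • (ρ.jacTerm (pderiv k a) v l (m + r - k) n w i +
        ρ.jacTerm a (pderiv k v) l m (n + r - k) w i)).Finite := fun k _ => by
    refine ((ρ.finite_jacTerm (pderiv k a) v l (m + r - k) n w).union
      (ρ.finite_jacTerm a (pderiv k v) l m (n + r - k) w)).subset fun i hi => ?_
    by_contra h'
    simp only [Set.mem_union, Function.mem_support, not_or, not_not] at h'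
    exact hi (by simp only [h'.1, h'.2, add_zero, smul_zero])
  have s' : (Function.support fun i => ∑ k ∈ Finset.range K, g • Ring.choose r k •
      (ρ.jacTerm (pderiv k a) v l (m + r - k) n w i +
        ρ.jacTerm a (pderiv k v) l m (n + r - k) w i)).Finite := by
    refine ((Finset.range K).finite_toSet.biUnion s).subset fun i hi => ?_
    obtain ⟨k, hk, hj⟩ := Finset.exists_ne_zero_of_sum_ne_zero hi
    exact Set.mem_biUnion hk hj
  rw [Rep.jacL, map_finsum O (ρ.finite_jacTerm ..), finsum_congr e,
    finsum_add_distrib (ρ.finite_jacTerm ..) s', finsum_sum_comm _ _ s, Finset.smul_sum]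
  congr 1
  refine Finset.sum_congr rfl fun k _ => ?_
  have s2 := (ρ.finite_jacTerm (pderiv k a) v l (m + r - k) n w)
  have s3 := (ρ.finite_jacTerm a (pderiv k v) l m (n + r - k) w)
  exact (smul_smul_finsum_add g (Ring.choose r k) s2 s3).symm

theorem sum_convolution (c d : ℕ → ℤ) (G : ℕ → Fock) (T : ℕ) (hG : ∀ t, T ≤ t → G t = 0) :
    ∑ i ∈ Finset.range T, ∑ k ∈ Finset.range T, (c i * d k) • G (i + k) =
      ∑ t ∈ Finset.range T, (∑ p ∈ Finset.HasAntidiagonal.antidiagonal t, c p.1 * d p.2) • G t := by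
  have h1 : ∀ t ∈ Finset.range T, (∑ p ∈ Finset.HasAntidiagonal.antidiagonal t, c p.1 * d p.2) • G t =
      ∑ p ∈ Finset.range T ×ˢ Finset.range T, if p.1 + p.2 = t then (c p.1 * d p.2) • G t else 0 := by
    intro t ht
    rw [Finset.sum_smul, ← Finset.sum_filter]
    refine Finset.sum_congr ?_ fun _ _ => rfl
    ext p
    simp only [Finset.HasAntidiagonal.mem_antidiagonal, Finset.mem_filter, Finset.mem_product, Finset.mem_range] at *
    omega
  rw [Finset.sum_congr rfl h1, Finset.sum_comm (s := Finset.range T) (t := _ ×ˢ _),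
    Finset.sum_product]
  refine Finset.sum_congr rfl fun i _ => Finset.sum_congr rfl fun k _ => ?_
  rw [Finset.sum_ite_eq]
  split_ifs with h
  · rfl
  · rw [hG _ (by simpa using h), smul_zero]

/-- From `(r choose k)(k choose s) = (r choose s)(r - s choose k - s)` the sum becomes a Vandermonde
convolution. The truncated difference `k - s` does no harm, since `(k choose s) = 0` for `k < s`. -/
theorem sum_choose_convolution (m r : ℤ) (s : ℕ) (G : ℕ → Fock) (T K : ℕ) (hK : s + T ≤ K)
    (hG : ∀ t, T ≤ t → G t = 0) :
    ∑ i ∈ Finset.range T, ∑ k ∈ Finset.range K,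
      (Ring.choose m i * (Ring.choose r k * Ring.choose (k : ℤ) s)) • G (i + (k - s)) =
      Ring.choose r s • ∑ t ∈ Finset.range T, Ring.choose (m + r - s) t • G t := by
  obtain ⟨L, rfl⟩ : ∃ L, K = s + L := ⟨K - s, by omega⟩
  have hv : ∀ t : ℕ, Ring.choose (m + r - s) t =
      ∑ p ∈ Finset.HasAntidiagonal.antidiagonal t, Ring.choose m p.1 * Ring.choose (r - s) p.2 := fun t => by
    rw [← Ring.add_choose_eq t (Commute.all m (r - s)), add_sub_assoc]
  have hc : ∀ k : ℕ, Ring.choose r (s + k) * Ring.choose ((s + k : ℕ) : ℤ) s =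
      Ring.choose r s * Ring.choose (r - s) k := fun k => by
    have := Ring.choose_smul_choose r (Nat.le_add_right s k)
    rw [nsmul_eq_mul, add_tsub_cancel_left] at this
    rw [Ring.choose_natCast, mul_comm, this]
  simp only [hv]
  rw [← sum_convolution _ _ G T hG, Finset.smul_sum]
  refine Finset.sum_congr rfl fun i _ => ?_
  rw [Finset.sum_range_add, Finset.sum_eq_zero fun k hk => ?_, zero_add, Finset.smul_sum]
  · symm
    refine (Finset.sum_subset (Finset.range_mono (show T ≤ L by omega)) fun k _ hk => ?_).trans ?_
    · rw [hG _ (by simp at hk; omega), smul_zero, smul_zero]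
    · refine Finset.sum_congr rfl fun k _ => ?_
      rw [hc, smul_smul, add_tsub_cancel_left]
      congr 1
      ring
  · rw [choose_eq_zero_of_lt (n := (k : ℤ)) (by omega) (by simpa using hk), mul_zero, mul_zero,
      zero_smul]

theorem exists_uniform_bound {P : ℕ → ℕ → Prop} (h : ∀ k, ∃ N, ∀ i, N ≤ i → P k i) (K : ℕ) :
    ∃ N, ∀ k, k < K → ∀ i, N ≤ i → P k i := by
  choose N hN using h
  exact ⟨(Finset.range K).sup N, fun k hk i hi =>
    hN k i ((Finset.le_sup (f := N) (Finset.mem_range.2 hk)).trans hi)⟩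

/-- The derivative of `a₍ₗ₊ᵢ₎v` is computed by `cov_pderiv`: it is `a₍ₗ₊ᵢ₎∂ₖv` plus terms with `∂ₛa`
and shifted indices. The first part gives the sums with `∂ₖ v`; in the second, Vandermonde's
identity absorbs the shifts into `m + r - s`. -/
theorem Rep.Cov.jacR {ρ : Rep} {O : Module.End ℂ Fock} {g : ℂ} {r : ℤ} (h : ρ.Cov O g r)
    {a v : Fock} {K : ℕ} (ha : ∀ k, K ≤ k → pderiv k a = 0) (hv : ∀ k, K ≤ k → pderiv k v = 0)
    (l m n : ℤ) (w : Fock) : O (ρ.jacR a v l m n w) = ρ.jacR a v l m n (O w) +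
      g • ∑ k ∈ Finset.range K, Ring.choose r k •
        (ρ.jacR (pderiv k a) v l (m + r - k) n w + ρ.jacR a (pderiv k v) l m (n + r - k) w) := by
  -- `T` truncates all sums over `i` at once; `K'` truncates the derivatives of all the `a₍ₗ₊ᵢ₎v`
  -- with `i < T` and leaves the margin `K + T` needed for the convolution.
  obtain ⟨T₁, hT₁⟩ := fockRep.exists_act_bound a v l
  obtain ⟨T₂, hT₂⟩ := exists_uniform_bound
    (fun k => fockRep.exists_act_bound (pderiv k a) v l) K
  obtain ⟨T₃, hT₃⟩ := exists_uniform_bound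
    (fun k => fockRep.exists_act_bound a (pderiv k v) l) K
  obtain ⟨T, h1, h2, h3⟩ : ∃ T, T₁ ≤ T ∧ T₂ ≤ T ∧ T₃ ≤ T := ⟨max T₁ (max T₂ T₃), by omega⟩
  obtain ⟨K₁, hK₁⟩ := exists_uniform_bound
    (fun i => exists_pderiv_eq_zero (fockRep.act (l + i) a v)) T
  obtain ⟨K', h4, h5⟩ : ∃ K', K₁ ≤ K' ∧ K + T ≤ K' := ⟨max K₁ (K + T), by omega⟩
  have f1 : ∀ m n w, ρ.jacR a v l m n w = ∑ i ∈ Finset.range T, ρ.jacTerm' a v l m n w i :=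
    fun m n w => finsum_eq_range fun i hi => by simp [jacTerm', hT₁ i (h1.trans hi)]
  have f2 : ∀ k < K, ∀ m, ρ.jacR (pderiv k a) v l m n w =
      ∑ i ∈ Finset.range T, ρ.jacTerm' (pderiv k a) v l m n w i :=
    fun k hk m => finsum_eq_range fun i hi => by simp [jacTerm', hT₂ k hk i (h2.trans hi)]
  have f3 : ∀ k < K, ∀ n, ρ.jacR a (pderiv k v) l m n w =
      ∑ i ∈ Finset.range T, ρ.jacTerm' a (pderiv k v) l m n w i :=
    fun k hk n => finsum_eq_range fun i hi => by simp [jacTerm', hT₃ k hk i (h3.trans hi)]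
  have e : ∀ i ∈ Finset.range T, O (ρ.jacTerm' a v l m n w i) = ρ.jacTerm' a v l m n (O w) i +
      (g • ∑ k ∈ Finset.range K', (Ring.choose r k * Ring.choose m i) •
        ρ.act (m + n - i + r - k) (fockRep.act (l + i) a (pderiv k v)) w +
      g • ∑ s ∈ Finset.range K, ∑ k ∈ Finset.range K',
        (Ring.choose m i * (Ring.choose r k * Ring.choose (k : ℤ) s)) •
        ρ.act (m + r - s + n - (i + (k - s) : ℕ)) (fockRep.act (l + (i + (k - s) : ℕ)) (pderiv s a) v) w) :=
    fun i hi => by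
    have hp : ∀ k, pderiv k (fockRep.act (l + i) a v) = fockRep.act (l + i) a (pderiv k v) +
        ∑ s ∈ Finset.range K, Ring.choose (k : ℤ) s •
          fockRep.act (l + i + k - s) (pderiv s a) v := fun k => by
      have := (cov_pderiv k).act ha (l + i) v
      rwa [one_smul] at this
    rw [jacTerm', jacTerm', map_zsmul, h.act (hK₁ i (Finset.mem_range.1 hi) · <| h4.trans ·),
      smul_add]
    congr 1
    simp only [hp, map_add, map_sum, LinearMap.add_apply, smul_add, Finset.sum_add_distrib,
      LinearMap.sum_apply, map_zsmul, LinearMap.smul_apply, Finset.smul_sum, smul_smul]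
    rw [Finset.sum_comm (s := Finset.range K)]
    congr 1
    · refine Finset.sum_congr rfl fun k _ => ?_
      rw [smul_comm, smul_smul, mul_comm (Ring.choose m i)]
    · refine Finset.sum_congr rfl fun k _ => Finset.sum_congr rfl fun s _ => ?_
      rw [smul_comm, smul_smul]
      rcases lt_or_ge k s with hks | hks
      · rw [choose_eq_zero_of_lt (n := (k : ℤ)) (k := s) (by omega) (by omega)]
        simp
      · obtain ⟨u, rfl⟩ := Nat.exists_eq_add_of_le hks
        rw [add_tsub_cancel_left]
        congr 2
        push_cast
        rw [show m + n - (i : ℤ) + r - (s + u) = m + r - s + n - (i + u) by ring,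
          show l + (i : ℤ) + (s + u) - s = l + (i + u) by ring]
  rw [f1, map_sum, Finset.sum_congr rfl e, Finset.sum_add_distrib, f1, Finset.sum_add_distrib,
    ← Finset.smul_sum, ← Finset.smul_sum]
  simp only [smul_add, Finset.sum_add_distrib]
  rw [add_right_inj, add_comm]
  congr 2
  · rw [Finset.sum_comm]
    refine Finset.sum_congr rfl fun s hs => ?_
    rw [sum_choose_convolution m r s (fun t => ρ.act (m + r - s + n - t)
      (fockRep.act (l + t) (pderiv s a) v) w) T K' (by have := Finset.mem_range.1 hs; omega)
      fun t ht => by simp [hT₂ s (Finset.mem_range.1 hs) t (h2.trans ht)],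
      f2 s (Finset.mem_range.1 hs)]
    rfl
  · rw [Finset.sum_comm]
    symm
    refine (Finset.sum_congr rfl fun k hk => ?_).trans
      (Finset.sum_subset (Finset.range_mono (show K ≤ K' by omega)) fun k _ hk => ?_)
    · rw [f3 k (Finset.mem_range.1 hk), Finset.smul_sum]
      refine Finset.sum_congr rfl fun i _ => ?_
      rw [jacTerm', smul_smul, show m + (n + r - k) - i = m + n - i + r - k by ring]
    · refine Finset.sum_eq_zero fun i _ => ?_
      rw [hv k (by simpa using hk)]
      simp

theorem Rep.Cov.jac {ρ : Rep} {O : Module.End ℂ Fock} {g : ℂ} {r : ℤ} (h : ρ.Cov O g r)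
    {a v : Fock} {K : ℕ} (ha : ∀ k, K ≤ k → pderiv k a = 0) (hv : ∀ k, K ≤ k → pderiv k v = 0)
    (l m n : ℤ) (w : Fock) : O (ρ.jac a v l m n w) = ρ.jac a v l m n (O w) +
      g • ∑ k ∈ Finset.range K, Ring.choose r k •
        (ρ.jac (pderiv k a) v l (m + r - k) n w + ρ.jac a (pderiv k v) l m (n + r - k) w) := by
  simp only [Rep.jac]
  rw [map_sub, h.jacL ha hv, h.jacR ha hv]
  simp only [smul_add, smul_sub, Finset.sum_add_distrib, Finset.sum_sub_distrib]
  abel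

/-! ### Vacuum expectation value of the Jacobi identity -/

theorem specialize_jac (a v : Fock) (l m n : ℤ) (w : Fock) :
    specialize (polyRep.jac a v l m n w) = fockRep.jac a v l m n (specialize w) := by
  rw [Rep.jac, map_sub, Rep.jacL, Rep.jacR, map_finsum specialize (polyRep.finite_jacTerm ..),
    map_finsum specialize (polyRep.finite_jacTerm' ..)]
  refine congrArg₂ _ (finsum_congr fun i => ?_) (finsum_congr fun i => ?_)
  · simp only [Rep.jacTerm, map_zsmul, map_sub, specialize_act]
  · simp only [Rep.jacTerm', map_zsmul, specialize_act]

/-- Upper negation of the second factor turns the sum into Vandermonde's identity for `l + (N - 1 -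
m - l)`; a second negation gives the result. -/
theorem sum_choose_alternating (l m : ℤ) (N : ℕ) :
    ∑ t ∈ Finset.range (N + 1), (-1 : ℤ) ^ t * Ring.choose l t * Ring.choose (m + l - t) (N - t) =
      Ring.choose m N := by
  have h := Ring.add_choose_eq N (Commute.all l (N - 1 - m - l))
  rw [Finset.Nat.sum_antidiagonal_eq_sum_range_succ_mk] at h
  rw [← choose_reflect m N, show (N : ℤ) - 1 - m = l + (N - 1 - m - l) by ring, h, Finset.mul_sum]
  refine Finset.sum_congr rfl fun t ht => ?_
  have htN : t ≤ N := by simpa [Nat.lt_succ_iff] using ht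
  obtain ⟨u, rfl⟩ := Nat.exists_eq_add_of_le htN
  rw [add_tsub_cancel_left, ← choose_reflect (m + l - t) u, pow_add]
  push_cast
  rw [show (u : ℤ) - 1 - (m + l - t) = t + u - 1 - m - l by ring]
  ring

/-- The binomial coefficient `p choose (-1-z)`, for `z < 0`. -/
def chooseNeg (p z : ℤ) : ℤ := if z < 0 then Ring.choose p (-1 - z).toNat else 0

/-- `chooseNeg m n` is the coefficient of `z⁻ᵐ⁻¹ w⁻ⁿ⁻¹` in the expansion of `(z - w)^(-m-n-2)` for
`|z| > |w|`. The identity multiplies the expansion of `(z - w)^(-ℓ-m-n-2)` by that of `(z - w)^ℓ`,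
so `ℓ` disappears. -/
theorem finsum_chooseNeg (l m n : ℤ) (c : ℂ) :
    ∑ᶠ t : ℕ, (((-1 : ℤ) ^ t * Ring.choose l t * chooseNeg (m + l - t) (n + t) : ℤ) : ℂ) * c =
      (chooseNeg m n : ℤ) * c := by
  rcases lt_or_ge n 0 with hn | hn
  · obtain ⟨N, rfl⟩ : ∃ N : ℕ, n = -1 - N := ⟨(-1 - n).toNat, by omega⟩
    rw [finsum_eq_sum_of_support_subset (s := Finset.range (N + 1)) _ fun t ht => ?_,
      ← Finset.sum_mul, ← Int.cast_sum, chooseNeg, if_pos hn,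
      show (-1 - (-1 - (N : ℤ))).toNat = N by omega, ← sum_choose_alternating l m N]
    · congr 2
      refine Finset.sum_congr rfl fun t ht => ?_
      rw [Finset.mem_range] at ht
      rw [chooseNeg, if_pos (by omega), show (-1 - (-1 - (N : ℤ) + t)).toNat = N - t by omega]
    · by_contra h'
      simp only [Finset.coe_range, Set.mem_Iio, not_lt] at h'
      exact ht (by simp only [chooseNeg]; rw [if_neg (by omega)]; simp)
  · rw [chooseNeg, if_neg (by omega), finsum_eq_zero_of_forall_eq_zero fun t => ?_]
    · simp
    · rw [chooseNeg, if_neg (by omega)]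
      simp

/-- The two terms on the left are the coefficients of `z⁻ᵐ⁻¹ w⁻ⁿ⁻¹` in the expansions of `(z -
w)^(-m-n-2)` for `|z| > |w|` and `|w| > |z|`. Their difference comes from a derivative of the formal
delta function, and is absent when the exponent is nonnegative. -/
theorem chooseNeg_sub (m n : ℤ) :
    chooseNeg m n - (m + n).negOnePow * chooseNeg n m =
      if 0 ≤ m + n + 1 then Ring.choose m (m + n + 1).toNat else 0 := by
  unfold chooseNeg
  rcases lt_or_ge n 0 with hn | hn <;> rcases lt_or_ge m 0 with hm | hm
  · rw [if_pos hn, if_pos hm, if_neg (by omega)]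
    obtain ⟨N, rfl⟩ : ∃ N : ℕ, n = -1 - N := ⟨(-1 - n).toNat, by omega⟩
    obtain ⟨M, rfl⟩ : ∃ M : ℕ, m = -1 - M := ⟨(-1 - m).toNat, by omega⟩
    rw [show (-1 - (-1 - (N : ℤ))).toNat = N by omega, show (-1 - (-1 - (M : ℤ))).toNat = M by omega,
      ← choose_reflect _ N, ← choose_reflect _ M,
      show (N : ℤ) - 1 - (-1 - M) = ((M + N : ℕ) : ℤ) by push_cast; ring,
      show (M : ℤ) - 1 - (-1 - N) = ((M + N : ℕ) : ℤ) by push_cast; ring,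
      show (-1 - (M : ℤ) + (-1 - N)) = -((M + N : ℕ) : ℤ) - 2 by push_cast; ring,
      Int.negOnePow_sub, Int.negOnePow_neg, show Int.negOnePow 2 = 1 from rfl,
      Ring.choose_natCast, Ring.choose_natCast, mul_one, negOnePow_natCast,
      ← Nat.choose_symm_add]
    have hM : ((-1 : ℤ) ^ M) * (-1) ^ M = 1 := by rw [← mul_pow]; simp
    rw [pow_add]
    linear_combination (-((-1 : ℤ) ^ N) * ((M + N).choose M : ℤ)) * hM
  · rw [if_pos hn, if_neg (by omega), mul_zero, sub_zero]
    obtain ⟨N, rfl⟩ : ∃ N : ℕ, n = -1 - N := ⟨(-1 - n).toNat, by omega⟩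
    lift m to ℕ using hm
    rw [show (-1 - (-1 - (N : ℤ))).toNat = N by omega]
    split_ifs with h
    · rw [show ((m : ℤ) + (-1 - N) + 1).toNat = m - N by omega, Ring.choose_natCast,
        Ring.choose_natCast, Nat.choose_symm (by omega)]
    · exact choose_eq_zero_of_lt (by omega) (by omega)
  · rw [if_neg (by omega), if_pos hm, zero_sub]
    obtain ⟨M, rfl⟩ : ∃ M : ℕ, m = -1 - M := ⟨(-1 - m).toNat, by omega⟩
    lift n to ℕ using hn
    rw [show (-1 - (-1 - (M : ℤ))).toNat = M by omega]
    split_ifs with h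
    · obtain ⟨q, rfl⟩ : ∃ q, n = M + q := ⟨n - M, by omega⟩
      rw [show (-1 - (M : ℤ) + ((M + q : ℕ) : ℤ) + 1).toNat = q by omega, ← choose_reflect _ q,
        show (q : ℤ) - 1 - (-1 - M) = ((M + q : ℕ) : ℤ) by push_cast; ring,
        show (-1 - (M : ℤ) + ((M + q : ℕ) : ℤ)) = q - 1 by push_cast; ring,
        Int.negOnePow_sub, show Int.negOnePow 1 = -1 from rfl, Ring.choose_natCast,
        Ring.choose_natCast, ← Nat.choose_symm_add]
      push_cast
      rw [negOnePow_natCast]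
      ring
    · rw [choose_eq_zero_of_lt (by omega) (by omega), mul_zero, neg_zero]
  · rw [if_neg (by omega), if_neg (by omega), if_pos (by omega), mul_zero, sub_zero,
      choose_eq_zero_of_lt hm (by omega)]

theorem constantCoeff_of_mem_grade {w : ℕ → ℤ} {z : ℤ} (hz : z ≠ 0) {a : Fock}
    (ha : a ∈ grade w z) : constantCoeff a = 0 := by
  rw [constantCoeff_eq]
  exact IsWeightedHomogeneous.coeff_eq_zero ha 0 (by rw [map_zero]; exact hz.symm)

theorem fockRep_graded : fockRep.Graded wt := by
  intro n z v hv
  match n with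
  | Int.ofNat 0 => simp [fockRep, oscillator]
  | Int.ofNat (k + 1) =>
    have := (grade wt _).smul_mem ((k : ℂ) + 1) (pderiv_mem_grade k hv)
    rw [wt] at this
    exact this
  | Int.negSucc k =>
    have := X_mul_mem_grade k hv
    rw [show z + wt k = z - Int.negSucc k by rw [Int.negSucc_eq, wt]; ring] at this
    exact this

theorem one_mem_grade (w : ℕ → ℤ) : (1 : Fock) ∈ grade w 0 := isWeightedHomogeneous_one ℂ w

theorem constantCoeff_act_act_one {i j : ℤ} {a v : Fock} (p q : ℤ) (h : p + q = i + j - 2) :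
    constantCoeff (fockRep.act p a (fockRep.act q v 1)) =
      (chooseNeg p q : ℤ) * constantCoeff (fockRep.act (i + j - 1) a v) := by
  rw [chooseNeg]
  split_ifs with hq
  · have := constantCoeff_act_act a v p (-1 - q).toNat
    rw [show (-1 - ((-1 - q).toNat : ℤ)) = q by omega] at this
    rw [this, show p - ((-1 - q).toNat : ℤ) = i + j - 1 by omega]
  · rw [act_one_vec v (by omega)]
    simp

/-- For weight reasons only `ℓ + m + n = i + j - 2` matters. Then every expectation of two modes is
a multiple of one number `P`, by `skew` for the products in the opposite order, and the identity
reduces to `chooseNeg_sub`. -/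
theorem constantCoeff_jac {i j : ℤ} {a v : Fock} (ha : a ∈ grade wt i) (hv : v ∈ grade wt j)
    (l m n : ℤ) : constantCoeff (fockRep.jac a v l m n 1) = 0 := by
  have hone := one_mem_grade wt
  by_cases hW : l + m + n = i + j - 2
  · set P := constantCoeff (fockRep.act (i + j - 1) a v) with hP
    have hL : constantCoeff (fockRep.jacL a v l m n 1) =
        (chooseNeg m n : ℤ) * P - (m + n).negOnePow * ((chooseNeg n m : ℤ) * P) := by
      have e : ∀ t : ℕ, constantCoeff (fockRep.jacTerm a v l m n 1 t) =
          (((-1 : ℤ) ^ t * Ring.choose l t * chooseNeg (m + l - t) (n + t) : ℤ) : ℂ) * P -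
          ((m + n).negOnePow : ℤ) * ((((-1 : ℤ) ^ t * Ring.choose l t *
            chooseNeg (n + l - t) (m + t) : ℤ) : ℂ) * P) := fun t => by
        have hs : ((l.negOnePow : ℤ) : ℂ) * ((i + j).negOnePow : ℤ) = ((m + n).negOnePow : ℤ) := by
          rw [← Int.cast_mul, ← Units.val_mul, ← Int.negOnePow_add,
            show l + (i + j) = m + n + (l + l) + 2 by omega, Int.negOnePow_add,
            Int.negOnePow_add, Int.negOnePow_add l, show Int.negOnePow 2 = 1 from rfl,
            Int.units_mul_self, mul_one, mul_one]
        rw [Rep.jacTerm, map_zsmul, map_sub, map_zsmul,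
          constantCoeff_act_act_one (i := i) (j := j) _ _ (by omega),
          constantCoeff_act_act_one (i := j) (j := i) _ _ (by omega), add_comm j i, skew ha hv,
          ← hP, ← hs, zsmul_eq_mul, zsmul_eq_mul]
        push_cast
        ring
      have hf : ∀ m n, (Function.support fun t : ℕ => (((-1 : ℤ) ^ t * Ring.choose l t *
          chooseNeg (m + l - t) (n + t) : ℤ) : ℂ) * P).Finite := fun m n => by
        refine (Set.finite_lt_nat (-n).toNat).subset fun t ht => ?_
        by_contra h'
        simp only [Set.mem_ofPred_eq, not_lt] at h'
        exact ht (by simp only [chooseNeg]; rw [if_neg (by omega)]; simp)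
      rw [Rep.jacL, map_finsum constantCoeff (fockRep.finite_jacTerm ..), finsum_congr e,
        finsum_sub_distrib (hf m n) ?_, ← mul_finsum, finsum_chooseNeg,
        finsum_chooseNeg]
      refine (hf n m).subset fun t => mt fun ht => ?_
      simp only [ht, mul_zero]
    have hR : constantCoeff (fockRep.jacR a v l m n 1) =
        ((if 0 ≤ m + n + 1 then Ring.choose m (m + n + 1).toNat else 0 : ℤ) : ℂ) * P := by
      -- For smaller `t` the outer mode has nonnegative index and kills the vacuum; for larger `t`
      -- the state `a₍ₗ₊ₜ₎v` has negative weight.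
      have e : ∀ t : ℕ, (t : ℤ) ≠ m + n + 1 →
          constantCoeff (fockRep.jacTerm' a v l m n 1 t) = 0 := fun t ht => by
        rw [Rep.jacTerm', map_zsmul]
        rcases lt_or_gt_of_ne ht with h | h
        · rw [act_one_vec _ (by omega)]
          simp
        · rw [eq_zero_of_mem_grade wt_nonneg (by omega) (fockRep_graded.act (n := l + t) ha hv)]
          simp
      rw [Rep.jacR, map_finsum constantCoeff (fockRep.finite_jacTerm' ..)]
      split_ifs with h
      · rw [finsum_eq_single _ (m + n + 1).toNat fun t ht => e t (by omega), Rep.jacTerm',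
          map_zsmul, show m + n - ((m + n + 1).toNat : ℤ) = -1 by omega, act_neg_one_one_vec,
          show l + ((m + n + 1).toNat : ℤ) = i + j - 1 by omega, zsmul_eq_mul]
      · rw [finsum_eq_zero_of_forall_eq_zero fun t => e t (by omega)]
        simp
    rw [Rep.jac, map_sub, hL, hR, ← chooseNeg_sub]
    push_cast
    ring
  · have hz : j + 0 + i - l - m - n - 2 ≠ 0 := by omega
    have hL : fockRep.jacL a v l m n 1 ∈ grade wt (j + i - l - m - n - 2) :=
      finsum_mem_submodule _ fun t => by
        have h1 := fockRep_graded.act (n := m + l - t) ha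
          (fockRep_graded.act (n := n + t) hv hone)
        have h2 := fockRep_graded.act (n := n + l - t) hv
          (fockRep_graded.act (n := m + t) ha hone)
        rw [show 0 + j - (n + t) - 1 + i - (m + l - t) - 1 = j + i - l - m - n - 2 by ring] at h1
        rw [show 0 + i - (m + t) - 1 + j - (n + l - t) - 1 = j + i - l - m - n - 2 by ring] at h2
        exact zsmul_mem (sub_mem h1 (zsmul_mem h2 _)) _
    have hR : fockRep.jacR a v l m n 1 ∈ grade wt (j + i - l - m - n - 2) :=
      finsum_mem_submodule _ fun t => by
        have h1 := fockRep_graded.act (n := m + n - t)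
          (fockRep_graded.act (n := l + t) ha hv) hone
        rw [show 0 + (j + i - (l + t) - 1) - (m + n - t) - 1 = j + i - l - m - n - 2 by ring] at h1
        exact zsmul_mem h1 _
    exact constantCoeff_of_mem_grade (by omega) (sub_mem hL hR)

theorem constantCoeff_specialize (f : Fock) : constantCoeff (specialize f) = constantCoeff f := by
  induction f using MvPolynomial.induction_on with
  | C a => simp [specialize]
  | add p q hp hq => simp only [map_add, hp, hq]
  | mul_X p k hp =>
    match k with
    | 0 => simp [specialize_X_zero]
    | k + 1 => simp [specialize_X_succ]

/-! ### Vanishing of the Jacobi defect, and modes of derivatives -/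

/-- An operator-valued expression in the modes of the universal Fock module vanishes as soon as it
commutes with the creation and annihilation operators and has no vacuum expectation value. -/
theorem eq_zero_of_commute (O : Module.End ℂ Fock) (hX : ∀ k w, X k * O w = O (X k * w))
    (hd : ∀ k w, pderiv k (O w) = O (pderiv k w)) (h0 : constantCoeff (specialize (O 1)) = 0)
    (w : Fock) : O w = 0 := by
  obtain ⟨c, hc⟩ := exists_scalar O hX hd
  rw [constantCoeff_specialize, hc 1, constantCoeff_smul, map_one, smul_eq_mul, mul_one] at h0
  rw [hc, h0, zero_smul]

/-- Each derivative lowers the total conformal weight by at least one, so by induction the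
correction terms in `Rep.Cov.jac` vanish. The defect then commutes with all multiplications and
derivatives, including those in the central variable, and `eq_zero_of_commute` applies. -/
theorem jac_eq_zero_of_grade (N : ℕ) : ∀ (i j : ℤ) (a v : Fock), i + j < N → a ∈ grade wt i →
    v ∈ grade wt j → ∀ l m n w, polyRep.jac a v l m n w = 0 := by
  induction N with
  | zero =>
    intro i j a v hij ha hv l m n w
    rcases lt_or_ge i 0 with hi | hi
    · rw [eq_zero_of_mem_grade wt_nonneg hi ha, Rep.jac_zero_left]
    · rw [eq_zero_of_mem_grade wt_nonneg (by omega) hv, Rep.jac_zero_mid]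
  | succ N ih =>
    intro i j a v hij ha hv l m n w
    obtain ⟨K₁, h₁⟩ := exists_pderiv_eq_zero a
    obtain ⟨K₂, h₂⟩ := exists_pderiv_eq_zero v
    have hcov : ∀ {O g r}, polyRep.Cov O g r → ∀ w,
        O (polyRep.jac a v l m n w) = polyRep.jac a v l m n (O w) := fun hO w => by
      rw [hO.jac (K := max K₁ K₂) (fun k hk => h₁ k (le_trans (le_max_left _ _) hk))
        (fun k hk => h₂ k (le_trans (le_max_right _ _) hk)), add_eq_left,
        Finset.sum_eq_zero fun k _ => ?_, smul_zero]
      have hk : 0 < wt k := by unfold wt; omega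
      rw [ih (i - wt k) j _ _ (by push_cast at hij; omega) (pderiv_mem_grade k ha) hv,
        ih i (j - wt k) _ _ (by push_cast at hij; omega) ha (pderiv_mem_grade k hv), add_zero,
        smul_zero]
    refine eq_zero_of_commute ⟨⟨polyRep.jac a v l m n, polyRep.jac_add_right a v l m n⟩,
      polyRep.jac_smul_right a v l m n⟩ (fun k w => hcov (polyCov_X k) w)
      (fun k w => hcov (polyCov_pderiv k) w) ?_ w
    change constantCoeff (specialize (polyRep.jac a v l m n 1)) = 0
    rw [specialize_jac, map_one]
    exact constantCoeff_jac ha hv l m n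

/-- The Jacobi identity for the modes on the universal Fock module. -/
theorem jac_eq_zero (a v : Fock) (l m n : ℤ) (w : Fock) : polyRep.jac a v l m n w = 0 := by
  induction a using MvPolynomial.induction_on' with
  | add p q hp hq => rw [Rep.jac_add_left, hp, hq, add_zero]
  | monomial s c =>
    induction v using MvPolynomial.induction_on' with
    | add p q hp hq => rw [Rep.jac_add_mid, hp, hq, add_zero]
    | monomial t d =>
      exact jac_eq_zero_of_grade (Finsupp.weight wt s + Finsupp.weight wt t + 1).toNat _ _ _ _
        (by omega) (monomial_mem_grade rfl) (monomial_mem_grade rfl) l m n w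

theorem translation_mem_grade {z : ℤ} {a : Fock} (h : a ∈ grade wt z) :
    translation a ∈ grade wt (z + 1) := by
  refine grade_induction (P := fun a => translation a ∈ grade wt (z + 1)) (fun s c hs => ?_)
    (by simp) (fun p q hp hq => by rw [map_add]; exact add_mem hp hq) h
  rw [monomial_eq_smul, map_smul]
  refine Submodule.smul_mem _ _ ?_
  clear h
  induction s using exponent_induction generalizing z with
  | zero => rw [monomial_zero', C_1, translation_one]; exact zero_mem _
  | cons k s _ ih =>
    rw [map_add, Finsupp.weight_single, one_smul, wt] at hs
    rw [show (monomial (Finsupp.single k 1 + s) 1 : Fock) = X k * monomial s 1 by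
      rw [X, monomial_mul, mul_one], translation_mul, translation_X, mul_smul_comm]
    refine add_mem ?_ ?_
    · have := X_mul_mem_grade k (ih (z := z - k - 1) (by omega))
      rwa [show z - k - 1 + 1 + wt k = z + 1 by rw [wt]; ring] at this
    · refine Submodule.smul_mem _ _ ?_
      have := X_mul_mem_grade (k + 1) (monomial_mem_grade (w := wt) (c := 1)
        (show Finsupp.weight wt s = z - k - 1 by omega))
      rwa [show z - k - 1 + wt (k + 1) = z + 1 by rw [wt]; push_cast; ring, mul_comm] at this

/-- The same induction as for the Jacobi identity, with `pderiv_translation` in place of the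
commutator formula for states. -/
theorem act_translation_of_grade (N : ℕ) : ∀ (i : ℤ) (a : Fock), i < N → a ∈ grade wt i →
    ∀ n w, polyRep.act n (translation a) w + n • polyRep.act (n - 1) a w = 0 := by
  induction N with
  | zero =>
    intro i a hi ha n w
    rw [eq_zero_of_mem_grade wt_nonneg hi ha]
    simp
  | succ N ih =>
    intro i a hi ha n w
    obtain ⟨K₁, h₁⟩ := exists_pderiv_eq_zero a
    obtain ⟨K₂, h₂⟩ := exists_pderiv_eq_zero (translation a)
    obtain ⟨K, hK1, hK2⟩ : ∃ K, K₁ ≤ K ∧ K₂ ≤ K := ⟨_, le_max_left _ _, le_max_right _ _⟩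
    set O : Module.End ℂ Fock := polyRep.act n (translation a) + n • polyRep.act (n - 1) a
    have hcov : ∀ {O' g r}, polyRep.Cov O' g r → ∀ w, O' (O w) = O (O' w) := fun {O' g r} hO w => by
      simp only [O, LinearMap.add_apply, LinearMap.smul_apply, map_add, map_zsmul]
      rw [hO.act (K := K + 1) (fun k hk => h₂ k (by omega)),
        hO.act (K := K) (fun k hk => h₁ k (by omega))]
      -- The range is longer by one because `∂ₖT` also involves `∂ₖ₋₁`. After the induction
      -- hypothesis and a shift of that part, the coefficients cancel by `(k + 1)(r choose k + 1) =
      -- (r - k)(r choose k)`.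
      have key : ∑ k ∈ Finset.range (K + 1), Ring.choose r k •
            polyRep.act (n + r - k) (pderiv k (translation a)) w +
          n • ∑ k ∈ Finset.range K, Ring.choose r k •
            polyRep.act (n - 1 + r - k) (pderiv k a) w = 0 := by
        have e1 : ∀ k : ℕ, polyRep.act (n + r - k) (pderiv k (translation a)) w =
            -((n + r - k) • polyRep.act (n + r - k - 1) (pderiv k a) w) +
            (k : ℤ) • polyRep.act (n + r - k) (pderiv (k - 1) a) w := fun k => by
          have hk : 0 < wt k := by unfold wt; omega
          have := ih (i - wt k) _ (by push_cast at hi; omega) (pderiv_mem_grade k ha) (n + r - k) w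
          rw [pderiv_translation, map_add, LinearMap.add_apply, map_smul, LinearMap.smul_apply,
            eq_neg_of_add_eq_zero_left this, ← Int.cast_smul_eq_zsmul ℂ (k : ℤ)]
          simp
        simp only [e1, smul_add, Finset.sum_add_distrib]
        rw [Finset.sum_range_succ, h₁ K hK1, Finset.sum_range_succ' _ K]
        simp only [map_zero, LinearMap.zero_apply, smul_zero, neg_zero, add_zero, Nat.cast_zero,
          zero_smul, Nat.add_sub_cancel]
        rw [Finset.smul_sum, ← Finset.sum_add_distrib, ← Finset.sum_add_distrib]
        refine Finset.sum_eq_zero fun k _ => ?_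
        rw [show n + r - k - 1 = n - 1 + r - k by ring,
          show n + r - ((k + 1 : ℕ) : ℤ) = n - 1 + r - k by push_cast; ring, smul_smul, smul_neg,
          smul_smul, smul_smul, ← neg_smul, ← add_smul, ← add_smul]
        have := succ_mul_choose r k
        rw [show -(Ring.choose r k * (n + r - k)) + Ring.choose r (k + 1) * ((k + 1 : ℕ) : ℤ) +
          n * Ring.choose r k = 0 by push_cast; linear_combination this, zero_smul]
      have key2 := congrArg (g • ·) key
      simp only [smul_add, smul_zero, smul_comm g n] at key2
      rw [smul_add]
      linear_combination key2
    have h0 : constantCoeff (specialize (O 1)) = 0 := by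
      simp only [O, LinearMap.add_apply, LinearMap.smul_apply, map_add, map_zsmul, specialize_act,
        map_one]
      -- A constant term has weight zero, which forces `n = i`. In that case a nonnegative index
      -- kills the vacuum, and a negative weight forces `a = 0`.
      rcases lt_trichotomy n i with hn | hn | hn
      · have h1 := fockRep_graded.act (n := n) (translation_mem_grade ha) (one_mem_grade wt)
        have h2 := fockRep_graded.act (n := n - 1) ha (one_mem_grade wt)
        rw [constantCoeff_of_mem_grade (by omega) h1, constantCoeff_of_mem_grade (by omega) h2]
        simp
      · rcases lt_trichotomy n 0 with h | h | h
        · rw [eq_zero_of_mem_grade wt_nonneg (by omega) ha]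
          simp
        · rw [h, act_one_vec _ le_rfl]
          simp
        · rw [act_one_vec _ (by omega), act_one_vec _ (by omega)]
          simp
      · have h1 := fockRep_graded.act (n := n) (translation_mem_grade ha) (one_mem_grade wt)
        have h2 := fockRep_graded.act (n := n - 1) ha (one_mem_grade wt)
        rw [constantCoeff_of_mem_grade (by omega) h1, constantCoeff_of_mem_grade (by omega) h2]
        simp
    exact eq_zero_of_commute O (fun k w => hcov (polyCov_X k) w)
      (fun k w => hcov (polyCov_pderiv k) w) h0 w

/-- Modes of derivatives on the universal Fock module. -/
theorem act_translation (a : Fock) (n : ℤ) :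
    polyRep.act n (translation a) + (n : ℂ) • polyRep.act (n - 1) a = 0 := by
  refine LinearMap.ext fun w => ?_
  rw [LinearMap.add_apply, LinearMap.smul_apply, Int.cast_smul_eq_zsmul, LinearMap.zero_apply]
  induction a using MvPolynomial.induction_on' with
  | add p q hp hq =>
    simp only [map_add, LinearMap.add_apply, smul_add]
    linear_combination hp + hq
  | monomial s c =>
    exact act_translation_of_grade (Finsupp.weight wt s + 1).toNat _ _ (by omega)
      (monomial_mem_grade rfl) n w

/-! ### The action of the enveloping algebra on the universal Fock module -/

theorem nabla_single (n : ℤ) (a : Fock) : nabla (Finsupp.single n a) =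
    Finsupp.single n (translation a) + (n : ℂ) • Finsupp.single (n - 1) a := by
  simp [nabla]

/-- The action of `𝔏(π)ᶠ` on the universal Fock module. -/
def ancillaryAct : Ancillary →ₗ[ℂ] Module.End ℂ Fock :=
  (LinearMap.range nabla).liftQ (Finsupp.lsum ℂ polyRep.act) (by
    rintro _ ⟨f, rfl⟩
    rw [LinearMap.mem_ker]
    induction f using Finsupp.induction_linear with
    | zero => rw [map_zero, map_zero]
    | add f g hf hg => rw [map_add, map_add, hf, hg, add_zero]
    | single n a =>
      rw [nabla_single, map_add, map_smul, Finsupp.lsum_single, Finsupp.lsum_single,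
        act_translation])

theorem ancillaryAct_bracketMode (a : Fock) (n : ℤ) :
    ancillaryAct (bracketMode a n) = polyRep.act n a := by
  rw [ancillaryAct, bracketMode, Submodule.mkQ_apply, Submodule.liftQ_apply, Finsupp.lsum_single]

theorem bracketMode_zero (n : ℤ) : bracketMode 0 n = 0 := by simp [bracketMode]

theorem bracketMode_add (a b : Fock) (n : ℤ) :
    bracketMode (a + b) n = bracketMode a n + bracketMode b n := by simp [bracketMode]

theorem bracketMode_smul (c : ℂ) (a : Fock) (n : ℤ) :
    bracketMode (c • a) n = c • bracketMode a n := by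
  rw [bracketMode, ← Finsupp.smul_single, map_smul, bracketMode]

theorem finsum_bracketMode_eq (a b : Fock) (l m n : ℤ) {T : ℕ}
    (hT : ∀ i : ℕ, T ≤ i → fockRep.act (l + i) a b = 0) :
    ∑ᶠ i : ℕ, Ring.choose m i • bracketMode (nthProduct (l + i) a b) (m + n - i) =
      ∑ i ∈ Finset.range T, Ring.choose m i • bracketMode (nthProduct (l + i) a b) (m + n - i) :=
  finsum_eq_sum_of_support_subset _ fun i hi => by
    by_contra h'
    exact hi (by simp only [nthProduct_eq, hT i (by simpa using h'), bracketMode_zero, smul_zero])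

theorem ancillaryAct_finsum (a b : Fock) (l m n : ℤ) (w : Fock) :
    ancillaryAct (∑ᶠ i : ℕ, Ring.choose m i • bracketMode (nthProduct (l + i) a b) (m + n - i)) w =
      polyRep.jacR a b l m n w := by
  obtain ⟨T, hT⟩ := fockRep.exists_act_bound a b l
  rw [finsum_bracketMode_eq a b l m n hT, map_sum, LinearMap.sum_apply, Rep.jacR,
    finsum_eq_range (N := T) fun i hi => by simp [Rep.jacTerm', hT i hi]]
  refine Finset.sum_congr rfl fun i _ => ?_
  rw [map_zsmul, ancillaryAct_bracketMode]
  rfl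

theorem jacL_zero (ρ : Rep) (a b : Fock) (m n : ℤ) (w : Fock) :
    ρ.jacL a b 0 m n w = ρ.act m a (ρ.act n b w) - ρ.act n b (ρ.act m a w) := by
  rw [Rep.jacL, finsum_eq_single _ 0 fun i hi => ?_]
  · simp [Rep.jacTerm]
  · obtain ⟨k, rfl⟩ := Nat.exists_eq_succ_of_ne_zero hi
    rw [Rep.jacTerm, Ring.choose_zero_succ, mul_zero, zero_smul]

/-- The action of the enveloping algebra on the universal Fock module. -/
def envAct : Enveloping →ₐ[ℂ] Module.End ℂ Fock :=
  RingQuot.liftAlgHom ℂ ⟨TensorAlgebra.lift ℂ ancillaryAct, by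
    rintro _ _ ⟨a, b, m, n⟩
    simp only [map_mul, map_add, TensorAlgebra.lift_ι_apply, ancillaryAct_bracketMode]
    refine LinearMap.ext fun w => ?_
    -- The Lie bracket of modes is the Jacobi identity at `ℓ = 0`.
    have h := jac_eq_zero a b 0 m n w
    rw [Rep.jac, jacL_zero, ← ancillaryAct_finsum] at h
    simp only [zero_add] at h
    rw [LinearMap.add_apply, Module.End.mul_apply, Module.End.mul_apply, lieBracket]
    linear_combination h⟩

theorem envAct_envι (x : Ancillary) : envAct (envι x) = ancillaryAct x := by
  have h : envAct (envProj (TensorAlgebra.ι ℂ x)) = TensorAlgebra.lift ℂ ancillaryAct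
      (TensorAlgebra.ι ℂ x) := RingQuot.liftAlgHom_mkAlgHom_apply ..
  rw [TensorAlgebra.lift_ι_apply] at h
  exact h

theorem envAct_mode (a : Fock) (n : ℤ) : envAct (mode a n) = polyRep.act n a := by
  rw [mode, envAct_envι, ancillaryAct_bracketMode]

/-- Induction on elements of the enveloping algebra. -/
theorem enveloping_induction {P : Enveloping → Prop} (algebraMap : ∀ c : ℂ, P (algebraMap ℂ _ c))
    (mode : ∀ a n, P (mode a n)) (add : ∀ x y, P x → P y → P (x + y))
    (mul : ∀ x y, P x → P y → P (x * y)) (x : Enveloping) : P x := by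
  obtain ⟨y, rfl⟩ : ∃ y, envProj y = x := RingQuot.mkAlgHom_surjective ℂ EnvelopingRel x
  induction y using TensorAlgebra.induction with
  | algebraMap r => rw [AlgHom.commutes]; exact algebraMap r
  | ι z =>
    obtain ⟨f, rfl⟩ := Submodule.mkQ_surjective _ z
    induction f using Finsupp.induction_linear with
    | zero => simpa using algebraMap 0
    | add f g hf hg => simpa only [map_add] using add _ _ hf hg
    | single n a => exact mode a n
  | mul p q hp hq => rw [map_mul]; exact mul _ _ hp hq
  | add p q hp hq => rw [map_add]; exact add _ _ hp hq

/-- The grading of the universal Fock module. -/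
def modWt (k : ℕ) : ℤ := k

theorem modWt_nonneg (k : ℕ) : 0 ≤ modWt k := Int.natCast_nonneg k

theorem polyRep_graded : polyRep.Graded modWt := by
  intro n z v hv
  match n with
  | Int.ofNat 0 => exact X_mul_mem_grade 0 hv
  | Int.ofNat (k + 1) =>
    have := (grade modWt _).smul_mem ((k : ℂ) + 1) (pderiv_mem_grade (k + 1) hv)
    rw [modWt] at this
    exact this
  | Int.negSucc k =>
    have := X_mul_mem_grade (k + 1) hv
    rw [show z + modWt (k + 1) = z - Int.negSucc k by
      rw [Int.negSucc_eq, modWt]; push_cast; ring] at this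
    exact this

theorem envAct_mem_grade {d z : ℤ} {u : Enveloping} {v : Fock} (hu : u ∈ gradedPiece d)
    (hv : v ∈ grade modWt z) : envAct u v ∈ grade modWt (z + d) := by
  induction hu using Submodule.span_induction with
  | mem u hu =>
    induction hu with
    | one => simpa using hv
    | @mul w a ha n e u hu ih =>
      have := polyRep_graded.act (n := n) (mem_weightSpace.1 ha) ih
      rw [map_mul, envAct_envι, ancillaryAct_bracketMode, Module.End.mul_apply]
      rwa [show z + e + w - n - 1 = z + (w - n - 1 + e) by ring] at this
  | zero => simp
  | add x y _ _ hx hy => rw [map_add, LinearMap.add_apply]; exact add_mem hx hy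
  | smul c x _ hx => rw [map_smul, LinearMap.smul_apply]; exact Submodule.smul_mem _ _ hx

/-- The module has no negative degrees, so an operator of degree at most `-N` kills degrees below
`N`; a further factor on the left changes nothing. -/
theorem envAct_leftNhd {N z : ℤ} (hz : z < N) {u : Enveloping} {v : Fock} (hu : u ∈ leftNhd N)
    (hv : v ∈ grade modWt z) : envAct u v = 0 := by
  induction hu using Submodule.span_induction with
  | mem u hu =>
    obtain ⟨j, hj, hu⟩ := hu
    exact eq_zero_of_mem_grade modWt_nonneg (by omega) (envAct_mem_grade hu hv)
  | zero => simp
  | add x y _ _ hx hy => rw [map_add, LinearMap.add_apply, hx, hy, add_zero]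
  | smul c x _ hx => rw [smul_eq_mul, map_mul, Module.End.mul_apply, hx, map_zero]

theorem exists_leftNhd_kills (v : Fock) : ∃ N₀ : ℤ, ∀ N, N₀ ≤ N → ∀ u ∈ leftNhd N,
    envAct u v = 0 := by
  induction v using MvPolynomial.induction_on' with
  | add p q hp hq =>
    obtain ⟨N₁, h₁⟩ := hp
    obtain ⟨N₂, h₂⟩ := hq
    refine ⟨max N₁ N₂, fun N hN u hu => ?_⟩
    rw [map_add, h₁ N (le_trans (le_max_left _ _) hN) u hu,
      h₂ N (le_trans (le_max_right _ _) hN) u hu, add_zero]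
  | monomial s c =>
    exact ⟨Finsupp.weight modWt s + 1, fun N hN u hu =>
      envAct_leftNhd (by omega) hu (monomial_mem_grade rfl)⟩

/-! ### Extension to the completion -/

theorem leftNhd_mem_nhds (N : ℤ) : (leftNhd N : Set Enveloping) ∈ nhds (0 : Enveloping) :=
  leftNhd_basis.hasBasis_nhds_zero.mem_of_mem trivial

theorem isClosed_leftNhd (N : ℤ) : IsClosed (leftNhd N : Set Enveloping) :=
  (leftNhd_basis.openAddSubgroup N).isClosed

theorem completedNhd_mem_nhds (N : ℤ) : completedNhd N ∈ nhds (0 : Completed) := by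
  have := UniformSpace.Completion.isDenseInducing_coe.closure_image_mem_nhds (leftNhd_mem_nhds N)
  exact this

/-- The left ideals are open subgroups, hence closed, and the topology of `U` is induced from the
completion. -/
theorem mem_leftNhd_of_toCompleted {N : ℤ} {u : Enveloping}
    (h : toCompleted u ∈ completedNhd N) : u ∈ leftNhd N := by
  have h2 := (UniformSpace.Completion.isUniformInducing_coe
    Enveloping).isInducing.closure_eq_preimage_closure_image (leftNhd N : Set Enveloping)
  rw [(isClosed_leftNhd N).closure_eq] at h2
  change u ∈ (leftNhd N : Set Enveloping)
  rw [h2]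
  exact h

theorem toCompleted_mem_completedNhd {N : ℤ} {u : Enveloping} (h : u ∈ leftNhd N) :
    toCompleted u ∈ completedNhd N := subset_closure ⟨u, h, rfl⟩

theorem completedNhd_anti {m n : ℤ} (h : m ≤ n) : completedNhd n ⊆ completedNhd m :=
  closure_mono (Set.image_mono (leftNhd_anti h))

theorem neg_mem_completedNhd {N : ℤ} {x : Completed} (h : x ∈ completedNhd N) :
    -x ∈ completedNhd N := by
  simpa using mul_mem_completedNhd (-1) h

theorem sub_mem_completedNhd {N : ℤ} {x y : Completed} (hx : x ∈ completedNhd N)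
    (hy : y ∈ completedNhd N) : x - y ∈ completedNhd N := by
  rw [sub_eq_add_neg]
  exact add_mem_completedNhd hx (neg_mem_completedNhd hy)

theorem exists_sub_mem_completedNhd {S : Set Completed} {c : Completed} (hc : c ∈ closure S)
    (N : ℤ) : ∃ s ∈ S, c - s ∈ completedNhd N := by
  have h : {x : Completed | c - x ∈ completedNhd N} ∈ nhds c := by
    have h1 : Filter.Tendsto (fun x : Completed => c - x) (nhds c) (nhds 0) := by
      have : Continuous fun x : Completed => c - x := by fun_prop
      simpa using this.tendsto c
    exact h1 (completedNhd_mem_nhds N)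
  obtain ⟨x, hx, hxS⟩ := mem_closure_iff_nhds.1 hc _ h
  exact ⟨x, hxS, hx⟩

theorem exists_approx (c : Completed) (N : ℤ) : ∃ u, c - toCompleted u ∈ completedNhd N := by
  obtain ⟨_, ⟨u, rfl⟩, hu⟩ := exists_sub_mem_completedNhd
    (UniformSpace.Completion.denseRange_coe c) N
  exact ⟨u, hu⟩

theorem completedNhd_mul_toCompleted (x : Enveloping) (N : ℤ) :
    ∃ M : ℤ, ∀ y ∈ completedNhd M, y * toCompleted x ∈ completedNhd N := by
  obtain ⟨M, hM⟩ := exists_mul_mem_leftNhd x N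
  refine ⟨M, fun y hy => map_mem_closure (f := fun z => z * toCompleted x)
    (continuous_mul_const _) hy ?_⟩
  rintro _ ⟨u, hu, rfl⟩
  exact ⟨u * x, hM u hu, map_mul _ _ _⟩

/-- The action of an element of the completion on a vector. -/
def completedActFun (c : Completed) (v : Fock) : Fock :=
  envAct (exists_approx c (exists_leftNhd_kills v).choose).choose v

/-- Independence of the choice: two approximations differ by an element of a left ideal that kills
`v`. -/
theorem completedActFun_eq {c : Completed} {u : Enveloping} {v : Fock} {N : ℤ}
    (hN : ∀ u ∈ leftNhd N, envAct u v = 0) (h : c - toCompleted u ∈ completedNhd N) :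
    completedActFun c v = envAct u v := by
  set N₀ := (exists_leftNhd_kills v).choose
  have h₀ := (exists_leftNhd_kills v).choose_spec
  have h₁ : c - toCompleted (exists_approx c N₀).choose ∈ completedNhd N₀ :=
    (exists_approx c N₀).choose_spec
  rw [completedActFun, ← sub_eq_zero, ← LinearMap.sub_apply, ← map_sub]
  have h₂ : toCompleted ((exists_approx c N₀).choose - u) ∈ completedNhd (min N N₀) := by
    have := sub_mem_completedNhd (completedNhd_anti (min_le_left N N₀) h)
      (completedNhd_anti (min_le_right N N₀) h₁)
    rwa [sub_sub_sub_cancel_left, ← map_sub] at this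
  have h₃ := mem_leftNhd_of_toCompleted h₂
  rcases min_choice N N₀ with h | h
  · exact hN _ (h ▸ h₃)
  · exact h₀ N₀ le_rfl _ (h ▸ h₃)

theorem completedActFun_add_right (c : Completed) (v w : Fock) :
    completedActFun c (v + w) = completedActFun c v + completedActFun c w := by
  obtain ⟨N₁, h₁⟩ := exists_leftNhd_kills v
  obtain ⟨N₂, h₂⟩ := exists_leftNhd_kills w
  obtain ⟨u, hu⟩ := exists_approx c (max N₁ N₂)
  have h₁' := h₁ _ (le_max_left N₁ N₂)
  have h₂' := h₂ _ (le_max_right N₁ N₂)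
  rw [completedActFun_eq h₁' hu, completedActFun_eq h₂' hu, completedActFun_eq
    (fun u hu => by rw [map_add, h₁' u hu, h₂' u hu, add_zero]) hu, map_add]

theorem completedActFun_smul_right (c : Completed) (a : ℂ) (v : Fock) :
    completedActFun c (a • v) = a • completedActFun c v := by
  obtain ⟨N, h⟩ := exists_leftNhd_kills v
  obtain ⟨u, hu⟩ := exists_approx c N
  rw [completedActFun_eq (h N le_rfl) hu, completedActFun_eq
    (fun u hu => by rw [map_smul, h N le_rfl u hu, smul_zero]) hu, map_smul]

theorem completedActFun_add (c c' : Completed) (v : Fock) :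
    completedActFun (c + c') v = completedActFun c v + completedActFun c' v := by
  obtain ⟨N, h⟩ := exists_leftNhd_kills v
  obtain ⟨u, hu⟩ := exists_approx c N
  obtain ⟨u', hu'⟩ := exists_approx c' N
  have h2 : c + c' - toCompleted (u + u') ∈ completedNhd N := by
    rw [map_add, add_sub_add_comm]
    exact add_mem_completedNhd hu hu'
  rw [completedActFun_eq (h N le_rfl) hu, completedActFun_eq (h N le_rfl) hu',
    completedActFun_eq (h N le_rfl) h2, map_add, LinearMap.add_apply]

theorem completedActFun_smul (a : ℂ) (c : Completed) (v : Fock) :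
    completedActFun (a • c) v = a • completedActFun c v := by
  obtain ⟨N, h⟩ := exists_leftNhd_kills v
  obtain ⟨u, hu⟩ := exists_approx c N
  have h2 : a • c - toCompleted (a • u) ∈ completedNhd N := by
    have := mul_mem_completedNhd (algebraMap ℂ Completed a) hu
    rwa [map_smul, ← smul_sub, Algebra.smul_def]
  rw [completedActFun_eq (h N le_rfl) hu, completedActFun_eq (h N le_rfl) h2, map_smul,
    LinearMap.smul_apply]

theorem zero_mem_completedNhd (N : ℤ) : (0 : Completed) ∈ completedNhd N :=
  mem_of_mem_nhds (completedNhd_mem_nhds N)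

theorem completedActFun_one (v : Fock) : completedActFun 1 v = v := by
  obtain ⟨N, h⟩ := exists_leftNhd_kills v
  rw [completedActFun_eq (u := 1) (h N le_rfl), map_one, Module.End.one_apply]
  rw [map_one, sub_self]
  exact zero_mem_completedNhd N

theorem completedActFun_mul (c c' : Completed) (v : Fock) :
    completedActFun (c * c') v = completedActFun c (completedActFun c' v) := by
  obtain ⟨N, h⟩ := exists_leftNhd_kills v
  obtain ⟨u', hu'⟩ := exists_approx c' N
  obtain ⟨N', h'⟩ := exists_leftNhd_kills (envAct u' v)
  -- The error is split as `c (c' - u') + (c - u) u'`. The bound `M` makes the second summand small,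
  -- and `N'` makes `u` represent `c` on the vector `u' v`.
  obtain ⟨M, hM⟩ := completedNhd_mul_toCompleted u' N
  obtain ⟨u, hu⟩ := exists_approx c (max M N')
  have h2 : c * c' - toCompleted (u * u') ∈ completedNhd N := by
    have := add_mem_completedNhd (mul_mem_completedNhd c hu')
      (hM _ (completedNhd_anti (le_max_left M N') hu))
    have e : c * c' - toCompleted (u * u') =
        c * (c' - toCompleted u') + (c - toCompleted u) * toCompleted u' := by
      rw [map_mul]
      noncomm_ring
    rwa [e]
  rw [completedActFun_eq (h N le_rfl) hu', completedActFun_eq (h N le_rfl) h2,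
    completedActFun_eq (h' _ (le_max_right M N')) hu, map_mul, Module.End.mul_apply]

/-- The action of an element of the completion on the universal Fock module. -/
def completedActLin (c : Completed) : Module.End ℂ Fock where
  toFun := completedActFun c
  map_add' := completedActFun_add_right c
  map_smul' := completedActFun_smul_right c

/-- The action of the completion on the universal Fock module. -/
def completedAct : Completed →ₐ[ℂ] Module.End ℂ Fock :=
  AlgHom.ofLinearMap
    { toFun := completedActLin
      map_add' := fun c c' => LinearMap.ext (completedActFun_add c c')
      map_smul' := fun a c => LinearMap.ext (completedActFun_smul a c) }
    (LinearMap.ext completedActFun_one)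
    (fun c c' => LinearMap.ext (completedActFun_mul c c'))

theorem completedAct_apply (c : Completed) (v : Fock) :
    completedAct c v = completedActFun c v := by
  rw [completedAct, AlgHom.ofLinearMap_apply]
  rfl

theorem completedAct_eq {c : Completed} {u : Enveloping} {v : Fock} {N : ℤ}
    (hN : ∀ u ∈ leftNhd N, envAct u v = 0) (h : c - toCompleted u ∈ completedNhd N) :
    completedAct c v = envAct u v := by
  rw [completedAct_apply, completedActFun_eq hN h]

theorem completedAct_toCompleted (u : Enveloping) : completedAct (toCompleted u) = envAct u := by
  refine LinearMap.ext fun v => ?_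
  obtain ⟨N, h⟩ := exists_leftNhd_kills v
  exact completedAct_eq (h N le_rfl) (by rw [sub_self]; exact zero_mem_completedNhd N)

theorem completedAct_completedNhd {N z : ℤ} (hz : z < N) {c : Completed} {v : Fock}
    (hc : c ∈ completedNhd N) (hv : v ∈ grade modWt z) : completedAct c v = 0 := by
  have h : ∀ u ∈ leftNhd N, envAct u v = 0 := fun u hu => envAct_leftNhd hz hu hv
  rw [completedAct_eq (u := 0) h (by rwa [map_zero, sub_zero]), map_zero, LinearMap.zero_apply]

/-- Multiplication by `X 0` is the action of the central `b₀`, so it commutes with all modes. This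
makes the action linear over `ℂ[x]`. -/
theorem completedAct_X_zero (c : Completed) (v : Fock) :
    completedAct c (X 0 * v) = X 0 * completedAct c v := by
  have hu : ∀ (u : Enveloping) (v : Fock), envAct u (X 0 * v) = X 0 * envAct u v := fun u => by
    induction u using enveloping_induction with
    | algebraMap c => intro v; rw [AlgHom.commutes]; simp
    | mode a n =>
      intro v
      obtain ⟨K, hK⟩ := exists_pderiv_eq_zero a
      have := (polyCov_X 0).act hK n v
      rw [Nat.cast_zero, neg_zero, zero_smul, add_zero] at this
      rw [envAct_mode]
      exact this.symm
    | add x y hx hy =>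
      intro v
      rw [map_add, LinearMap.add_apply, hx, hy, LinearMap.add_apply, mul_add]
    | mul x y hx hy =>
      intro v
      rw [map_mul envAct, Module.End.mul_apply, hy, hx, Module.End.mul_apply]
  obtain ⟨N, h⟩ := exists_leftNhd_kills v
  obtain ⟨u, hc⟩ := exists_approx c N
  rw [completedAct_eq (h N le_rfl) hc,
    completedAct_eq (fun u h' => by rw [hu, h N le_rfl u h', mul_zero]) hc, hu]

theorem completedAct_mem_grade {c : Completed} {z : ℤ} {v : Fock}
    (hc : c ∈ (degreeZero.map toCompleted).topologicalClosure) (hv : v ∈ grade modWt z) :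
    completedAct c v ∈ grade modWt z := by
  obtain ⟨_, ⟨u, hu, rfl⟩, h⟩ := exists_sub_mem_completedNhd hc (z + 1)
  have hN : ∀ u ∈ leftNhd (z + 1), envAct u v = 0 := fun u hu => envAct_leftNhd (by omega) hu hv
  rw [completedAct_eq hN h]
  simpa using envAct_mem_grade (show u ∈ gradedPiece 0 from hu) hv

theorem envAct_jacobiTerm (a b : Fock) (l m n : ℤ) (i : ℕ) (w : Fock) :
    envAct (jacobiTerm a b l m n i) w = polyRep.jacTerm a b l m n w i := by
  simp only [jacobiTerm, Rep.jacTerm, map_zsmul, map_sub, map_mul, envAct_mode,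
    LinearMap.smul_apply, LinearMap.sub_apply, Module.End.mul_apply]

theorem sub_sum_mem_of_hasSum {f : ℕ → Completed} {s : Completed} (h : HasSum f s) (N : ℤ) :
    ∃ T₀ : ℕ, ∀ T, T₀ ≤ T → s - ∑ i ∈ Finset.range T, f i ∈ completedNhd N := by
  have h1 : Filter.Tendsto (fun T => s - ∑ i ∈ Finset.range T, f i) Filter.atTop (nhds 0) := by
    simpa using h.tendsto_sum_nat.const_sub s
  exact Filter.eventually_atTop.1 (h1.eventually (completedNhd_mem_nhds N))

/-- On a fixed vector a sufficiently long partial sum of the convergent series acts as the whole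
series, so the relation becomes the Jacobi identity for modes. -/
theorem completedAct_relations {x : GradedCompletion} (hx : x ∈ relations) :
    completedAct (x : Completed) = 0 := by
  rcases hx with ⟨a, b, l, m, n, s, hs, hx⟩ | hx
  · refine LinearMap.ext fun v => ?_
    obtain ⟨N, h⟩ := exists_leftNhd_kills v
    obtain ⟨T₀, hT₀⟩ := sub_sum_mem_of_hasSum hs N
    obtain ⟨T₁, hT₁⟩ := polyRep.exists_jacTerm_bound a b l m n v
    have h1 := hT₀ (max T₀ T₁) (le_max_left _ _)
    rw [← map_sum] at h1
    have h2 := jac_eq_zero a b l m n v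
    rw [hx, map_sub, LinearMap.sub_apply, completedAct_eq (h N le_rfl) h1, completedAct_toCompleted,
      jacobiRight, envAct_envι, ancillaryAct_finsum, map_sum, LinearMap.sum_apply,
      LinearMap.zero_apply, ← h2, Rep.jac, Rep.jacL,
      finsum_eq_range (N := max T₀ T₁) fun i hi => hT₁ i (le_trans (le_max_right _ _) hi)]
    simp only [envAct_jacobiTerm]
  · rw [hx, map_sub, completedAct_toCompleted, envAct_mode, map_one, vacuum, Rep.act_one,
      if_pos rfl]
    exact sub_self _

/-- The action of the graded completion on the universal Fock module. -/
def gradedAct : GradedCompletion →ₐ[ℂ] Module.End ℂ Fock :=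
  completedAct.comp (Subalgebra.val _)

/-- On a fixed vector, an element of the closure acts like a sufficiently close element of the
ideal, which acts by zero. -/
theorem gradedAct_closedIdeal {x : GradedCompletion} (hx : x ∈ closedIdeal) :
    gradedAct x = 0 := by
  have h0 : ∀ y ∈ TwoSidedIdeal.span relations, gradedAct y = 0 := fun y hy => by
    have hle : TwoSidedIdeal.span relations ≤ TwoSidedIdeal.ker gradedAct :=
      TwoSidedIdeal.span_le.2 fun z hz => (TwoSidedIdeal.mem_ker _).2 (completedAct_relations hz)
    exact (TwoSidedIdeal.mem_ker _).1 (hle hy)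
  refine LinearMap.ext fun v => ?_
  obtain ⟨N, h⟩ := exists_leftNhd_kills v
  have hx' : (x : Completed) ∈ closure (Subtype.val ''
      (TwoSidedIdeal.asIdeal (TwoSidedIdeal.span relations) : Set GradedCompletion)) :=
    map_mem_closure continuous_subtype_val hx fun y hy => ⟨y, hy, rfl⟩
  obtain ⟨_, ⟨y, hy, rfl⟩, hxy⟩ := exists_sub_mem_completedNhd hx' N
  obtain ⟨u, hu⟩ := exists_approx (y : Completed) N
  have h2 := add_mem_completedNhd hxy hu
  rw [sub_add_sub_cancel] at h2
  change completedAct (x : Completed) v = 0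
  rw [completedAct_eq (h N le_rfl) h2, ← completedAct_eq (h N le_rfl) hu]
  exact LinearMap.congr_fun (h0 y hy) v

/-- The action of the universal enveloping algebra of the vertex algebra on the universal Fock
module. -/
def ueaAct : UEA →ₐ[ℂ] Module.End ℂ Fock :=
  Ideal.Quotient.liftₐ closedIdeal gradedAct fun _ => gradedAct_closedIdeal

theorem ueaAct_mk (y : GradedCompletion) :
    ueaAct (Ideal.Quotient.mk closedIdeal y) = completedAct (y : Completed) := rfl

/-! ### Normally ordered elements of the enveloping algebra of the vertex algebra -/

theorem Rep.act_X (ρ : Rep) (k : ℕ) (n : ℤ) (v : Fock) :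
    ρ.act n (X k) v = VertexOperator.ncoeff (ρ.field k) n v := by
  have h := ρ.act_X_mul (k := k) (s := 0) (by simp) n v
  rw [add_zero] at h
  have h1 : (monomial 0 1 : Fock) = 1 := rfl
  rw [X, h, h1]
  simp only [Rep.act_one]
  rcases lt_or_ge n 0 with hn | hn
  · rw [finsum_eq_single _ (-1 - n).toNat fun i hi => ?_,
      finsum_eq_zero_of_forall_eq_zero fun i => ?_, if_pos (by omega), add_zero, show -1 - ((-1 - n).toNat : ℤ) = n by omega]
    · rfl
    · rw [if_neg (by omega), LinearMap.zero_apply]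
    · rw [if_neg (by omega), LinearMap.zero_apply, map_zero]
  · rw [finsum_eq_zero_of_forall_eq_zero fun i => ?_, finsum_eq_single _ n.toNat fun i hi => ?_,
      if_pos (by omega), zero_add, show (n.toNat : ℤ) = n by omega]
    · rfl
    · rw [if_neg (by omega), LinearMap.zero_apply]
    · rw [if_neg (by omega), LinearMap.zero_apply, map_zero]

theorem Rep.act_X_zero (ρ : Rep) (n : ℤ) (v : Fock) : ρ.act n (X 0) v = ρ.osc n v := by
  rw [Rep.act_X, ncoeff_field]
  simp

theorem mode_mem_gradedPiece {z : ℤ} {a : Fock} (ha : a ∈ grade wt z) (n : ℤ) :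
    mode a n ∈ gradedPiece (z - n - 1) := by
  rcases lt_or_ge z 0 with hz | hz
  · rw [eq_zero_of_mem_grade wt_nonneg hz ha, mode, bracketMode_zero, map_zero]
    exact zero_mem _
  · lift z to ℕ using hz
    have := IsMonomial.mul (mem_weightSpace.2 ha) n IsMonomial.one
    rw [mul_one, add_zero] at this
    exact Submodule.subset_span this

theorem X_mem_grade (w : ℕ → ℤ) (k : ℕ) : (X k : Fock) ∈ grade w (w k) := by
  simpa using X_mul_mem_grade k (one_mem_grade w)

theorem toCompleted_mem_adjoin (u : Enveloping) :
    toCompleted u ∈ Algebra.adjoin ℂ (⋃ d : ℤ, completedPiece d) := by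
  induction u using enveloping_induction with
  | algebraMap c => rw [AlgHom.commutes]; exact Subalgebra.algebraMap_mem _ c
  | mode a n =>
    induction a using MvPolynomial.induction_on' with
    | monomial s c =>
      exact Algebra.subset_adjoin (Set.mem_iUnion.2
        ⟨_, subset_closure ⟨_, mode_mem_gradedPiece (monomial_mem_grade rfl) n, rfl⟩⟩)
    | add p q hp hq =>
      rw [mode, bracketMode_add, map_add, map_add]
      exact add_mem hp hq
  | add x y hx hy => rw [map_add]; exact add_mem hx hy
  | mul x y hx hy => rw [map_mul]; exact mul_mem hx hy

/-- The canonical map from `U` to the enveloping algebra of the vertex algebra. -/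
def toUEA : Enveloping →ₐ[ℂ] UEA :=
  (Ideal.Quotient.mkₐ ℂ closedIdeal).comp
    (toCompleted.codRestrict (Algebra.adjoin ℂ (⋃ d : ℤ, completedPiece d)) toCompleted_mem_adjoin)

theorem toUEA_apply (u : Enveloping) :
    toUEA u = Ideal.Quotient.mk closedIdeal ⟨toCompleted u, toCompleted_mem_adjoin u⟩ := rfl

theorem ueaAct_toUEA (u : Enveloping) : ueaAct (toUEA u) = envAct u := by
  rw [toUEA_apply, ueaAct_mk, completedAct_toCompleted]

/-- The neighbourhood `N^n 𝒰`, as a left ideal. -/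
def nhd (n : ℤ) : Ideal UEA where
  carrier := {x | ∃ y : GradedCompletion, (y : Completed) ∈ completedNhd n ∧
    Ideal.Quotient.mk closedIdeal y = x}
  zero_mem' := ⟨0, zero_mem_completedNhd n, map_zero _⟩
  add_mem' := by
    rintro a b ⟨y, hy, hya⟩ ⟨z, hz, hzb⟩
    exact ⟨y + z, add_mem_completedNhd hy hz, by simp [hya, hzb]⟩
  smul_mem' := by
    rintro a b ⟨y, hy, hyb⟩
    obtain ⟨z, hz⟩ := Ideal.Quotient.mk_surjective a
    exact ⟨z * y, mul_mem_completedNhd _ hy, by simp [hyb, hz]⟩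

theorem mem_nhdZero {n : ℤ} {x : UEAZero} : x ∈ nhdZero n ↔ (x : UEA) ∈ nhd n := Iff.rfl

theorem toUEA_mem_nhd {n : ℤ} {u : Enveloping} (h : u ∈ leftNhd n) : toUEA u ∈ nhd n :=
  ⟨_, toCompleted_mem_completedNhd h, rfl⟩

theorem gradedPiece_mem_leftNhd {n e : ℤ} {u : Enveloping} (h : u ∈ gradedPiece e) (he : e ≤ -n) :
    u ∈ leftNhd n := Ideal.subset_span ⟨e, he, h⟩

theorem nhd_mul_toUEA {n e : ℤ} {x : UEA} {u : Enveloping} (hx : x ∈ nhd n)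
    (hu : u ∈ gradedPiece e) : x * toUEA u ∈ nhd (n - e) := by
  obtain ⟨y, hy, rfl⟩ := hx
  refine ⟨y * ⟨toCompleted u, toCompleted_mem_adjoin u⟩,
    map_mem_closure (f := fun z => z * toCompleted u) (continuous_mul_const _) hy ?_, map_mul _ _ _⟩
  rintro _ ⟨v, hv, rfl⟩
  exact ⟨v * u, mul_mem_leftNhd hv hu, map_mul _ _ _⟩

theorem ueaAct_nhd {n z : ℤ} (hz : z < n) {x : UEA} {v : Fock} (hx : x ∈ nhd n)
    (hv : v ∈ grade modWt z) : ueaAct x v = 0 := by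
  obtain ⟨y, hy, rfl⟩ := hx
  rw [ueaAct_mk, completedAct_completedNhd hz hy hv]

theorem ueaAct_mem_grade {x : UEA} (hx : x ∈ UEAZero) {z : ℤ} {v : Fock}
    (hv : v ∈ grade modWt z) : ueaAct x v ∈ grade modWt z := by
  obtain ⟨y, hy, rfl⟩ := hx
  exact completedAct_mem_grade hy hv

theorem ueaAct_X_zero (x : UEA) (v : Fock) : ueaAct x (X 0 * v) = X 0 * ueaAct x v := by
  obtain ⟨y, rfl⟩ := Ideal.Quotient.mk_surjective x
  rw [ueaAct_mk, completedAct_X_zero]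

theorem toUEA_mem_UEAZero {u : Enveloping} (h : u ∈ gradedPiece 0) : toUEA u ∈ UEAZero :=
  ⟨_, subset_closure ⟨u, h, rfl⟩, rfl⟩

theorem exists_sub_mem_nhd {x : UEA} (hx : x ∈ UEAZero) (n : ℤ) :
    ∃ u ∈ gradedPiece 0, x - toUEA u ∈ nhd n := by
  obtain ⟨y, hy, rfl⟩ := hx
  obtain ⟨_, ⟨u, hu, rfl⟩, h⟩ := exists_sub_mem_completedNhd
    (S := toCompleted '' (gradedPiece 0 : Set Enveloping)) hy n
  let y' : GradedCompletion := y
  refine ⟨u, hu, y' - ⟨toCompleted u, toCompleted_mem_adjoin u⟩, ?_, map_sub _ _ _⟩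
  exact h

theorem toUEA_of_relation {u : Enveloping}
    (h : (⟨toCompleted u, toCompleted_mem_adjoin u⟩ : GradedCompletion) ∈ relations) :
    toUEA u = 0 :=
  Ideal.Quotient.eq_zero_iff_mem.2 (subset_closure (TwoSidedIdeal.subset_span h))

theorem toUEA_mode_one_neg_one : toUEA (mode 1 (-1)) = 1 := by
  have h : toUEA (mode 1 (-1) - 1) = 0 := toUEA_of_relation (Or.inr (map_sub toCompleted _ _))
  rwa [map_sub, map_one, sub_eq_zero] at h

/-- Since `T|0⟩ = 0`, the operator `∇` sends `|0⟩ ⊗ tⁿ⁺¹` to `(n + 1) |0⟩ ⊗ tⁿ`, and `n + 1 ≠ 0`. -/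
theorem mode_one {n : ℤ} (hn : n ≠ -1) : mode 1 n = 0 := by
  have h : bracketMode 1 n = 0 := by
    have h1 := nabla_single (n + 1) 1
    rw [translation_one, Finsupp.single_zero, zero_add, add_sub_cancel_right] at h1
    have h2 : ((n + 1 : ℤ) : ℂ) ≠ 0 := Int.cast_ne_zero.2 (by omega)
    rw [bracketMode, Submodule.mkQ_apply, Submodule.Quotient.mk_eq_zero]
    refine ⟨((n + 1 : ℤ) : ℂ)⁻¹ • Finsupp.single (n + 1) 1, ?_⟩
    rw [map_smul, h1, inv_smul_smul₀ h2]
  rw [mode, h, map_zero]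

theorem mode_mul_mode (a b : Fock) (m n : ℤ) :
    mode a m * mode b n = mode b n * mode a m + envι (lieBracket a b m n) := by
  have h := RingQuot.mkAlgHom_rel ℂ (EnvelopingRel.lie a b m n)
  rw [map_mul, map_add, map_mul] at h
  exact h

/-! ### Oscillators and normally ordered products in `𝒰` -/

/-- The oscillators in the enveloping algebra of the vertex algebra. -/
def ueaOsc (n : ℤ) : UEA := toUEA (mode (X 0) n)

theorem lieBracket_X_zero (m n : ℤ) :
    lieBracket (X 0) (X 0) m n = m • bracketMode 1 (m + n - 1) := by
  rw [lieBracket, finsum_eq_single _ 1 fun k hk => ?_]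
  · have h : fockRep.osc 1 (X 0) = 1 := by
      change oscillator (Int.ofNat (0 + 1)) (X 0) = 1
      simp [oscillator]
    rw [nthProduct_eq, Rep.act_X_zero, Nat.cast_one, h, Ring.choose_one_right]
  · have h : fockRep.osc k (X 0) = 0 := by
      change oscillator (Int.ofNat k) (X 0) = 0
      match k, hk with
      | 0, _ => simp [oscillator]
      | 1, hk => exact absurd rfl hk
      | k + 2, _ => simp [oscillator, pderiv_X_of_ne (show (0 : ℕ) ≠ k + 1 by omega)]
    rw [nthProduct_eq, Rep.act_X_zero, h, bracketMode_zero, smul_zero]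

theorem ueaOsc_mul (m n : ℤ) : ueaOsc m * ueaOsc n =
    ueaOsc n * ueaOsc m + if m + n = 0 then (m : ℂ) • 1 else 0 := by
  rw [ueaOsc, ueaOsc, ← map_mul, mode_mul_mode, map_add, map_mul, lieBracket_X_zero, map_zsmul,
    map_zsmul]
  change _ + m • toUEA (mode 1 (m + n - 1)) = _
  split_ifs with h
  · rw [h, zero_sub, toUEA_mode_one_neg_one, Int.cast_smul_eq_zsmul]
  · rw [mode_one (by omega), map_zero, smul_zero]

theorem ueaOsc_comm {m n : ℤ} (h : m + n ≠ 0) : ueaOsc m * ueaOsc n = ueaOsc n * ueaOsc m := by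
  rw [ueaOsc_mul, if_neg h, add_zero]

/-- Evaluation of polynomials at a commuting family of elements of an algebra. -/
def commAeval {A : Type*} [Ring A] [Algebra ℂ A] (b : ℕ → A) (h : ∀ i j, b i * b j = b j * b i) :
    MvPolynomial ℕ ℂ →ₐ[ℂ] A :=
  -- Evaluation needs a commutative target, so it goes through the subalgebra generated by the
  -- family.
  letI : CommRing (Algebra.adjoin ℂ (Set.range b)) :=
    { (inferInstance : Ring (Algebra.adjoin ℂ (Set.range b))) with
      mul_comm := (Algebra.isMulCommutative_adjoin ℂ
        (by rintro _ ⟨i, rfl⟩ _ ⟨j, rfl⟩; exact h i j)).is_comm.comm }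
  (Algebra.adjoin ℂ (Set.range b)).val.comp
    (aeval fun k => ⟨b k, Algebra.subset_adjoin ⟨k, rfl⟩⟩)

theorem commAeval_X {A : Type*} [Ring A] [Algebra ℂ A] (b : ℕ → A)
    (h : ∀ i j, b i * b j = b j * b i) (k : ℕ) : commAeval b h (X k) = b k := by
  simp [commAeval]

/-- Polynomials in the creation operators. -/
def creation : Fock →ₐ[ℂ] UEA :=
  commAeval (fun k => ueaOsc (-k)) fun i j => by
    rcases eq_or_ne i j with rfl | h
    · rfl
    · rcases eq_or_ne ((i : ℤ) + j) 0 with h' | h'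
      · omega
      · exact ueaOsc_comm (by omega)

/-- Polynomials in the annihilation operators. -/
def annihilation : Fock →ₐ[ℂ] UEA :=
  commAeval (fun k => ueaOsc (k + 1)) fun i j => ueaOsc_comm (by omega)

theorem creation_X (k : ℕ) : creation (X k) = ueaOsc (-k) := commAeval_X _ _ k

theorem annihilation_X (k : ℕ) : annihilation (X k) = ueaOsc (k + 1) := commAeval_X _ _ k

/-- Commutation with `bₖ₊₁` is a derivation that sends `b₋ₖ₋₁` to `k + 1` and the other creation
operators to zero. -/
theorem ueaOsc_mul_creation (k : ℕ) (f : Fock) : ueaOsc (k + 1) * creation f =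
    creation (((k : ℂ) + 1) • pderiv (k + 1) f) + creation f * ueaOsc (k + 1) := by
  induction f using MvPolynomial.induction_on with
  | C c =>
    have h : creation (C c) = algebraMap ℂ UEA c := creation.commutes c
    rw [pderiv_C, smul_zero, map_zero, zero_add, h, Algebra.commutes]
  | add p q hp hq =>
    simp only [map_add, smul_add, mul_add, add_mul, hp, hq]
    abel
  | mul_X p i hp =>
    rw [map_mul, ← mul_assoc, hp, add_mul, mul_assoc (creation p), creation_X, ueaOsc_mul,
      mul_add, Derivation.leibniz, pderiv_X, mul_assoc (creation p)]
    simp only [smul_eq_mul, smul_add, map_add]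
    rcases eq_or_ne i (k + 1) with rfl | h
    · rw [if_pos (by push_cast; ring), Pi.single_eq_same, mul_one, mul_comm (X (k + 1)),
        ← smul_mul_assoc, map_mul, creation_X, map_smul creation, map_smul creation]
      push_cast
      rw [mul_smul_comm, mul_one]
      abel
    · rw [if_neg (by omega), Pi.single_eq_of_ne h]
      simp only [mul_zero, smul_zero, map_zero, zero_add, add_zero]
      rw [mul_comm (X i), ← smul_mul_assoc, map_mul, creation_X]

theorem ueaOsc_mem (n : ℤ) : mode (X 0) n ∈ gradedPiece (-n) := by
  have := mode_mem_gradedPiece (X_mem_grade wt 0) n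
  rwa [show wt 0 - n - 1 = -n by simp [wt]] at this

/-- The image of `U_e`. -/
def ueaPiece (e : ℤ) : Submodule ℂ UEA := (gradedPiece e).map toUEA.toLinearMap

theorem one_mem_ueaPiece : (1 : UEA) ∈ ueaPiece 0 :=
  ⟨1, Submodule.subset_span IsMonomial.one, map_one toUEA⟩

theorem mul_mem_ueaPiece {d e : ℤ} {x y : UEA} (hx : x ∈ ueaPiece d) (hy : y ∈ ueaPiece e) :
    x * y ∈ ueaPiece (d + e) := by
  obtain ⟨u, hu, rfl⟩ := hx
  obtain ⟨v, hv, rfl⟩ := hy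
  exact ⟨u * v, mul_mem_gradedPiece hu hv, map_mul toUEA u v⟩

theorem algHom_mem_ueaPiece {F : Fock →ₐ[ℂ] UEA} {w : ℕ → ℤ} (ε : ℤ)
    (hX : ∀ k, F (X k) ∈ ueaPiece (ε * w k)) {z : ℤ} {f : Fock} (hf : f ∈ grade w z) :
    F f ∈ ueaPiece (ε * z) := by
  refine grade_induction (P := fun f => F f ∈ ueaPiece (ε * z)) ?_ ?_ ?_ hf
  · intro s c hs
    rw [monomial_eq_smul, map_smul, ← hs]
    refine Submodule.smul_mem _ _ ?_
    clear hs
    induction s using exponent_induction with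
    | zero =>
      change F 1 ∈ _
      rw [map_one, map_zero, mul_zero]
      exact one_mem_ueaPiece
    | cons k s _ ih =>
      have := mul_mem_ueaPiece (hX k) ih
      rwa [← map_mul, X, monomial_mul, one_mul, ← mul_add, show w k = Finsupp.weight w
        (Finsupp.single k 1) by simp [Finsupp.weight_single], ← map_add] at this
  · rw [map_zero]; exact zero_mem _
  · intro p q hp hq; rw [map_add]; exact add_mem hp hq

theorem creation_mem {z : ℤ} {f : Fock} (hf : f ∈ grade modWt z) : creation f ∈ ueaPiece z := by
  have := algHom_mem_ueaPiece (F := creation) 1 (fun k => ?_) hf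
  · rwa [one_mul] at this
  · rw [creation_X, one_mul, modWt]
    exact ⟨_, by simpa using ueaOsc_mem (-k), rfl⟩

theorem annihilation_mem {z : ℤ} {f : Fock} (hf : f ∈ grade wt z) :
    annihilation f ∈ ueaPiece (-z) := by
  have := algHom_mem_ueaPiece (F := annihilation) (-1) (fun k => ?_) hf
  · rwa [neg_one_mul] at this
  · rw [annihilation_X, neg_one_mul, wt]
    exact ⟨_, ueaOsc_mem (k + 1), rfl⟩

/-- The span of the normally ordered elements of degree `e` whose annihilation part has degree at
most `-m`. -/
def ordered (m e : ℤ) : Submodule ℂ UEA := Submodule.span ℂ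
  {x | ∃ i j : ℤ, i - j = e ∧ m ≤ j ∧ ∃ f ∈ grade modWt i, ∃ g ∈ grade wt j,
    x = creation f * annihilation g}

theorem ordered_mem_ueaPiece {m e : ℤ} {x : UEA} (hx : x ∈ ordered m e) : x ∈ ueaPiece e := by
  refine Submodule.span_le.2 ?_ hx
  rintro _ ⟨i, j, h, _, f, hf, g, hg, rfl⟩
  have := mul_mem_ueaPiece (creation_mem hf) (annihilation_mem hg)
  rwa [← sub_eq_add_neg, h] at this

theorem ordered_mem_UEAZero {m : ℤ} {x : UEA} (hx : x ∈ ordered m 0) : x ∈ UEAZero := by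
  obtain ⟨u, hu, rfl⟩ := ordered_mem_ueaPiece hx
  exact toUEA_mem_UEAZero hu

theorem ordered_mem_nhd {m e : ℤ} {x : UEA} (hx : x ∈ ordered m e) : x ∈ nhd m := by
  refine Submodule.span_le (p := (nhd m).restrictScalars ℂ).2 ?_ hx
  rintro _ ⟨i, j, _, hj, f, _, g, hg, rfl⟩
  obtain ⟨u, hu, h⟩ := annihilation_mem hg
  refine Ideal.mul_mem_left _ _ ?_
  rw [← h]
  exact toUEA_mem_nhd (gradedPiece_mem_leftNhd hu (by omega))

theorem one_mem_ordered : (1 : UEA) ∈ ordered 0 0 :=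
  Submodule.subset_span ⟨0, 0, sub_zero 0, le_rfl, 1, one_mem_grade _, 1, one_mem_grade _, by
    rw [map_one, map_one, one_mul]⟩

/-- An oscillator of index at most zero joins the creation part; one of positive index
differentiates it or joins the annihilation part. The annihilation degree never drops, so the bound
`m` persists. -/
theorem ueaOsc_mul_ordered (n : ℤ) {m e : ℤ} {x : UEA} (hx : x ∈ ordered m e) :
    ueaOsc n * x ∈ ordered m (e - n) := by
  induction hx using Submodule.span_induction with
  | zero => rw [mul_zero]; exact zero_mem _
  | add x y _ _ hx hy => rw [mul_add]; exact add_mem hx hy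
  | smul c x _ hx => rw [mul_smul_comm]; exact Submodule.smul_mem _ _ hx
  | mem x hx =>
    obtain ⟨i, j, h, hj, f, hf, g, hg, rfl⟩ := hx
    rcases le_or_gt n 0 with hn | hn
    · obtain ⟨k, rfl⟩ : ∃ k : ℕ, n = -k := ⟨n.natAbs, by omega⟩
      rw [← creation_X, ← mul_assoc, ← map_mul]
      exact Submodule.subset_span ⟨i + modWt k, j, by rw [modWt]; omega, hj, _,
        X_mul_mem_grade k hf, g, hg, rfl⟩
    · obtain ⟨k, rfl⟩ : ∃ k : ℕ, n = k + 1 := ⟨(n - 1).toNat, by omega⟩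
      rw [← mul_assoc, ueaOsc_mul_creation, add_mul, mul_assoc, ← annihilation_X, ← map_mul]
      refine add_mem (Submodule.subset_span ⟨i - modWt (k + 1), j, by rw [modWt]; push_cast; omega,
        hj, _, Submodule.smul_mem _ _ (pderiv_mem_grade (k + 1) hf), g, hg, rfl⟩)
        (Submodule.subset_span ⟨i, j + wt k, by rw [wt]; omega, by rw [wt]; omega, f, hf, _,
          X_mul_mem_grade k hg, rfl⟩)

/-! ### The Jacobi relations -/

theorem nonarchimedean_completed : NonarchimedeanAddGroup Completed := by
  have : NonarchimedeanRing Enveloping := leftNhd_basis.nonarchimedean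
  infer_instance

/-- The right factors of the two products have degrees `z - n - 1 - i` and `y - m - 1 - i`, which
tend to `-∞` with `i`. -/
theorem jacobiTerm_mem_leftNhd {a b : Fock} {y z : ℤ} (ha : a ∈ grade wt y) (hb : b ∈ grade wt z)
    (l m n N : ℤ) {i : ℕ} (hi : z - n - 1 + N ≤ i) (hi' : y - m - 1 + N ≤ i) :
    jacobiTerm a b l m n i ∈ leftNhd N := by
  refine zsmul_mem (sub_mem (Ideal.mul_mem_left _ _ ?_)
    (zsmul_mem (Ideal.mul_mem_left _ _ ?_) _)) _
  · exact gradedPiece_mem_leftNhd (mode_mem_gradedPiece hb _) (by omega)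
  · exact gradedPiece_mem_leftNhd (mode_mem_gradedPiece ha _) (by omega)

theorem summable_jacobiTerm {a b : Fock} {y z : ℤ} (ha : a ∈ grade wt y) (hb : b ∈ grade wt z)
    (l m n : ℤ) : Summable fun i : ℕ => toCompleted (jacobiTerm a b l m n i) := by
  have := nonarchimedean_completed
  refine NonarchimedeanAddGroup.summable_of_tendsto_cofinite_zero ?_
  rw [Nat.cofinite_eq_atTop]
  have h : Filter.Tendsto (fun i : ℕ => jacobiTerm a b l m n i) Filter.atTop (nhds 0) := by
    refine leftNhd_basis.hasBasis_nhds_zero.tendsto_right_iff.2 fun N _ => ?_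
    filter_upwards [Filter.eventually_ge_atTop (max (z - n - 1 + N) (y - m - 1 + N)).toNat]
      with i hi
    exact jacobiTerm_mem_leftNhd ha hb l m n N (by omega) (by omega)
  have hc : Filter.Tendsto toCompleted (nhds 0) (nhds (toCompleted 0)) :=
    (UniformSpace.Completion.continuous_coe Enveloping).tendsto 0
  rw [map_zero] at hc
  exact hc.comp h

theorem jacobiTerm_mem_gradedPiece {a b : Fock} {y z : ℤ} (ha : a ∈ grade wt y)
    (hb : b ∈ grade wt z) (l m n : ℤ) (i : ℕ) :
    jacobiTerm a b l m n i ∈ gradedPiece (y + z - l - m - n - 2) := by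
  refine zsmul_mem (sub_mem ?_ (zsmul_mem ?_ _)) _
  · have := mul_mem_gradedPiece (mode_mem_gradedPiece ha (m + l - i))
      (mode_mem_gradedPiece hb (n + i))
    convert this using 2
    ring
  · have := mul_mem_gradedPiece (mode_mem_gradedPiece hb (n + l - i))
      (mode_mem_gradedPiece ha (m + i))
    convert this using 2
    ring

/-- The terms tend to zero in a complete nonarchimedean group, so the series converges. All terms
have the same degree, so the sum lies in one closed piece and the relation is available in `Û`;
truncating the series costs only an element of `N^N`. -/
theorem toUEA_jacobiRight {a b : Fock} {y z : ℤ} (ha : a ∈ grade wt y) (hb : b ∈ grade wt z)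
    (l m n N : ℤ) : ∃ T : ℕ, toUEA (jacobiRight a b l m n) -
      ∑ i ∈ Finset.range T, toUEA (jacobiTerm a b l m n i) ∈ nhd N := by
  obtain ⟨s, hs⟩ := summable_jacobiTerm ha hb l m n
  have hmem : s ∈ Algebra.adjoin ℂ (⋃ d : ℤ, completedPiece d) := by
    refine Algebra.subset_adjoin (Set.mem_iUnion.2 ⟨y + z - l - m - n - 2,
      mem_closure_of_tendsto hs.tendsto_sum_nat (Filter.Eventually.of_forall fun T => ?_)⟩)
    rw [← map_sum]
    exact ⟨_, sum_mem fun i _ => jacobiTerm_mem_gradedPiece ha hb l m n i, rfl⟩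
  have h0 : Ideal.Quotient.mk closedIdeal ⟨s, hmem⟩ = toUEA (jacobiRight a b l m n) := by
    rw [toUEA_apply, Ideal.Quotient.eq]
    exact subset_closure (TwoSidedIdeal.subset_span (Or.inl ⟨a, b, l, m, n, s, hs, rfl⟩))
  obtain ⟨T, hT⟩ := sub_sum_mem_of_hasSum hs N
  have h1 := hT T le_rfl
  rw [← map_sum] at h1
  refine ⟨T, ⟨s, hmem⟩ - ⟨toCompleted (∑ i ∈ Finset.range T, jacobiTerm a b l m n i),
    toCompleted_mem_adjoin _⟩, h1, ?_⟩
  rw [map_sub, h0, ← map_sum, toUEA_apply (∑ i ∈ Finset.range T, _)]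

/-- The mode of index `-k - 1` of `b₋₁|0⟩` is multiplication by `X k`, and `m = 0` leaves only the
first term. The Jacobi relation thus reduces the modes of `X k * b` to oscillators and modes of `b`.
-/
theorem jacobiRight_X_zero (k : ℕ) (b : Fock) (n : ℤ) :
    jacobiRight (X 0) b (Int.negSucc k) 0 n = mode (X k * b) n := by
  rw [jacobiRight, finsum_eq_single _ 0 fun i hi => ?_]
  · rw [nthProduct_eq, Nat.cast_zero, add_zero, Rep.act_X_zero, Ring.choose_zero_right, one_smul,
      zero_add, sub_zero]
    rfl
  · obtain ⟨j, rfl⟩ := Nat.exists_eq_succ_of_ne_zero hi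
    rw [Ring.choose_zero_succ, zero_smul]

theorem ueaOsc_mul_sup (n : ℤ) {m e N : ℤ} {x : UEA}
    (hx : x ∈ ordered m e ⊔ (nhd N).restrictScalars ℂ) :
    ueaOsc n * x ∈ ordered m (e - n) ⊔ (nhd N).restrictScalars ℂ := by
  obtain ⟨p, hp, q, hq, rfl⟩ := Submodule.mem_sup.1 hx
  rw [mul_add]
  exact Submodule.add_mem_sup (ueaOsc_mul_ordered n hp) (Ideal.mul_mem_left _ _ hq)

/-- Induction on the monomial. Up to a small error, a mode of `X k * b` is a finite sum of products
of an oscillator and a mode of `b` in either order, and multiplication by an oscillator preserves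
the normally ordered span. -/
theorem toUEA_mode_mul_ordered {z : ℤ} {a : Fock} (ha : a ∈ grade wt z) (n m e N : ℤ) {p : UEA}
    (hp : p ∈ ordered m e) :
    toUEA (mode a n) * p ∈ ordered m (e + z - n - 1) ⊔ (nhd N).restrictScalars ℂ := by
  refine grade_induction (P := fun a => toUEA (mode a n) * p ∈
    ordered m (e + z - n - 1) ⊔ (nhd N).restrictScalars ℂ) ?_ ?_ ?_ ha
  rotate_left
  · rw [mode, bracketMode_zero, map_zero, map_zero, zero_mul]
    exact zero_mem _
  · intro a b ha hb
    rw [mode, bracketMode_add, map_add, map_add, add_mul]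
    exact add_mem ha hb
  · intro s c hs
    rw [monomial_eq_smul, mode, bracketMode_smul, map_smul, map_smul, smul_mul_assoc, ← hs]
    refine Submodule.smul_mem _ _ ?_
    clear hs
    change toUEA (mode _ _) * p ∈ _
    induction s using exponent_induction generalizing n e N p with
    | zero =>
      change toUEA (mode 1 n) * p ∈ _
      rcases eq_or_ne n (-1) with rfl | hn
      · rw [toUEA_mode_one_neg_one, one_mul, map_zero]
        refine Submodule.mem_sup_left ?_
        simpa using hp
      · rw [mode_one hn, map_zero toUEA, zero_mul]
        exact zero_mem _
    | cons k s _ ih =>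
      obtain ⟨u, hu, hup⟩ := ordered_mem_ueaPiece hp
      -- The precision is `N + e` because right multiplication by `p`, of degree `e`, loses `e`.
      obtain ⟨T, hT⟩ := toUEA_jacobiRight (X_mem_grade wt 0)
        (monomial_mem_grade (w := wt) (s := s) (c := 1) rfl) (Int.negSucc k) 0 n (N + e)
      have h1 := nhd_mul_toUEA hT hu
      rw [add_sub_cancel_right, jacobiRight_X_zero, X, monomial_mul, one_mul, sub_mul,
        Finset.sum_mul] at h1
      have hup' : toUEA u = p := hup
      rw [hup'] at h1
      rw [← sub_add_cancel (toUEA _ * p)]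
      refine add_mem (Submodule.mem_sup_right h1) (sum_mem fun i _ => ?_)
      have hw : Finsupp.weight wt (Finsupp.single k 1 + s) = k + 1 + Finsupp.weight wt s := by
        simp [Finsupp.weight_single, wt]
      rw [jacobiTerm, map_zsmul, map_sub, map_mul, map_zsmul, map_mul, smul_mul_assoc, sub_mul,
        smul_mul_assoc, mul_assoc, mul_assoc, hw]
      refine zsmul_mem (sub_mem ?_ (zsmul_mem ?_ _)) _
      · have := ueaOsc_mul_sup (0 + Int.negSucc k - i) (ih (n + i) e N hp)
        rw [show e + Finsupp.weight wt s - (n + i) - 1 - (0 + Int.negSucc k - i) =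
          e + (k + 1 + Finsupp.weight wt s) - n - 1 by rw [Int.negSucc_eq]; ring] at this
        exact this
      · have := ih (n + Int.negSucc k - i) (e - (0 + i)) N (ueaOsc_mul_ordered (0 + i) hp)
        rw [show e - (0 + (i : ℤ)) + Finsupp.weight wt s - (n + Int.negSucc k - i) - 1 =
          e + (k + 1 + Finsupp.weight wt s) - n - 1 by rw [Int.negSucc_eq]; ring] at this
        exact this

theorem toUEA_mem_ordered {d : ℤ} {u : Enveloping} (hu : u ∈ gradedPiece d) (N : ℤ) :
    toUEA u ∈ ordered 0 d ⊔ (nhd N).restrictScalars ℂ := by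
  induction hu using Submodule.span_induction with
  | zero => rw [map_zero]; exact zero_mem _
  | add x y _ _ hx hy => rw [map_add]; exact add_mem hx hy
  | smul c x _ hx => rw [map_smul]; exact Submodule.smul_mem _ _ hx
  | mem u hu =>
    induction hu with
    | one => rw [map_one]; exact Submodule.mem_sup_left one_mem_ordered
    | @mul w a ha n d u _ ih =>
      obtain ⟨p, hp, q, hq, h⟩ := Submodule.mem_sup.1 ih
      rw [map_mul, ← h, mul_add]
      refine add_mem ?_ (Submodule.mem_sup_right (Ideal.mul_mem_left _ _ hq))
      have := toUEA_mode_mul_ordered (mem_weightSpace.1 ha) n 0 d N hp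
      rwa [show d + w - n - 1 = w - n - 1 + d by ring] at this

/-- Modulo the neighbourhoods of zero, `𝒰₀` is spanned by normally ordered elements. -/
theorem exists_ordered {x : UEA} (hx : x ∈ UEAZero) (N : ℤ) :
    ∃ p ∈ ordered 0 0, x - p ∈ nhd N := by
  obtain ⟨u, hu, h⟩ := exists_sub_mem_nhd hx N
  obtain ⟨p, hp, q, hq, hpq⟩ := Submodule.mem_sup.1 (toUEA_mem_ordered hu N)
  refine ⟨p, hp, ?_⟩
  rw [← sub_add_sub_cancel x (toUEA u) p, ← hpq, add_sub_cancel_left]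
  rw [← hpq] at h
  exact add_mem h hq

/-! ### Partitions and polynomials over `ℂ[x]` -/

theorem sum_parts (s : ℕ →₀ ℕ) :
    ((((Finsupp.toMultiset s).map (· + 1)).sum : ℕ) : ℤ) = Finsupp.weight wt s := by
  induction s using Finsupp.induction_linear with
  | zero => simp
  | add s t hs ht => rw [map_add, Multiset.map_add, Multiset.sum_add, Nat.cast_add, hs, ht, map_add]
  | single n a =>
    rw [Finsupp.toMultiset_single, Multiset.map_nsmul, Multiset.sum_nsmul, Finsupp.weight_single]
    simp [wt]

/-- Partitions of `j` as exponents of monomials of weight `j`. -/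
def partitionEquiv (j : ℕ) : {s : ℕ →₀ ℕ // Finsupp.weight wt s = j} ≃ Nat.Partition j where
  toFun s :=
    { parts := (Finsupp.toMultiset s.1).map (· + 1)
      parts_pos := by
        intro i hi
        obtain ⟨k, _, rfl⟩ := Multiset.mem_map.1 hi
        exact Nat.succ_pos k
      parts_sum := by exact_mod_cast (sum_parts s.1).trans s.2 }
  invFun p := ⟨Multiset.toFinsupp (p.parts.map Nat.pred), by
    rw [← sum_parts, Multiset.toFinsupp_toMultiset, Multiset.map_map]
    have h : p.parts.map ((· + 1) ∘ Nat.pred) = p.parts := by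
      conv_rhs => rw [← Multiset.map_id p.parts]
      exact Multiset.map_congr rfl fun i hi => Nat.succ_pred_eq_of_pos (p.parts_pos hi)
    rw [h, p.parts_sum]⟩
  left_inv s := by
    refine Subtype.ext ?_
    simp only [Multiset.map_map]
    have h : (Nat.pred ∘ fun x : ℕ => x + 1) = id := rfl
    rw [h, Multiset.map_id, Finsupp.toMultiset_toFinsupp]
  right_inv p := by
    refine Nat.Partition.ext ?_
    simp only [Multiset.toFinsupp_toMultiset, Multiset.map_map]
    conv_rhs => rw [← Multiset.map_id p.parts]
    exact Multiset.map_congr rfl fun i hi => Nat.succ_pred_eq_of_pos (p.parts_pos hi)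

/-- Variables other than the zeroth. -/
def natOption : ℕ ≃ Option ℕ where
  toFun
    | 0 => none
    | k + 1 => some k
  invFun
    | none => 0
    | some k => k + 1
  left_inv k := by cases k <;> rfl
  right_inv k := by cases k <;> rfl

/-- The identification of the universal Fock module with polynomials over `ℂ[x]`. -/
def expand : Fock ≃ₐ[ℂ] MvPolynomial ℕ ℂ[X] :=
  (renameEquiv ℂ natOption).trans (optionEquivRight ℂ ℕ)

theorem expand_X_zero : expand (X 0) = C Polynomial.X := by
  rw [expand, AlgEquiv.trans_apply, renameEquiv_apply, rename_X]
  exact optionEquivRight_X_none ℂ ℕ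

theorem expand_X_succ (k : ℕ) : expand (X (k + 1)) = X k := by
  rw [expand, AlgEquiv.trans_apply, renameEquiv_apply, rename_X]
  exact optionEquivRight_X_some ℂ ℕ k

theorem pderiv_expand (k : ℕ) (f : Fock) : pderiv k (expand f) = expand (pderiv (k + 1) f) := by
  induction f using MvPolynomial.induction_on with
  | C c =>
    have h : expand (C c) = C (Polynomial.C c) := expand.commutes c
    rw [h, pderiv_C, pderiv_C, map_zero]
  | add p q hp hq => simp only [map_add, hp, hq]
  | mul_X p i hp =>
    have h : pderiv k (expand (X i)) = expand (pderiv (k + 1) (X i)) := by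
      match i with
      | 0 => rw [expand_X_zero, pderiv_C, pderiv_X_of_ne (by omega), map_zero]
      | i + 1 =>
        rw [expand_X_succ]
        rcases eq_or_ne i k with rfl | h
        · rw [pderiv_X_self, pderiv_X_self, map_one]
        · rw [pderiv_X_of_ne h, pderiv_X_of_ne (by omega), map_zero]
    rw [map_mul, Derivation.leibniz, Derivation.leibniz, hp, h]
    simp only [smul_eq_mul, map_add, map_mul]

/-- `X 0` has degree zero and becomes a scalar, while `X (k + 1)`, of degree `k + 1`, becomes the
variable `X k` of weight `wt k`. -/
theorem expand_mem {z : ℤ} {f : Fock} (hf : f ∈ grade modWt z) :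
    IsWeightedHomogeneous wt (expand f) z := by
  refine grade_induction (P := fun f => IsWeightedHomogeneous wt (expand f) z) ?_ ?_ ?_ hf
  · intro s c hs
    rw [monomial_eq_smul, map_smul, ← hs]
    refine ((weightedHomogeneousSubmodule ℂ[X] wt _).restrictScalars ℂ).smul_mem _ ?_
    change IsWeightedHomogeneous wt _ _
    clear hs
    induction s using exponent_induction with
    | zero =>
      rw [map_zero]
      change IsWeightedHomogeneous wt (expand 1) 0
      rw [map_one]
      exact isWeightedHomogeneous_one _ _
    | cons k s _ ih =>
      rw [show (monomial (Finsupp.single k 1 + s) 1 : Fock) = X k * monomial s 1 by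
        rw [X, monomial_mul, one_mul], map_mul, map_add]
      refine IsWeightedHomogeneous.mul ?_ ih
      rw [Finsupp.weight_single, one_smul]
      match k with
      | 0 => rw [expand_X_zero]; exact isWeightedHomogeneous_C _ _
      | k + 1 => rw [expand_X_succ]; exact isWeightedHomogeneous_X _ _ _
  · rw [map_zero]; exact (weightedHomogeneousSubmodule ℂ[X] wt z).zero_mem
  · intro p q hp hq
    rw [map_add]
    exact (weightedHomogeneousSubmodule ℂ[X] wt z).add_mem hp hq

theorem eq_sum_monomial {R : Type*} [CommSemiring R] {p : MvPolynomial ℕ R} {j : ℕ}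
    {ι : Type*} [Fintype ι] (e : ι ≃ {s : ℕ →₀ ℕ // Finsupp.weight wt s = j})
    (h : IsWeightedHomogeneous wt p (j : ℤ)) :
    p = ∑ a : ι, monomial (e a).1 (coeff (e a).1 p) := by
  classical
  refine MvPolynomial.ext _ _ fun s => ?_
  rw [coeff_sum]
  simp only [coeff_monomial]
  by_cases hs : Finsupp.weight wt s = j
  · rw [Finset.sum_eq_single (e.symm ⟨s, hs⟩)]
    · simp
    · intro b _ hb
      rw [if_neg]
      rintro rfl
      exact hb (e.symm_apply_apply b).symm
    · intro h; exact absurd (Finset.mem_univ _) h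
  · rw [h.coeff_eq_zero s hs, Finset.sum_eq_zero]
    intro b _
    rw [if_neg]
    rintro rfl
    exact hs (e b).2

theorem C_mul_mem {z : ℤ} {f : Fock} (p : ℂ[X]) (hf : f ∈ grade modWt z) :
    expand.symm (C p) * f ∈ grade modWt z := by
  induction p using Polynomial.induction_on' with
  | add p q hp hq => rw [C_add, map_add, add_mul]; exact add_mem hp hq
  | monomial n c =>
    induction n generalizing f with
    | zero =>
      have h : expand (C c) = C (Polynomial.C c) := expand.commutes c
      rw [Polynomial.monomial_zero_left, ← h, AlgEquiv.symm_apply_apply, ← smul_eq_C_mul]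
      exact Submodule.smul_mem _ _ hf
    | succ n ih =>
      rw [← Polynomial.monomial_mul_X, C_mul, ← expand_X_zero, map_mul, AlgEquiv.symm_apply_apply,
        mul_assoc]
      refine ih ?_
      simpa [modWt] using X_mul_mem_grade 0 hf

/-- The monomials in the variables other than the zeroth. -/
def freeVec (t : ℕ →₀ ℕ) : Fock := expand.symm (monomial t 1)

theorem expand_freeVec (t : ℕ →₀ ℕ) : expand (freeVec t) = monomial t 1 :=
  expand.apply_symm_apply _

theorem freeVec_mem (t : ℕ →₀ ℕ) : freeVec t ∈ grade modWt (Finsupp.weight wt t) := by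
  induction t using exponent_induction with
  | zero =>
    have h : freeVec 0 = 1 := map_one expand.symm
    rw [h, map_zero]
    exact one_mem_grade _
  | cons k t _ ih =>
    have h : freeVec (Finsupp.single k 1 + t) = X (k + 1) * freeVec t := by
      apply expand.injective
      rw [map_mul, expand_freeVec, expand_freeVec, expand_X_succ, X, monomial_mul, one_mul]
    rw [h, map_add, add_comm, Finsupp.weight_single, one_smul]
    exact X_mul_mem_grade (k + 1) ih

theorem ueaAct_C_mul (x : UEA) (p : ℂ[X]) (f : Fock) :
    ueaAct x (expand.symm (C p) * f) = expand.symm (C p) * ueaAct x f := by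
  induction p using Polynomial.induction_on' with
  | add p q hp hq => simp only [map_add, add_mul, hp, hq]
  | monomial n c =>
    induction n generalizing f with
    | zero =>
      have h : expand (C c) = C (Polynomial.C c) := expand.commutes c
      rw [Polynomial.monomial_zero_left, ← h, AlgEquiv.symm_apply_apply, ← smul_eq_C_mul,
        ← smul_eq_C_mul, map_smul]
    | succ n ih =>
      rw [← Polynomial.monomial_mul_X, C_mul, ← expand_X_zero, map_mul expand.symm,
        AlgEquiv.symm_apply_apply,
        mul_assoc, ih, ueaAct_X_zero, mul_assoc]

/-! ### Matrices of elements of degree zero -/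

/-- The number of partitions of `j`. -/
abbrev numPartitions (j : ℕ) : ℕ := Fintype.card (Nat.Partition j)

/-- An enumeration of the exponents of weight `j`. -/
def index (j : ℕ) : Fin (numPartitions j) ≃ {s : ℕ →₀ ℕ // Finsupp.weight wt s = j} :=
  (Fintype.equivFin _).symm.trans (partitionEquiv j).symm

theorem weight_index (j : ℕ) (a : Fin (numPartitions j)) : Finsupp.weight wt (index j a).1 = j :=
  (index j a).2

/-- The basis over `ℂ[x]` of the piece of degree `j` of the universal Fock module. -/
def basisVec (j : ℕ) (a : Fin (numPartitions j)) : Fock := freeVec (index j a).1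

theorem basisVec_mem (j : ℕ) (a : Fin (numPartitions j)) : basisVec j a ∈ grade modWt j := by
  have := freeVec_mem (index j a).1
  rwa [weight_index] at this

theorem eq_sum_basisVec {j : ℕ} {v : Fock} (hv : v ∈ grade modWt j) :
    v = ∑ a, expand.symm (C (coeff (index j a).1 (expand v))) * basisVec j a := by
  apply expand.injective
  rw [map_sum]
  simp only [map_mul, AlgEquiv.apply_symm_apply, basisVec, expand_freeVec, C_mul_monomial, mul_one]
  exact eq_sum_monomial (index j) (expand_mem hv)

/-- The matrix of an element of `𝒰₀` on the piece of degree `j` of the universal Fock module. -/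
def entries (j : ℕ) :
    UEA →ₗ[ℂ] Matrix (Fin (numPartitions j)) (Fin (numPartitions j)) ℂ[X] where
  toFun x := Matrix.of fun a b => coeff (index j a).1 (expand (ueaAct x (basisVec j b)))
  map_add' x y := by
    ext1 a b
    simp only [Matrix.of_apply, Matrix.add_apply, map_add, LinearMap.add_apply, coeff_add]
  map_smul' c x := by
    ext1 a b
    simp only [Matrix.of_apply, Matrix.smul_apply, map_smul, LinearMap.smul_apply, coeff_smul,
      RingHom.id_apply]

theorem entries_apply (j : ℕ) (x : UEA) (a b : Fin (numPartitions j)) :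
    entries j x a b = coeff (index j a).1 (expand (ueaAct x (basisVec j b))) := rfl

theorem ueaAct_basisVec {j : ℕ} {x : UEA} (hx : x ∈ UEAZero) (b : Fin (numPartitions j)) :
    ueaAct x (basisVec j b) = ∑ a, expand.symm (C (entries j x a b)) * basisVec j a :=
  eq_sum_basisVec (ueaAct_mem_grade hx (basisVec_mem j b))

theorem entries_one (j : ℕ) : entries j 1 = 1 := by
  ext1 a b
  rw [entries_apply, map_one, Module.End.one_apply, basisVec, expand_freeVec, coeff_monomial,
    Matrix.one_apply]
  refine if_congr ?_ rfl rfl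
  rw [← Subtype.ext_iff, (index j).injective.eq_iff, eq_comm]

/-- The action is `ℂ[x]`-linear. Only the right factor has to preserve the degree, so that its
values expand in the basis. -/
theorem entries_mul (j : ℕ) (x : UEA) {y : UEA} (hy : y ∈ UEAZero) :
    entries j (x * y) = entries j x * entries j y := by
  ext1 a b
  rw [entries_apply, map_mul, Module.End.mul_apply, ueaAct_basisVec hy, map_sum, map_sum,
    coeff_sum, Matrix.mul_apply]
  refine Finset.sum_congr rfl fun c _ => ?_
  rw [ueaAct_C_mul, map_mul, AlgEquiv.apply_symm_apply, coeff_C_mul, mul_comm, entries_apply j x]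

theorem entries_nhd {j : ℕ} {n : ℤ} (hj : j < n) {x : UEA} (hx : x ∈ nhd n) :
    entries j x = 0 := by
  ext1 a b
  rw [entries_apply, ueaAct_nhd hj hx (basisVec_mem j b), map_zero, coeff_zero, Matrix.zero_apply]

/-- The action of `𝒰₀` on the piece of degree `j` of the universal Fock module. -/
def matrixAct (j : ℕ) :
    UEAZero →ₐ[ℂ] Matrix (Fin (numPartitions j)) (Fin (numPartitions j)) ℂ[X] :=
  AlgHom.ofLinearMap (entries j ∘ₗ UEAZero.val.toLinearMap) (entries_one j)
    fun x y => entries_mul j x.1 y.2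

/-! ### Realizing matrices by normally ordered elements -/

theorem ueaAct_creation (f v : Fock) : ueaAct (creation f) v = f * v := by
  induction f using MvPolynomial.induction_on generalizing v with
  | C c =>
    have h : creation (C c) = algebraMap ℂ UEA c := creation.commutes c
    rw [h, AlgHom.commutes, Module.algebraMap_end_apply, smul_eq_C_mul]
  | add p q hp hq => rw [map_add, map_add, LinearMap.add_apply, hp, hq, add_mul]
  | mul_X p k hp =>
    rw [map_mul, map_mul, Module.End.mul_apply, hp, creation_X, ueaOsc, ueaAct_toUEA, envAct_mode,
      Rep.act_X_zero, mul_assoc]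
    congr 1
    match k with
    | 0 => rfl
    | k + 1 => rfl

theorem ueaAct_annihilation_X (k : ℕ) (v : Fock) :
    ueaAct (annihilation (X k)) v = ((k : ℂ) + 1) • pderiv (k + 1) v := by
  rw [annihilation_X, ueaOsc, ueaAct_toUEA, envAct_mode, Rep.act_X_zero]
  rfl

theorem eq_zero_of_weight_eq_zero {t : ℕ →₀ ℕ} (h : Finsupp.weight wt t = 0) : t = 0 := by
  induction t using exponent_induction with
  | zero => rfl
  | cons k t _ _ =>
    rw [map_add, Finsupp.weight_single, one_smul, wt] at h
    have := weight_nonneg wt_nonneg t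
    omega

theorem pderiv_freeVec (k : ℕ) (t : ℕ →₀ ℕ) :
    pderiv (k + 1) (freeVec t) = (t k : ℂ) • freeVec (t - Finsupp.single k 1) := by
  apply expand.injective
  rw [← pderiv_expand, expand_freeVec, pderiv_monomial, map_smul, expand_freeVec, smul_monomial,
    one_mul]
  congr 1
  rw [Algebra.smul_def, mul_one, map_natCast]

/-- A monomial of differential operators applied to a monomial of the same weight vanishes unless
the exponents agree, and otherwise gives a nonzero constant. -/
theorem ueaAct_annihilation_monomial (s : ℕ →₀ ℕ) : ∃ c : ℂ, c ≠ 0 ∧ ∀ t,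
    Finsupp.weight wt t = Finsupp.weight wt s →
      ueaAct (annihilation (monomial s 1)) (freeVec t) = if s = t then C c else 0 := by
  induction s using exponent_induction with
  | zero =>
    refine ⟨1, one_ne_zero, fun t ht => ?_⟩
    rw [map_zero] at ht
    obtain rfl := eq_zero_of_weight_eq_zero ht
    have h : freeVec 0 = 1 := map_one expand.symm
    have h' : annihilation (monomial 0 1) = 1 := map_one annihilation
    rw [h, h', map_one ueaAct, if_pos rfl]
    rfl
  | cons k s _ ih =>
    obtain ⟨c, hc, h⟩ := ih
    -- The factor `k + 1` comes from `bₖ₊₁ = (k + 1) ∂`, and `s k + 1` is the exponent that is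
    -- differentiated.
    refine ⟨((k : ℂ) + 1) * (s k + 1) * c,
      mul_ne_zero (mul_ne_zero k.cast_add_one_ne_zero (s k).cast_add_one_ne_zero) hc,
      fun t ht => ?_⟩
    rw [show (monomial (Finsupp.single k 1 + s) 1 : Fock) = monomial s 1 * X k by
      rw [X, monomial_mul, one_mul, add_comm], map_mul, map_mul, Module.End.mul_apply,
      ueaAct_annihilation_X, pderiv_freeVec]
    rcases Nat.eq_zero_or_pos (t k) with h0 | h0
    · rw [h0, Nat.cast_zero, zero_smul, smul_zero, map_zero, if_neg]
      rintro rfl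
      simp at h0
    · obtain ⟨t, rfl⟩ : ∃ t', t = Finsupp.single k 1 + t' :=
        ⟨t - Finsupp.single k 1, (add_tsub_cancel_of_le (Finsupp.single_le_iff.2 h0)).symm⟩
      rw [map_add, map_add, add_right_inj] at ht
      rw [add_tsub_cancel_left, map_smul, map_smul, h t ht]
      by_cases hst : s = t
      · subst hst
        rw [if_pos rfl, if_pos rfl, smul_smul, smul_eq_C_mul, ← C_mul]
        simp [add_comm]
      · rw [if_neg hst, if_neg (by simpa using hst), smul_zero, smul_zero]

theorem exists_annihilation_basisVec (j : ℕ) : ∃ c : Fin (numPartitions j) → ℂ, (∀ a, c a ≠ 0) ∧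
    ∀ a b, ueaAct (annihilation (monomial (index j a).1 1)) (basisVec j b) =
      if a = b then C (c a) else 0 := by
  choose c hc h using fun a : Fin (numPartitions j) => ueaAct_annihilation_monomial (index j a).1
  refine ⟨c, hc, fun a b => ?_⟩
  rw [basisVec, h a _ (by rw [weight_index, weight_index])]
  refine if_congr ?_ rfl rfl
  rw [← Subtype.ext_iff, (index j).injective.eq_iff]

theorem ueaAct_sum_basisVec {j : ℕ} {c : Fin (numPartitions j) → ℂ}
    (h : ∀ a b, ueaAct (annihilation (monomial (index j a).1 1)) (basisVec j b) =
      if a = b then C (c a) else 0) (f : Fin (numPartitions j) → Fock)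
    (b : Fin (numPartitions j)) :
    ueaAct (∑ a, creation (f a) * annihilation (monomial (index j a).1 1)) (basisVec j b) =
      c b • f b := by
  rw [map_sum, LinearMap.sum_apply, Finset.sum_eq_single b]
  · rw [map_mul, Module.End.mul_apply, h, if_pos rfl, ueaAct_creation, mul_comm, smul_eq_C_mul]
  · intro a _ hab
    rw [map_mul, Module.End.mul_apply, h, if_neg hab, map_zero]
  · intro hb; exact absurd (Finset.mem_univ b) hb

theorem sum_mem_ordered {j : ℕ} {f : Fin (numPartitions j) → Fock}
    (hf : ∀ a, f a ∈ grade modWt j) :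
    ∑ a, creation (f a) * annihilation (monomial (index j a).1 1) ∈ ordered j 0 :=
  sum_mem fun a _ => Submodule.subset_span ⟨j, j, sub_self _, le_rfl, f a, hf a, _,
    monomial_mem_grade (weight_index j a), rfl⟩

theorem ordered_anti {m n : ℤ} (h : m ≤ n) (e : ℤ) : ordered n e ≤ ordered m e :=
  Submodule.span_mono fun _ ⟨i, j, hij, hj, hx⟩ => ⟨i, j, hij, h.trans hj, hx⟩

theorem exists_entries_eq (j : ℕ)
    (A : Matrix (Fin (numPartitions j)) (Fin (numPartitions j)) ℂ[X]) :
    ∃ x ∈ ordered j 0, entries j x = A := by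
  obtain ⟨c, hc, h⟩ := exists_annihilation_basisVec j
  -- The vector prescribed by column `b` of `A`, divided by the pairing constant of the annihilation
  -- monomial dual to basis vector `b`.
  set f : Fin (numPartitions j) → Fock := fun b =>
    (c b)⁻¹ • ∑ a, expand.symm (C (A a b)) * basisVec j a
  refine ⟨_, sum_mem_ordered (f := f) fun b => Submodule.smul_mem _ _
    (sum_mem fun a _ => C_mul_mem _ (basisVec_mem j a)), ?_⟩
  ext1 a b
  rw [entries_apply, ueaAct_sum_basisVec h, smul_inv_smul₀ (hc b), map_sum, coeff_sum,
    Finset.sum_eq_single a]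
  · rw [map_mul, AlgEquiv.apply_symm_apply, basisVec, expand_freeVec, coeff_C_mul, coeff_monomial,
      if_pos rfl, mul_one]
  · intro a' _ ha
    rw [map_mul, AlgEquiv.apply_symm_apply, basisVec, expand_freeVec, coeff_C_mul, coeff_monomial,
      if_neg, mul_zero]
    rw [← Subtype.ext_iff, (index j).injective.eq_iff]
    exact ha
  · intro hb; exact absurd (Finset.mem_univ a) hb

/-- The system is triangular: a correction in `ordered m 0` acts by zero in degrees below `m`, so
the degrees can be adjusted one after the other. -/
theorem exists_forall_entries_eq (m : ℕ)
    (A : ∀ j : ℕ, Matrix (Fin (numPartitions j)) (Fin (numPartitions j)) ℂ[X]) :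
    ∃ x ∈ ordered 0 0, ∀ j < m, entries j x = A j := by
  induction m with
  | zero => exact ⟨0, zero_mem _, fun j hj => absurd hj j.not_lt_zero⟩
  | succ m ih =>
    obtain ⟨x, hx, h⟩ := ih
    obtain ⟨y, hy, h'⟩ := exists_entries_eq m (A m - entries m x)
    refine ⟨x + y, add_mem hx (ordered_anti (Int.natCast_nonneg m) 0 hy), fun j hj => ?_⟩
    rw [map_add]
    rcases Nat.lt_succ_iff_lt_or_eq.1 hj with hj | rfl
    · rw [h j hj, entries_nhd (by exact_mod_cast hj) (ordered_mem_nhd hy), add_zero]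
    · rw [h', add_sub_cancel]

/-! ### The kernel of the action on normally ordered elements -/

/-- Isolates the part with annihilation degree exactly `j`, written in terms of the annihilation
monomials of weight `j`. -/
theorem exists_sub_sum_mem_ordered {j : ℕ} {x : UEA} (hx : x ∈ ordered j 0) :
    ∃ f : Fin (numPartitions j) → Fock,
      x - ∑ a, creation (f a) * annihilation (monomial (index j a).1 1) ∈ ordered (j + 1) 0 := by
  induction hx using Submodule.span_induction with
  | zero => exact ⟨0, by simp⟩
  | add x y _ _ hx hy =>
    obtain ⟨f, hf⟩ := hx
    obtain ⟨g, hg⟩ := hy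
    refine ⟨f + g, ?_⟩
    simp only [Pi.add_apply, map_add, add_mul, Finset.sum_add_distrib, add_sub_add_comm]
    exact add_mem hf hg
  | smul c x _ hx =>
    obtain ⟨f, hf⟩ := hx
    refine ⟨c • f, ?_⟩
    simp only [Pi.smul_apply, map_smul, smul_mul_assoc, ← Finset.smul_sum, ← smul_sub]
    exact Submodule.smul_mem _ _ hf
  | mem x hx =>
    obtain ⟨i, k, hik, hk, f, hf, g, hg, rfl⟩ := hx
    rcases hk.eq_or_lt with rfl | hk
    · refine ⟨fun a => coeff (index j a).1 g • f, ?_⟩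
      have h : annihilation g =
          ∑ a, coeff (index j a).1 g • annihilation (monomial (index j a).1 1) := by
        conv_lhs => rw [eq_sum_monomial (index j) hg]
        rw [map_sum]
        exact Finset.sum_congr rfl fun a _ => by rw [monomial_eq_smul, map_smul]
      rw [h, Finset.mul_sum, ← Finset.sum_sub_distrib]
      simp only [map_smul, smul_mul_assoc, mul_smul_comm, sub_self, Finset.sum_const_zero]
      exact zero_mem _
    · refine ⟨0, ?_⟩
      simp only [Pi.zero_apply, map_zero, zero_mul, Finset.sum_const_zero, sub_zero]
      exact Submodule.subset_span ⟨i, k, hik, hk, f, hf, g, hg, rfl⟩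

theorem ueaAct_basisVec_eq_zero {j : ℕ} {x : UEA} (hx : x ∈ UEAZero) (h : entries j x = 0)
    (b : Fin (numPartitions j)) : ueaAct x (basisVec j b) = 0 := by
  rw [ueaAct_basisVec hx, h]
  simp

/-- The remainder kills the piece of degree `j`, so the value on basis vector `b` is a nonzero
multiple of the coefficient `f b`. Zero entries therefore make the whole leading part vanish. -/
theorem mem_ordered_of_entries {j : ℕ} {x : UEA} (hx : x ∈ ordered j 0) (h : entries j x = 0) :
    x ∈ ordered (j + 1) 0 := by
  obtain ⟨f, hf⟩ := exists_sub_sum_mem_ordered hx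
  obtain ⟨c, hc, hcb⟩ := exists_annihilation_basisVec j
  have hf0 : ∀ b, f b = 0 := fun b => by
    have h1 := ueaAct_nhd (z := j) (by omega) (ordered_mem_nhd hf) (basisVec_mem j b)
    rw [map_sub, LinearMap.sub_apply, ueaAct_basisVec_eq_zero (ordered_mem_UEAZero hx) h b,
      ueaAct_sum_basisVec hcb, zero_sub, neg_eq_zero] at h1
    exact (smul_eq_zero.1 h1).resolve_left (hc b)
  simpa [hf0] using hf

theorem mem_ordered_of_forall_entries {m : ℕ} {x : UEA} (hx : x ∈ ordered 0 0)
    (h : ∀ j < m, entries j x = 0) : x ∈ ordered m 0 := by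
  induction m with
  | zero => exact hx
  | succ m ih =>
    have := mem_ordered_of_entries (ih fun j hj => h j (by omega)) (h m (by omega))
    rwa [Nat.cast_succ]

/-! ### The higher level Zhu algebras -/

/-- The action of `𝒰₀` on the pieces of degree less than `m` of the universal Fock module. -/
def totalAct (m : ℕ) : UEAZero →ₐ[ℂ] ∀ j : Fin m,
    Matrix (Fin (numPartitions j)) (Fin (numPartitions j)) ℂ[X] :=
  AlgHom.pi fun j => matrixAct j

theorem totalAct_apply (m : ℕ) (x : UEAZero) (j : Fin m) :
    totalAct m x j = entries j (x : UEA) := rfl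

theorem totalAct_surjective (m : ℕ) : Function.Surjective (totalAct m) := by
  intro A
  obtain ⟨x, hx, h⟩ := exists_forall_entries_eq m
    fun j => if hj : j < m then A ⟨j, hj⟩ else 0
  refine ⟨⟨x, ordered_mem_UEAZero hx⟩, funext fun j => ?_⟩
  rw [totalAct_apply, h j j.2, dif_pos j.2]

theorem entries_congr {j : ℕ} {n : ℤ} (hj : j < n) {x y : UEA} (h : x - y ∈ nhd n) :
    entries j x = entries j y := by
  rw [← sub_eq_zero, ← map_sub (entries j)]
  exact entries_nhd hj h

/-- Elements of `N^m` do not affect the entries in degrees below `m`, so `x` may be replaced by a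
normally ordered element. -/
theorem mem_nhd_of_entries {m : ℕ} {x : UEA} (hx : x ∈ UEAZero) (h : ∀ j < m, entries j x = 0) :
    x ∈ nhd m := by
  obtain ⟨p, hp, hxp⟩ := exists_ordered hx m
  have hp' : p ∈ ordered m 0 := mem_ordered_of_forall_entries hp fun j hj => by
    rw [← entries_congr (Nat.cast_lt.2 hj) hxp, h j hj]
  rw [← sub_add_cancel x p]
  exact add_mem hxp (ordered_mem_nhd hp')

theorem totalAct_eq_zero_iff (m : ℕ) (x : UEAZero) : totalAct m x = 0 ↔ x ∈ nhdZero m := by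
  rw [mem_nhdZero]
  refine ⟨fun h => mem_nhd_of_entries x.2 fun j hj => ?_, fun h => _root_.funext fun j => ?_⟩
  · rw [← totalAct_apply m x ⟨j, hj⟩, h, Pi.zero_apply]
  · rw [totalAct_apply, entries_nhd (n := m) (Nat.cast_lt.2 j.2) h, Pi.zero_apply]

theorem nonempty_higherZhu_equiv {m : ℕ} {n : ℤ} (h : n + 1 = m) :
    Nonempty (HigherZhu n ≃ₐ[ℂ] ∀ j : Fin m,
      Matrix (Fin (numPartitions j)) (Fin (numPartitions j)) ℂ[X]) := by
  have hk : ∀ x : UEAZero, x ∈ nhdZero (n + 1) ↔ totalAct m x = 0 := fun x => by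
    rw [h, totalAct_eq_zero_iff]
  refine ⟨AlgEquiv.ofBijective (Ideal.Quotient.liftₐ (nhdZero (n + 1)) (totalAct m)
    fun x hx => (hk x).1 hx) ⟨?_, ?_⟩⟩
  · rw [injective_iff_map_eq_zero]
    intro y hy
    obtain ⟨x, rfl⟩ := Ideal.Quotient.mk_surjective y
    exact Ideal.Quotient.eq_zero_iff_mem.2 ((hk x).2 hy)
  · intro A
    obtain ⟨x, hx⟩ := totalAct_surjective m A
    exact ⟨Ideal.Quotient.mk _ x, hx⟩

/-- Splitting off the last factor of a product of algebras. -/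
def splitLast (m : ℕ) (R : ℕ → Type) [∀ j, Ring (R j)] [∀ j, Algebra ℂ (R j)] :
    (∀ j : Fin (m + 1), R j) ≃ₐ[ℂ] R m × ∀ j : Fin m, R j :=
  AlgEquiv.ofBijective
    ((Pi.evalAlgHom ℂ (fun j : Fin (m + 1) => R j) (Fin.last m)).prod
      (AlgHom.pi fun j : Fin m => Pi.evalAlgHom ℂ (fun j : Fin (m + 1) => R j) j.castSucc))
    ⟨fun f g h => funext fun j => Fin.lastCases (motive := fun j => f j = g j)
        (congrArg Prod.fst h) (fun j => congrFun (congrArg Prod.snd h) j) j,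
      fun x => ⟨Fin.lastCases (motive := fun j => R j) x.1 x.2, by
        refine Prod.ext ?_ (_root_.funext fun j => ?_)
        · exact Fin.lastCases_last (motive := fun j => R j)
        · exact Fin.lastCases_castSucc (motive := fun j => R j) j⟩⟩

end Heisenberg

end

/-- For every `d`, the `d`-th higher level Zhu algebra of the Heisenberg vertex algebra `π` is
`Mat_{p(d)}(ℂ[x]) ⊕ A_{d-1}(π)`, and hence `∏_{j=0}^d Mat_{p(j)}(ℂ[x])`, where `p(j)` is the number
of partitions of `j`. -/
theorem corollary7p3p1 (d : ℕ) :
    Nonempty (Heisenberg.HigherZhu d ≃ₐ[ℂ]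
      Matrix (Fin (Fintype.card (Nat.Partition d))) (Fin (Fintype.card (Nat.Partition d))) ℂ[X] ×
        Heisenberg.HigherZhu (d - 1)) ∧
    Nonempty (Heisenberg.HigherZhu d ≃ₐ[ℂ]
      ∀ j : Fin (d + 1), Matrix (Fin (Fintype.card (Nat.Partition j)))
        (Fin (Fintype.card (Nat.Partition j))) ℂ[X]) := by
  obtain ⟨e⟩ := Heisenberg.nonempty_higherZhu_equiv (m := d + 1) (n := d) (Nat.cast_succ d).symm
  -- For `d = 0` this is the empty product, in agreement with `A₋₁ = 0`.
  obtain ⟨e'⟩ := Heisenberg.nonempty_higherZhu_equiv (m := d) (n := d - 1) (sub_add_cancel _ _)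
  exact ⟨⟨(e.trans (Heisenberg.splitLast d fun j => Matrix (Fin (Fintype.card (Nat.Partition j)))
    (Fin (Fintype.card (Nat.Partition j))) ℂ[X])).trans (AlgEquiv.prodCongr AlgEquiv.refl e'.symm)⟩,
    ⟨e⟩⟩
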